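/- All manifolds and polyhedra are piecewise linear (PL); a polyhedron is a locally finite polyhedron, realized as a subset of some $\mathbb{R}^d$ each of whose points has a neighborhood in it that is a finite union of simplices. An \emph{open} $n$-manifold is a noncompact PL $n$-manifold without boundary. A space \emph{has finite homotopy type} if it is homotopy equivalent to a finite polyhedron $K$; it is \emph{finitely dominated} if its identity map is homotopic to a composition through a finite polyhedron. A \emph{closed polyhedral neighborhood of infinity} in a polyhedron $P$ is a closed subpolyhedron $N\subseteq P$ such that $\overline{P\setminus N}$ is compact. $P$ is \emph{1-ended} if it has exactly one end, an end being a compatible choice of a component of $P\setminus C$ for every compact $C\subseteq P$. $P$ is \emph{inward tame} if for every compact $C\subseteq P$ there is a finitely dominated closed polyhedral neighborhood of infinity disjoint from $C$. For a ring $R$, $\widetilde K_0(R)$ is the group of stable equivalence classes of finitely generated projective left $R$-modules. For a path connected space $X$, Wall's finiteness obstruction is $\sigma(X)=\sum_i(-1)^i[Q_i]\in\widetilde K_0(\mathbb{Z}[\pi_1(X)])$, where $Q_*$ is any bounded complex of finitely generated projective $\mathbb{Z}[\pi_1(X)]$-modules chain homotopy equivalent to the singular chain complex of the universal cover of $X$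 (such $Q_*$ exists if $X$ is a finitely dominated polyhedron). For a space with several path components $X^j$ one puts $\widetilde K_0(\mathbb{Z}[\pi_1(X)])=\bigoplus_j\widetilde K_0(\mathbb{Z}[\pi_1(X^j)])$ and $\sigma(X)=(\sigma(X^j))_j$. For an inward tame polyhedron $P$ and a nested cofinal sequence $N_1\supseteq N_2\supseteq\cdots$ of closed polyhedral neighborhoods of infinity, the end obstruction is $$\sigma_\infty(P)=(\sigma(N_1),\sigma(N_2),\ldots)\in\varprojlim_i\widetilde K_0(\mathbb{Z}[\pi_1(N_i)]),$$ with bonding maps induced by inclusion. \textbf{Proposition.} Let $W^n$ be a connected open $n$-manifold. If $W^n$ has finite homotopy type, then $W^n\times[0,1)$ is 1-ended and inward tame, and $\sigma_\infty(W^n\times[0,1))=0$ (for every choice of the nested cofinal sequence $\{N_i\}$). -/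

import Mathlib

open CategoryTheory Topology
open scoped TensorProduct

noncomputable section

namespace EndTheory

/-! ### Polyhedra, piecewise linear maps and PL manifolds -/

section Polyhedra

variable {E F : Type*} [AddCommGroup E] [Module ℝ E] [TopologicalSpace E]
  [AddCommGroup F] [Module ℝ F] [TopologicalSpace F]

/-- A compact (finite) polyhedron: a finite union of convex hulls of finite sets
(equivalently, of simplices). -/
def IsCompactPolyhedron (K : Set E) : Prop :=
  ∃ 𝒮 : Finset (Finset E), K = ⋃ S ∈ 𝒮, convexHull ℝ (S : Set E)

/-- A (locally finite) polyhedron in a finite dimensional vector space: a subset each of whose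
points has a neighborhood in the subset that is a compact polyhedron. -/
def IsPolyhedron (P : Set E) : Prop :=
  ∀ x ∈ P, ∃ K : Set E, IsCompactPolyhedron K ∧ K ⊆ P ∧ K ∈ 𝓝[P] x

/-- `f` is piecewise linear on `U`: every point of `U` has a neighborhood in `U` that is a finite
union of compact convex cells on each of which `f` is affine. -/
def IsPLOn (f : E → F) (U : Set E) : Prop :=
  ∀ x ∈ U, ∃ 𝒮 : Finset (Finset E),
    (∀ S ∈ 𝒮, convexHull ℝ (S : Set E) ⊆ U ∧
      ∃ φ : E →ᵃ[ℝ] F, Set.EqOn f φ (convexHull ℝ (S : Set E))) ∧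
    (⋃ S ∈ 𝒮, convexHull ℝ (S : Set E)) ∈ 𝓝[U] x

/-- A PL `n`-manifold without boundary: a polyhedron in which every point has a neighborhood that
is PL homeomorphic to an open subset of `ℝⁿ`. -/
def IsBoundarylessPLManifold (n : ℕ) (W : Set E) : Prop :=
  IsPolyhedron W ∧
  ∀ x ∈ W, ∃ (U : Set E) (V : Set (EuclideanSpace ℝ (Fin n)))
    (f : E → EuclideanSpace ℝ (Fin n)) (g : EuclideanSpace ℝ (Fin n) → E),
    U ⊆ W ∧ U ∈ 𝓝[W] x ∧ IsOpen V ∧ Set.BijOn f U V ∧ Set.InvOn g f U V ∧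
      IsPLOn f U ∧ IsPLOn g V

/-- An open `n`-manifold: a noncompact PL `n`-manifold without boundary. -/
def IsOpenPLManifold (n : ℕ) (W : Set E) : Prop :=
  IsBoundarylessPLManifold n W ∧ ¬ IsCompact W

end Polyhedra

/-! ### Finite homotopy type and finite domination -/

/-- `X` is homotopy equivalent to a finite polyhedron. -/
def HasFiniteHomotopyType (X : Type*) [TopologicalSpace X] : Prop :=
  ∃ (k : ℕ) (K : Set (EuclideanSpace ℝ (Fin k))), IsCompactPolyhedron K ∧
    Nonempty (ContinuousMap.HomotopyEquiv X K)

/-- `X` is finitely dominated: the identity of `X` factors up to homotopy through a finite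
polyhedron. -/
def IsFinitelyDominated (X : Type*) [TopologicalSpace X] : Prop :=
  ∃ (k : ℕ) (K : Set (EuclideanSpace ℝ (Fin k))), IsCompactPolyhedron K ∧
    ∃ (u : C(X, K)) (d : C(K, X)), (d.comp u).Homotopic (ContinuousMap.id X)

/-! ### Neighborhoods of infinity, ends, inward tameness -/

section Ends

variable {E : Type*} [TopologicalSpace E]

/-- An end of `P`: a compatible choice of a connected component of `P \ C` for every compact
`C ⊆ P`. -/
def IsEnd (P : Set E) (ε : {C : Set E // IsCompact C ∧ C ⊆ P} → Set E) : Prop :=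
  (∀ C, ∃ x ∈ P \ C.1, ε C = connectedComponentIn (P \ C.1) x) ∧
  ∀ C D, C.1 ⊆ D.1 → ε D ⊆ ε C

/-- `P` has exactly one end. -/
def IsOneEnded (P : Set E) : Prop := ∃! ε, IsEnd P ε

variable [AddCommGroup E] [Module ℝ E]

/-- `N` is a closed polyhedral neighborhood of infinity in `P`: a polyhedron, closed as a subset of
`P`, whose complement in `P` has compact closure in `P`. -/
structure IsPolyhedralNhdOfInfinity (P N : Set E) : Prop where
  subset : N ⊆ P
  polyhedron : IsPolyhedron N
  closed : ∃ A : Set E, IsClosed A ∧ N = P ∩ A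
  cocompact : ∃ C : Set E, IsCompact C ∧ C ⊆ P ∧ P \ N ⊆ C

/-- The polyhedron `P` is inward tame: it contains arbitrarily small finitely dominated polyhedral
neighborhoods of infinity. -/
def IsInwardTame (P : Set E) : Prop :=
  IsPolyhedron P ∧
  ∀ C : Set E, IsCompact C → C ⊆ P →
    ∃ N : Set E, IsPolyhedralNhdOfInfinity P N ∧ Disjoint N C ∧ IsFinitelyDominated N

/-- A nested cofinal sequence of closed polyhedral neighborhoods of infinity in `P`. -/
structure CofinalSequence (P : Set E) where
  nhd : ℕ → Set E
  isNhd : ∀ i, IsPolyhedralNhdOfInfinity P (nhd i)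
  nested : ∀ i, nhd (i + 1) ⊆ nhd i
  cofinal : ∀ C : Set E, IsCompact C → C ⊆ P → ∃ i, Disjoint (nhd i) C

end Ends

/-! ### The reduced projective class group -/

/-- Finitely generated projective left `R`-modules. -/
structure FGProj (R : Type) [Ring R] where
  carrier : Type
  [addCommGroup : AddCommGroup carrier]
  [module : Module R carrier]
  [finite : Module.Finite R carrier]
  [projective : Module.Projective R carrier]

attribute [instance] FGProj.addCommGroup FGProj.module FGProj.finite FGProj.projective

namespace FGProj

variable {R : Type} [Ring R]

/-- Stable equivalence: the modules become isomorphic after adding finitely generated free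
modules. -/
def StablyEquiv (M N : FGProj R) : Prop :=
  ∃ m n : ℕ, Nonempty ((M.carrier × (Fin m → R)) ≃ₗ[R] (N.carrier × (Fin n → R)))

def freeSum (R : Type) [Ring R] (m n : ℕ) :
    ((Fin m → R) × (Fin n → R)) ≃ₗ[R] (Fin (m + n) → R) :=
  (LinearEquiv.sumArrowLequivProdArrow (Fin m) (Fin n) R R).symm ≪≫ₗ
    LinearEquiv.funCongrLeft R R finSumFinEquiv.symm

theorem StablyEquiv.trans {M N L : FGProj R} (h₁ : StablyEquiv M N) (h₂ : StablyEquiv N L) :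
    StablyEquiv M L := by
  obtain ⟨a, b, ⟨e⟩⟩ := h₁
  obtain ⟨c, d, ⟨f⟩⟩ := h₂
  refine ⟨a + c, d + b, ⟨?_⟩⟩
  refine (LinearEquiv.prodCongr (.refl R _) (freeSum R a c).symm) ≪≫ₗ
    (LinearEquiv.prodAssoc R _ _ _).symm ≪≫ₗ (LinearEquiv.prodCongr e (.refl R _)) ≪≫ₗ
    LinearEquiv.prodAssoc R _ _ _ ≪≫ₗ
    LinearEquiv.prodCongr (.refl R _) (LinearEquiv.prodComm R _ _) ≪≫ₗ
    (LinearEquiv.prodAssoc R _ _ _).symm ≪≫ₗ (LinearEquiv.prodCongr f (.refl R _)) ≪≫ₗ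
    LinearEquiv.prodAssoc R _ _ _ ≪≫ₗ LinearEquiv.prodCongr (.refl R _) (freeSum R d b)

instance stableSetoid (R : Type) [Ring R] : Setoid (FGProj R) where
  r := StablyEquiv
  iseqv := ⟨fun _ => ⟨0, 0, ⟨.refl R _⟩⟩, fun ⟨m, n, ⟨e⟩⟩ => ⟨n, m, ⟨e.symm⟩⟩,
    StablyEquiv.trans⟩

theorem stablyEquiv_of_equiv {M N : FGProj R} (e : M.carrier ≃ₗ[R] N.carrier) : M ≈ N :=
  ⟨0, 0, ⟨LinearEquiv.prodCongr e (.refl R _)⟩⟩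

/-- Direct sum. -/
def prod (M N : FGProj R) : FGProj R := ⟨M.carrier × N.carrier⟩

/-- The zero module. -/
def zero (R : Type) [Ring R] : FGProj R := ⟨PUnit⟩

/-- The free module `Rⁿ`. -/
def free (R : Type) [Ring R] (n : ℕ) : FGProj R := ⟨Fin n → R⟩

def swapMid (A B C D : Type) [AddCommGroup A] [AddCommGroup B] [AddCommGroup C] [AddCommGroup D]
    [Module R A] [Module R B] [Module R C] [Module R D] :
    ((A × B) × (C × D)) ≃ₗ[R] ((A × C) × (B × D)) :=
  LinearEquiv.prodProdProdComm R A B C D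

theorem prod_congr {M M' N N' : FGProj R} (h₁ : M ≈ M') (h₂ : N ≈ N') :
    M.prod N ≈ M'.prod N' := by
  obtain ⟨a, b, ⟨e⟩⟩ := h₁
  obtain ⟨c, d, ⟨f⟩⟩ := h₂
  refine ⟨a + c, b + d, ⟨?_⟩⟩
  exact (LinearEquiv.prodCongr (.refl R _) (freeSum R a c).symm) ≪≫ₗ
    swapMid _ _ _ _ ≪≫ₗ LinearEquiv.prodCongr e f ≪≫ₗ swapMid _ _ _ _ ≪≫ₗ
    LinearEquiv.prodCongr (.refl R _) (freeSum R b d)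

theorem free_equiv_zero (n : ℕ) : free R n ≈ zero R :=
  ⟨0, n, ⟨LinearEquiv.prodComm R _ _ ≪≫ₗ
    LinearEquiv.prodCongr ⟨⟨⟨fun _ => PUnit.unit, fun _ _ => rfl⟩, fun _ _ => rfl⟩,
      fun _ => 0, fun _ => Subsingleton.elim _ _, fun _ => rfl⟩ (.refl R _)⟩⟩

theorem exists_complement (M : FGProj R) :
    ∃ (N : FGProj R) (n : ℕ), Nonempty ((N.carrier × M.carrier) ≃ₗ[R] (Fin n → R)) := by
  obtain ⟨n, f, hf⟩ := Module.Finite.exists_fin' R M.carrier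
  obtain ⟨g, hg⟩ := Module.projective_lifting_property f LinearMap.id hf
  have hgi : Function.LeftInverse f g := fun x => by
    simpa using congrArg (fun h => h x) hg
  have hc : IsCompl (LinearMap.ker f) (LinearMap.range g) := by
    constructor
    · rw [Submodule.disjoint_def]
      rintro x hx ⟨y, rfl⟩
      rw [LinearMap.mem_ker, hgi y] at hx
      simp [hx]
    · rw [codisjoint_iff, eq_top_iff]
      intro x _
      refine Submodule.mem_sup.2 ⟨x - g (f x), ?_, g (f x), ⟨f x, rfl⟩, by simp⟩
      simp [hgi (f x)]
  let e : (LinearMap.ker f × M.carrier) ≃ₗ[R] (Fin n → R) :=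
    LinearEquiv.prodCongr (.refl R _)
      (LinearEquiv.ofInjective g hgi.injective) ≪≫ₗ
      Submodule.prodEquivOfIsCompl _ _ hc
  have hsp : Function.LeftInverse ((LinearMap.fst R _ _).comp e.symm.toLinearMap)
      (e.toLinearMap.comp (LinearMap.inl R (LinearMap.ker f) M.carrier)) := fun x => by simp
  have : Module.Projective R (LinearMap.ker f) :=
    Module.Projective.of_split (e.toLinearMap.comp (LinearMap.inl R (LinearMap.ker f) M.carrier))
      ((LinearMap.fst R _ _).comp e.symm.toLinearMap) (LinearMap.ext fun x => hsp x)
  have : Module.Finite R (LinearMap.ker f) :=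
    Module.Finite.of_surjective ((LinearMap.fst R _ _).comp e.symm.toLinearMap) hsp.surjective
  exact ⟨⟨LinearMap.ker f⟩, n, ⟨e⟩⟩

end FGProj

/-- The reduced projective class group `K̃₀(R)`: stable equivalence classes of finitely generated
projective left `R`-modules, with direct sum as addition. -/
def KTilde (R : Type) [Ring R] : Type 1 := Quotient (FGProj.stableSetoid R)

namespace KTilde

variable {R S : Type} [Ring R] [Ring S]

/-- The class of a module. -/
def of (M : FGProj R) : KTilde R := Quotient.mk _ M

instance : Zero (KTilde R) := ⟨of (.zero R)⟩

instance : Add (KTilde R) := ⟨Quotient.map₂ FGProj.prod fun _ _ h _ _ h' => FGProj.prod_congr h h'⟩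

theorem of_add (M N : FGProj R) : of M + of N = of (M.prod N) := rfl

protected theorem add_comm' (x y : KTilde R) : x + y = y + x := by
  refine Quotient.inductionOn₂ x y fun M N => Quotient.sound ?_
  exact FGProj.stablyEquiv_of_equiv (LinearEquiv.prodComm R _ _)

protected theorem zero_add' (x : KTilde R) : 0 + x = x := by
  refine Quotient.inductionOn x fun M => Quotient.sound ?_
  exact FGProj.stablyEquiv_of_equiv
    ⟨⟨⟨fun p => p.2, fun _ _ => rfl⟩, fun _ _ => rfl⟩, fun m => (PUnit.unit, m),
      fun _ => rfl, fun _ => rfl⟩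

protected theorem exists_neg (x : KTilde R) : ∃ y : KTilde R, y + x = 0 := by
  refine Quotient.inductionOn x fun M => ?_
  obtain ⟨N, n, ⟨e⟩⟩ := M.exists_complement
  refine ⟨of N, Quotient.sound ?_⟩
  exact (FGProj.stablyEquiv_of_equiv (N := FGProj.free R n) e).trans (FGProj.free_equiv_zero n)

instance : Neg (KTilde R) := ⟨fun x => (KTilde.exists_neg x).choose⟩

instance : AddCommGroup (KTilde R) where
  add_assoc x y z := by
    refine Quotient.inductionOn₃ x y z fun M N L => Quotient.sound ?_
    exact FGProj.stablyEquiv_of_equiv (LinearEquiv.prodAssoc R _ _ _)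
  zero_add := KTilde.zero_add'
  add_zero x := by rw [KTilde.add_comm', KTilde.zero_add']
  nsmul := nsmulRec
  zsmul := zsmulRec
  neg_add_cancel x := (KTilde.exists_neg x).choose_spec
  add_comm := KTilde.add_comm'

end KTilde

/-! ### Base change along a homomorphism of (noncommutative) rings -/

section BaseChange

variable {R S : Type} [Ring R] [Ring S] (f : R →+* S)

/-- `S ⊗_R M`, as the quotient of `S ⊗_ℤ M` by the relations `s f(r) ⊗ m = s ⊗ r m`. -/
def BaseChange (M : Type) [AddCommGroup M] [Module R M] : Type :=
  (S ⊗[ℤ] M) ⧸ Submodule.span S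
    {z : S ⊗[ℤ] M | ∃ (s : S) (r : R) (m : M), z = (s * f r) ⊗ₜ[ℤ] m - s ⊗ₜ[ℤ] (r • m)}

namespace BaseChange

variable (M : Type) [AddCommGroup M] [Module R M] {N : Type} [AddCommGroup N] [Module R N]
  {Q : Type} [AddCommGroup Q] [Module S Q]

instance : AddCommGroup (BaseChange f M) := inferInstanceAs (AddCommGroup (_ ⧸ _))
instance : Module S (BaseChange f M) := inferInstanceAs (Module S (_ ⧸ _))

/-- The `f`-semilinear map `m ↦ 1 ⊗ m`. -/
def unit : M →ₛₗ[f] BaseChange f M where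
  toFun m := Submodule.Quotient.mk ((1 : S) ⊗ₜ[ℤ] m)
  map_add' m m' := by rw [TensorProduct.tmul_add]; rfl
  map_smul' r m := by
    have h : (Submodule.Quotient.mk ((1 : S) ⊗ₜ[ℤ] (r • m)) : BaseChange f M) =
        Submodule.Quotient.mk ((1 * f r : S) ⊗ₜ[ℤ] m) :=
      ((Submodule.Quotient.eq (Submodule.span S {z : S ⊗[ℤ] M | ∃ (s : S) (r : R) (m : M),
        z = (s * f r) ⊗ₜ[ℤ] m - s ⊗ₜ[ℤ] (r • m)})).2
        (Submodule.subset_span ⟨1, r, m, rfl⟩)).symm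
    refine h.trans ?_
    rw [one_mul]
    change _ = Submodule.Quotient.mk (f r • ((1 : S) ⊗ₜ[ℤ] m))
    rw [TensorProduct.smul_tmul', smul_eq_mul, mul_one]

variable {M f}

theorem hom_ext {g h : BaseChange f M →ₗ[S] Q} (H : ∀ m, g (unit f M m) = h (unit f M m)) :
    g = h := by
  refine Submodule.linearMap_qext _ (LinearMap.ext fun z => ?_)
  induction z using TensorProduct.induction_on with
  | zero => simp
  | add x y hx hy => rw [map_add, map_add, hx, hy]
  | tmul s m =>
    have : s ⊗ₜ[ℤ] m = s • ((1 : S) ⊗ₜ[ℤ] m) := by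
      rw [TensorProduct.smul_tmul', smul_eq_mul, mul_one]
    rw [this, map_smul, map_smul]
    exact congrArg (s • ·) (H m)

/-- The universal property. -/
def lift (g : M →ₛₗ[f] Q) : BaseChange f M →ₗ[S] Q :=
  Submodule.liftQ _
    ({ toFun := TensorProduct.lift
          (LinearMap.mk₂ ℤ (fun (s : S) (m : M) => s • g m)
            (fun _ _ _ => add_smul _ _ _) (fun c s m => by rw [smul_assoc])
            (fun _ _ _ => by rw [map_add, smul_add])
            (fun c s m => by rw [map_zsmul, smul_comm]))
       map_add' := fun x y => map_add _ x y
       map_smul' := fun s z => by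
        induction z using TensorProduct.induction_on with
        | zero => simp
        | add x y hx hy => simp only [smul_add, map_add, hx, hy]
        | tmul t m => simp [TensorProduct.smul_tmul', mul_smul] } : S ⊗[ℤ] M →ₗ[S] Q)
    (by
      rw [Submodule.span_le]
      rintro _ ⟨s, r, m, rfl⟩
      simp [mul_smul])

@[simp] theorem lift_unit (g : M →ₛₗ[f] Q) (m : M) : lift g (unit f M m) = g m := by
  change (1 : S) • g m = g m
  rw [one_smul]

def congr (e : M ≃ₗ[R] N) : BaseChange f M ≃ₗ[S] BaseChange f N :=
  LinearEquiv.ofLinearMap (lift ((unit f N).comp e.toLinearMap))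
    (lift ((unit f M).comp e.symm.toLinearMap))
    (hom_ext fun m => by simp) (hom_ext fun m => by simp)

variable (f M N) in
def prodEquiv : BaseChange f (M × N) ≃ₗ[S] (BaseChange f M × BaseChange f N) :=
  LinearEquiv.ofLinearMap
    (LinearMap.prod (lift ((unit f M).comp (LinearMap.fst R M N)))
      (lift ((unit f N).comp (LinearMap.snd R M N))))
    (LinearMap.coprod (lift ((unit f (M × N)).comp (LinearMap.inl R M N)))
      (lift ((unit f (M × N)).comp (LinearMap.inr R M N))))
    (LinearMap.prod_ext (hom_ext fun m => by simp) (hom_ext fun m => by simp))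
    (hom_ext fun m => by simp [← map_add])

variable (f) in
def freeEquiv (n : ℕ) : BaseChange f (Fin n → R) ≃ₗ[S] (Fin n → S) :=
  LinearEquiv.ofLinearMap
    (lift { toFun := fun v i => f (v i)
            map_add' := fun v w => by ext; simp
            map_smul' := fun r v => by ext; simp })
    (Fintype.linearCombination S fun i => unit f (Fin n → R) (Pi.single i 1))
    (by
      refine LinearMap.pi_ext' fun i => LinearMap.ext_ring ?_
      ext j
      by_cases h : j = i
      · subst h; simp [Fintype.linearCombination_apply, Pi.single_apply]
      · simp [Fintype.linearCombination_apply, Pi.single_apply, h])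
    (hom_ext fun v => by
      have hv : v = ∑ i, v i • (Pi.single i (1 : R) : Fin n → R) := by
        ext j; simp [Finset.sum_apply, Pi.single_apply]
      conv_rhs => rw [LinearMap.id_apply, hv, map_sum]
      simp [Fintype.linearCombination_apply])

end BaseChange

end BaseChange

namespace FGProj

variable {R S : Type} [Ring R] [Ring S] (f : R →+* S)

theorem baseChange_split (M : FGProj R) :
    ∃ (n : ℕ) (p : (Fin n → S) →ₗ[S] BaseChange f M.carrier)
      (i : BaseChange f M.carrier →ₗ[S] (Fin n → S)), p.comp i = LinearMap.id := by
  obtain ⟨N, n, ⟨e⟩⟩ := M.exists_complement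
  let e' : (BaseChange f N.carrier × BaseChange f M.carrier) ≃ₗ[S] (Fin n → S) :=
    (BaseChange.prodEquiv f _ _).symm ≪≫ₗ BaseChange.congr e ≪≫ₗ BaseChange.freeEquiv f n
  refine ⟨n, (LinearMap.snd S _ _).comp e'.symm.toLinearMap,
    e'.toLinearMap.comp (LinearMap.inr S _ _), ?_⟩
  ext x
  simp

/-- Base change `S ⊗_R M` of a finitely generated projective module. -/
def baseChange (M : FGProj R) : FGProj S where
  carrier := BaseChange f M.carrier
  finite := by
    obtain ⟨n, p, i, h⟩ := M.baseChange_split f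
    exact Module.Finite.of_surjective p
      (Function.LeftInverse.surjective (g := i) fun x => congrArg (fun h => h x) h)
  projective := by
    obtain ⟨n, p, i, h⟩ := M.baseChange_split f
    exact Module.Projective.of_split i p h

theorem baseChange_congr {M N : FGProj R} (h : M ≈ N) : M.baseChange f ≈ N.baseChange f := by
  obtain ⟨m, n, ⟨e⟩⟩ := h
  exact ⟨m, n, ⟨LinearEquiv.prodCongr (.refl S _) (BaseChange.freeEquiv f m).symm ≪≫ₗ
    (BaseChange.prodEquiv f _ _).symm ≪≫ₗ BaseChange.congr e ≪≫ₗ BaseChange.prodEquiv f _ _ ≪≫ₗ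
    LinearEquiv.prodCongr (.refl S _) (BaseChange.freeEquiv f n)⟩⟩

end FGProj

/-- The functoriality of `K̃₀`: the homomorphism `[M] ↦ [S ⊗_R M]`. -/
def KTilde.map {R S : Type} [Ring R] [Ring S] (f : R →+* S) : KTilde R →+ KTilde S :=
  AddMonoidHom.mk' (Quotient.map (FGProj.baseChange f) fun _ _ h => FGProj.baseChange_congr f h)
    fun x y => Quotient.inductionOn₂ x y fun _ _ =>
      Quotient.sound (FGProj.stablyEquiv_of_equiv (BaseChange.prodEquiv f _ _))

/-! ### The singular chain complex of the universal cover -/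

section UniversalCover

variable (X : Type) [TopologicalSpace X] (x₀ : X)

/-- The integral group ring of the fundamental group. -/
abbrev GroupRing : Type := MonoidAlgebra ℤ (FundamentalGroup X x₀)

/-- A map of `A` into the universal cover of (the path component of `x₀` in) `X`. A point of the
universal cover is a point `x` of `X` with a homotopy class of paths between `x` and `x₀`; so a map
of a simplex `A` into it is a map to `X` with a choice of such a class over every point of `A`
that is compatible with transport along the paths of `A`. -/
@[ext]
structure CoverMap (A : Type) [TopologicalSpace A] where
  toMap : C(A, X)
  lift : ∀ a, Path.Homotopic.Quotient (toMap a) x₀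
  compat : ∀ (a b : A) (p : Path a b),
    lift a = (Path.Homotopic.Quotient.mk (p.map toMap.continuous)).trans (lift b)

namespace CoverMap

variable {X x₀} {A B : Type} [TopologicalSpace A] [TopologicalSpace B]

/-- Precomposition. -/
def precomp (c : CoverMap X x₀ B) (φ : C(A, B)) : CoverMap X x₀ A where
  toMap := c.toMap.comp φ
  lift a := c.lift (φ a)
  compat a b p := c.compat (φ a) (φ b) (p.map φ.continuous)

theorem precomp_eq (c : CoverMap X x₀ A) (φ : C(A, A)) (h : φ = .id A) : c.precomp φ = c := by
  subst h; rfl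

theorem precomp_comp_eq {D : Type} [TopologicalSpace D] (c : CoverMap X x₀ D) (φ : C(B, D))
    (ψ : C(A, B)) (χ : C(A, D)) (h : χ = φ.comp ψ) :
    c.precomp χ = (c.precomp φ).precomp ψ := by
  subst h; rfl

/-- The fundamental group acts by deck transformations. (Mathlib's product `p * q` of loops is
`q` followed by `p`, hence a left action.) -/
instance : MulAction (FundamentalGroup X x₀) (CoverMap X x₀ A) where
  smul g c := ⟨c.toMap, fun a => (c.lift a).trans g.toPath, fun a b p => by
    rw [c.compat a b p, Path.Homotopic.Quotient.trans_assoc]⟩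
  one_smul c := CoverMap.ext rfl (heq_of_eq (funext fun a =>
    Path.Homotopic.Quotient.trans_refl (c.lift a)))
  mul_smul g h c := CoverMap.ext rfl (heq_of_eq (funext fun a =>
    (Path.Homotopic.Quotient.trans_assoc (c.lift a) h.toPath g.toPath).symm))

end CoverMap

/-- The singular simplicial set of the universal cover, with its action of the fundamental
group. -/
def coverSingularSet : SimplicialObject (Action (Type) (FundamentalGroup X x₀)) where
  obj n := Action.ofMulAction (FundamentalGroup X x₀)
    (CoverMap X x₀ (SimplexCategory.toTop₀.obj n.unop))
  map φ := ⟨↾fun c => c.precomp (SimplexCategory.toTop₀.map φ.unop).hom, fun _ => rfl⟩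
  map_id n := Action.hom_ext _ _ (by
    ext c
    exact CoverMap.precomp_eq c _ (by rw [unop_id, SimplexCategory.toTop₀.map_id]; rfl))
  map_comp φ ψ := Action.hom_ext _ _ (by
    ext c
    exact CoverMap.precomp_comp_eq c _ _ _
      (by rw [unop_comp, SimplexCategory.toTop₀.map_comp]; rfl))

/-- The singular chain complex of the universal cover of `X`, a complex of left
`ℤ[π₁(X, x₀)]`-modules. -/
def coverChains : ChainComplex (ModuleCat.{0} (GroupRing X x₀)) ℕ :=
  (AlgebraicTopology.alternatingFaceMapComplex _).obj
    (((SimplicialObject.whiskering _ _).obj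
      (Rep.linearization ℤ (FundamentalGroup X x₀) ⋙ Rep.toModuleMonoidAlgebra)).obj
      (coverSingularSet X x₀))

end UniversalCover

/-! ### Wall's finiteness obstruction -/

/-- A bounded chain complex of finitely generated projective modules. -/
structure FGProjComplex (R : Type) [Ring R] where
  complex : ChainComplex (ModuleCat.{0} R) ℕ
  finite : ∀ i, Module.Finite R (complex.X i)
  projective : ∀ i, Module.Projective R (complex.X i)
  bound : ℕ
  vanish : ∀ i, bound < i → Subsingleton (complex.X i)

/-- The class `∑ (-1)ⁱ [Qᵢ]` in the reduced projective class group. -/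
def FGProjComplex.eulerClass {R : Type} [Ring R] (Q : FGProjComplex R) : KTilde R :=
  ∑ i ∈ Finset.range (Q.bound + 1), (-1 : ℤ) ^ i •
    KTilde.of (@FGProj.mk R _ (Q.complex.X i) _ _ (Q.finite i) (Q.projective i))

/-- `z` is Wall's finiteness obstruction of the path component of `x₀` in `X`: the chain complex of
its universal cover is chain homotopy equivalent to a bounded complex `Q` of finitely generated
projective modules, and `z = ∑ (-1)ⁱ [Qᵢ]`. (Such a `Q` exists for every finitely dominated `X`,
and `z` does not depend on `Q`.) -/
def IsFinitenessObstructionAt (X : Type) [TopologicalSpace X] (x₀ : X)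
    (z : KTilde (GroupRing X x₀)) : Prop :=
  ∃ Q : FGProjComplex (GroupRing X x₀),
    Nonempty (HomotopyEquiv (coverChains X x₀) Q.complex) ∧ z = Q.eulerClass

section Pi0

variable (X : Type) [TopologicalSpace X]

/-- A chosen base point in a path component. -/
def basePt {X : Type} [TopologicalSpace X] (c : ZerothHomotopy X) : X := Quotient.out c

/-- `K̃₀(ℤ[π₁(X)])`, the direct sum over the path components of `X`. -/
abbrev KTildePi : Type 1 :=
  DirectSum (ZerothHomotopy X) fun c => KTilde (GroupRing X (basePt c))

variable {X}

/-- `σ(X) = z`: Wall's finiteness obstruction of a possibly disconnected space. -/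
def IsFinitenessObstruction (z : KTildePi X) : Prop :=
  ∀ c : ZerothHomotopy X, IsFinitenessObstructionAt X (basePt c) (z c)

variable {Y : Type} [TopologicalSpace Y]

/-- The component of `Y` into which `f` maps the component `c` of `X`. -/
def mapComponent (f : C(X, Y)) (c : ZerothHomotopy X) : ZerothHomotopy Y :=
  Quotient.mk _ (f (basePt c))

theorem joined_basePt (f : C(X, Y)) (c : ZerothHomotopy X) :
    Joined (f (basePt c)) (basePt (mapComponent f c)) :=
  (Quotient.exact (Quotient.out_eq (mapComponent f c))).symm

/-- The homomorphism of fundamental groups induced by `f` on the component `c`, after a change of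
base point. -/
def mapPi (f : C(X, Y)) (c : ZerothHomotopy X) :
    FundamentalGroup X (basePt c) →* FundamentalGroup Y (basePt (mapComponent f c)) :=
  (FundamentalGroup.fundamentalGroupMulEquivOfPath
    (joined_basePt f c).somePath).toMonoidHom.comp (FundamentalGroup.map f (basePt c))

open scoped Classical in
/-- The homomorphism `K̃₀(ℤ[π₁(X)]) → K̃₀(ℤ[π₁(Y)])` induced by `f`. -/
def KTildePi.map (f : C(X, Y)) : KTildePi X →+ KTildePi Y :=
  DirectSum.toAddMonoid fun c =>
    (DirectSum.of (fun d => KTilde (GroupRing Y (basePt d))) (mapComponent f c)).comp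
      (KTilde.map (MonoidAlgebra.mapDomainRingHom ℤ (mapPi f c)))

end Pi0

/-! ### The end obstruction -/

section EndObstruction

variable {E : Type} [TopologicalSpace E] [AddCommGroup E] [Module ℝ E] {P : Set E}

/-- The inverse limit of the groups `K̃₀(ℤ[π₁(Nᵢ)])`, with bonding maps induced by inclusion. -/
def limKTilde (𝒩 : CofinalSequence P) : AddSubgroup (∀ i, KTildePi (𝒩.nhd i)) where
  carrier := {s | ∀ i, KTildePi.map
    ⟨Set.inclusion (𝒩.nested i), continuous_inclusion (𝒩.nested i)⟩ (s (i + 1)) = s i}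
  zero_mem' i := by simp
  add_mem' hs ht i := by simp [hs i, ht i]
  neg_mem' hs i := by simp [hs i]

/-- `σ_∞(P) = s`, computed from the sequence `𝒩`: the `i`-th coordinate of `s` is the finiteness
obstruction of the `i`-th neighborhood of infinity. -/
def IsEndObstruction (𝒩 : CofinalSequence P) (s : limKTilde 𝒩) : Prop :=
  ∀ i, IsFinitenessObstruction (s.1 i)

end EndObstruction

end EndTheory

end

noncomputable section

namespace EndTheory

/-! ### Chain complexes of modules: elementwise homology -/

section Elementwise

variable {R : Type} [Ring R] {C D : ChainComplex (ModuleCat.{0} R) ℕ}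

/-- `z` is a cycle. -/
def IsCycle {n : ℕ} (z : C.X n) : Prop := ∀ j, C.d n j z = 0

/-- `z` is a boundary. -/
def IsBdry {n : ℕ} (z : C.X n) : Prop := ∃ w : C.X (n + 1), C.d (n + 1) n w = z

theorem d_d_apply (i j k : ℕ) (x : C.X i) : C.d j k (C.d i j x) = 0 := by
  rw [← ConcreteCategory.comp_apply, C.d_comp_d]; rfl

theorem hom_d_apply (f : C ⟶ D) (i j : ℕ) (x : C.X i) :
    D.d i j (f.f i x) = f.f j (C.d i j x) := by
  rw [← ConcreteCategory.comp_apply, ← ConcreteCategory.comp_apply, f.comm]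

theorem isCycle_zero_degree (z : C.X 0) : IsCycle z := fun _ => by
  rw [C.shape 0 _ (by simp)]; rfl

theorem isCycle_succ {n : ℕ} {z : C.X (n + 1)} (h : C.d (n + 1) n z = 0) : IsCycle z := fun j => by
  by_cases hj : j = n
  · subst hj; exact h
  · rw [C.shape _ j (by simpa using hj)]; rfl

theorem IsCycle.map (f : C ⟶ D) {n : ℕ} {z : C.X n} (h : IsCycle z) : IsCycle (f.f n z) :=
  fun j => by rw [hom_d_apply, h j, map_zero]

theorem IsCycle.add {n : ℕ} {z w : C.X n} (h : IsCycle z) (h' : IsCycle w) : IsCycle (z + w) :=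
  fun j => by rw [map_add, h j, h' j, add_zero]

theorem exists_cycles {n : ℕ} {z : C.X n} (h : IsCycle z) : ∃ c : C.cycles n, C.iCycles n c = z := by
  refine ⟨(C.sc n).moduleCatCyclesIso.inv ⟨z, h _⟩, ?_⟩
  exact ConcreteCategory.congr_hom (C.sc n).moduleCatCyclesIso_inv_iCycles
    (⟨z, h _⟩ : (C.sc n).moduleCatLeftHomologyData.K)

theorem isCycle_iCycles {n : ℕ} (c : C.cycles n) : IsCycle (C.iCycles n c) := fun j => by
  rw [← ConcreteCategory.comp_apply, C.iCycles_d]; rfl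

theorem exists_prev_iff {n i : ℕ} (hi : i = n + 1) (z : C.X n) :
    (∃ w : C.X i, C.d i n w = z) ↔ IsBdry z := by
  subst hi; rfl

theorem homologyπ_eq_zero_iff {n : ℕ} (c : C.cycles n) :
    C.homologyπ n c = 0 ↔ IsBdry (C.iCycles n c) := by
  have hex := (ShortComplex.exact_of_g_is_cokernel
    (ShortComplex.mk _ _ (C.toCycles_comp_homologyπ ((ComplexShape.down ℕ).prev n) n))
    (C.homologyIsCokernel _ n rfl))
  rw [ShortComplex.moduleCat_exact_iff] at hex
  rw [← exists_prev_iff (ChainComplex.prev ℕ n)]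
  constructor
  · intro h
    obtain ⟨w, hw⟩ := hex c h
    refine ⟨w, ?_⟩
    have hw : C.toCycles _ n w = c := hw
    rw [← hw, ← ConcreteCategory.comp_apply, C.toCycles_i]
  · rintro ⟨w, hw⟩
    have : C.toCycles _ n w = c := by
      apply (ModuleCat.mono_iff_injective (C.iCycles n)).1 inferInstance
      rw [← ConcreteCategory.comp_apply, C.toCycles_i, hw]
    rw [← this, ← ConcreteCategory.comp_apply, C.toCycles_comp_homologyπ]; rfl

theorem homologyπ_surjective (n : ℕ) : Function.Surjective (C.homologyπ n) :=
  (ModuleCat.epi_iff_surjective _).1 inferInstance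

theorem homologyMap_π (f : C ⟶ D) {n : ℕ} (c : C.cycles n) :
    HomologicalComplex.homologyMap f n (C.homologyπ n c) =
      D.homologyπ n (HomologicalComplex.cyclesMap f n c) := by
  rw [← ConcreteCategory.comp_apply, ← ConcreteCategory.comp_apply,
    HomologicalComplex.homologyπ_naturality]

theorem iCycles_cyclesMap (f : C ⟶ D) {n : ℕ} (c : C.cycles n) :
    D.iCycles n (HomologicalComplex.cyclesMap f n c) = f.f n (C.iCycles n c) := by
  rw [← ConcreteCategory.comp_apply, ← ConcreteCategory.comp_apply,
    HomologicalComplex.cyclesMap_i]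

theorem quasiIso_iff_elementwise (f : C ⟶ D) : QuasiIso f ↔
    (∀ n (z : D.X n), IsCycle z → ∃ c : C.X n, IsCycle c ∧ IsBdry (z - f.f n c)) ∧
    (∀ n (c : C.X n), IsCycle c → IsBdry (f.f n c) → IsBdry c) := by
  rw [quasiIso_iff]
  simp only [quasiIsoAt_iff_isIso_homologyMap, ConcreteCategory.isIso_iff_bijective]
  constructor
  · intro h
    constructor
    · intro n z hz
      obtain ⟨z', rfl⟩ := exists_cycles hz
      obtain ⟨y, hy⟩ := (h n).2 (D.homologyπ n z')
      obtain ⟨c, rfl⟩ := homologyπ_surjective n y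
      refine ⟨C.iCycles n c, isCycle_iCycles c, ?_⟩
      rw [homologyMap_π] at hy
      rw [← iCycles_cyclesMap, ← map_sub, ← homologyπ_eq_zero_iff, map_sub, hy, sub_self]
    · intro n c hc hb
      obtain ⟨c', rfl⟩ := exists_cycles hc
      rw [← homologyπ_eq_zero_iff]
      refine (h n).1 ?_
      rw [homologyMap_π, map_zero, homologyπ_eq_zero_iff, iCycles_cyclesMap]
      exact hb
  · rintro ⟨h₁, h₂⟩ n
    constructor
    · rw [injective_iff_map_eq_zero]
      intro y hy
      obtain ⟨c, rfl⟩ := homologyπ_surjective n y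
      rw [homologyMap_π, homologyπ_eq_zero_iff, iCycles_cyclesMap] at hy
      exact (homologyπ_eq_zero_iff c).2 (h₂ n _ (isCycle_iCycles c) hy)
    · intro y
      obtain ⟨z, rfl⟩ := homologyπ_surjective n y
      obtain ⟨c, hc, hb⟩ := h₁ n _ (isCycle_iCycles z)
      obtain ⟨c', rfl⟩ := exists_cycles hc
      refine ⟨C.homologyπ n c', ?_⟩
      rw [homologyMap_π]
      rw [← iCycles_cyclesMap, ← map_sub, ← homologyπ_eq_zero_iff, map_sub, sub_eq_zero] at hb
      exact hb.symm

theorem quasiIso_of_bijective (f : C ⟶ D) (h : ∀ n, Function.Bijective (f.f n)) : QuasiIso f := by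
  rw [quasiIso_iff_elementwise]
  constructor
  · intro n z hz
    obtain ⟨c, rfl⟩ := (h n).2 z
    refine ⟨c, fun j => (h j).1 ?_, 0, by simp⟩
    rw [← hom_d_apply, hz j, map_zero]
  · rintro n c hc ⟨w, hw⟩
    obtain ⟨w, rfl⟩ := (h _).2 w
    exact ⟨w, (h n).1 (by rw [← hom_d_apply, hw])⟩

end Elementwise

/-! ### Complexes of finite free type -/

section FiniteFree

variable {R : Type} [Ring R]

/-- A bounded chain complex of finitely generated free modules. -/
structure IsFiniteFree (Q : ChainComplex (ModuleCat.{0} R) ℕ) : Prop where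
  finite : ∀ i, Module.Finite R (Q.X i)
  free : ∀ i, Module.Free R (Q.X i)
  bounded : ∃ b, ∀ i, b < i → Subsingleton (Q.X i)

/-- `C` is quasi-isomorphic to a bounded complex of finitely generated free modules. -/
def HasFiniteFreeType (C : ChainComplex (ModuleCat.{0} R) ℕ) : Prop :=
  ∃ (Q : ChainComplex (ModuleCat.{0} R) ℕ) (f : Q ⟶ C), IsFiniteFree Q ∧ QuasiIso f

theorem HasFiniteFreeType.of_quasiIso {C D : ChainComplex (ModuleCat.{0} R) ℕ}
    (h : HasFiniteFreeType C) (f : C ⟶ D) (hf : QuasiIso f) : HasFiniteFreeType D := by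
  obtain ⟨Q, q, hQ, hq⟩ := h
  exact ⟨Q, q ≫ f, hQ, inferInstance⟩

theorem hasFiniteFreeType_of_subsingleton {C : ChainComplex (ModuleCat.{0} R) ℕ}
    (h : ∀ n, Subsingleton (C.X n)) : HasFiniteFreeType C := by
  refine ⟨C, 𝟙 C, ⟨fun i => ?_, fun i => ?_, 0, fun i _ => h i⟩, inferInstance⟩
  · have := h i; infer_instance
  · have := h i; infer_instance

end FiniteFree

end EndTheory

end

noncomputable section

namespace EndTheory

/-! ### The Mayer–Vietoris property of complexes of finite free type -/

namespace MVCone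

variable {R : Type} [Ring R] {Q Q₁ Q₂ : ChainComplex (ModuleCat.{0} R) ℕ}

/-- The module of degree `n - 1`, zero for `n = 0`. -/
abbrev predX (Q : ChainComplex (ModuleCat.{0} R) ℕ) : ℕ → ModuleCat.{0} R
  | 0 => ModuleCat.of R PUnit
  | n + 1 => Q.X n

def predD (Q : ChainComplex (ModuleCat.{0} R) ℕ) : ∀ n, Q.X n →ₗ[R] predX Q n
  | 0 => 0
  | n + 1 => (Q.d (n + 1) n).hom

theorem predD_d (n : ℕ) (a : Q.X (n + 1)) : predD Q n (Q.d (n + 1) n a) = 0 := by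
  cases n with
  | zero => rfl
  | succ n => exact d_d_apply _ _ _ a

theorem isCycle_of_predD {n : ℕ} {a : Q.X n} (h : predD Q n a = 0) : IsCycle a := by
  cases n with
  | zero => exact isCycle_zero_degree a
  | succ n => exact isCycle_succ h

theorem predD_eq_zero {n : ℕ} {a : Q.X n} (h : IsCycle a) : predD Q n a = 0 := by
  cases n with
  | zero => rfl
  | succ n => exact h n

variable (g₁ : Q ⟶ Q₁) (g₂ : Q ⟶ Q₂)

/-- The differential of the mapping cone. -/
def coneD (n : ℕ) : (Q.X n × Q₁.X (n + 1) × Q₂.X (n + 1)) →ₗ[R] (predX Q n × Q₁.X n × Q₂.X n) :=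
  LinearMap.prod (-(predD Q n ∘ₗ LinearMap.fst R (Q.X n) _))
    (LinearMap.prod
      ((g₁.f n).hom ∘ₗ LinearMap.fst R (Q.X n) _ +
        (Q₁.d (n + 1) n).hom ∘ₗ LinearMap.fst R _ _ ∘ₗ LinearMap.snd R (Q.X n) _)
      ((g₂.f n).hom ∘ₗ LinearMap.fst R (Q.X n) _ +
        (Q₂.d (n + 1) n).hom ∘ₗ LinearMap.snd R _ _ ∘ₗ LinearMap.snd R (Q.X n) _))

theorem coneD_coneD (n : ℕ) (x : Q.X (n + 1) × Q₁.X (n + 2) × Q₂.X (n + 2)) :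
    coneD g₁ g₂ n (coneD g₁ g₂ (n + 1) x) = 0 := by
  obtain ⟨a, b₁, b₂⟩ := x
  refine Prod.ext ?_ (Prod.ext ?_ ?_)
  · change -(predD Q n (-(predD Q (n + 1) a))) = 0
    rw [map_neg, neg_neg]
    exact predD_d n a
  · change g₁.f n (-(Q.d (n + 1) n a)) + Q₁.d (n + 1) n (g₁.f (n + 1) a +
      Q₁.d (n + 2) (n + 1) b₁) = 0
    rw [map_neg, map_add, d_d_apply, hom_d_apply, add_zero, neg_add_cancel]
  · change g₂.f n (-(Q.d (n + 1) n a)) + Q₂.d (n + 1) n (g₂.f (n + 1) a +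
      Q₂.d (n + 2) (n + 1) b₂) = 0
    rw [map_neg, map_add, d_d_apply, hom_d_apply, add_zero, neg_add_cancel]

variable (Q Q₁ Q₂) in
abbrev coneX (n : ℕ) : ModuleCat.{0} R := ModuleCat.of R (predX Q n × Q₁.X n × Q₂.X n)

def coneHom (n : ℕ) : coneX Q Q₁ Q₂ (n + 1) ⟶ coneX Q Q₁ Q₂ n := ModuleCat.ofHom (coneD g₁ g₂ n)

/-- The mapping cone of `Q ⟶ Q₁ ⊕ Q₂`. -/
def cone : ChainComplex (ModuleCat.{0} R) ℕ :=
  ChainComplex.of (coneX Q Q₁ Q₂) (coneHom g₁ g₂)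
    (fun n => ModuleCat.hom_ext (LinearMap.ext fun x => coneD_coneD g₁ g₂ n x))

def mk (n : ℕ) (a : predX Q n) (b₁ : Q₁.X n) (b₂ : Q₂.X n) : (cone g₁ g₂).X n := (a, b₁, b₂)

theorem exists_mk {n : ℕ} (x : (cone g₁ g₂).X n) : ∃ a b₁ b₂, x = mk g₁ g₂ n a b₁ b₂ :=
  ⟨x.1, x.2.1, x.2.2, rfl⟩

theorem cone_d (n : ℕ) (a : Q.X n) (b₁ : Q₁.X (n + 1)) (b₂ : Q₂.X (n + 1)) :
    (cone g₁ g₂).d (n + 1) n (mk g₁ g₂ (n + 1) a b₁ b₂) =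
      mk g₁ g₂ n (-(predD Q n a)) (g₁.f n a + Q₁.d (n + 1) n b₁)
        (g₂.f n a + Q₂.d (n + 1) n b₂) := by
  have h : (cone g₁ g₂).d (n + 1) n = coneHom g₁ g₂ n :=
    ChainComplex.of_d (coneX Q Q₁ Q₂) (coneHom g₁ g₂) n
  exact ConcreteCategory.congr_hom h (mk g₁ g₂ (n + 1) a b₁ b₂)

theorem mk_inj {n : ℕ} {a a' : predX Q n} {b₁ b₁' : Q₁.X n} {b₂ b₂' : Q₂.X n}
    (h : mk g₁ g₂ n a b₁ b₂ = mk g₁ g₂ n a' b₁' b₂') : a = a' ∧ b₁ = b₁' ∧ b₂ = b₂' :=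
  ⟨congrArg (fun x => x.1) h, congrArg (fun x => x.2.1) h, congrArg (fun x => x.2.2) h⟩

theorem isFiniteFree_cone (h : IsFiniteFree Q) (h₁ : IsFiniteFree Q₁) (h₂ : IsFiniteFree Q₂) :
    IsFiniteFree (cone g₁ g₂) := by
  have f1 := h₁.finite
  have f2 := h₂.finite
  have r1 := h₁.free
  have r2 := h₂.free
  refine ⟨fun i => ?_, fun i => ?_, ?_⟩
  · have : Module.Finite R (predX Q i) := by
      cases i with
      | zero => exact inferInstanceAs (Module.Finite R PUnit)
      | succ n => exact h.finite n
    exact inferInstanceAs (Module.Finite R (predX Q i × Q₁.X i × Q₂.X i))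
  · have : Module.Free R (predX Q i) := by
      cases i with
      | zero => exact inferInstanceAs (Module.Free R PUnit)
      | succ n => exact h.free n
    exact inferInstanceAs (Module.Free R (predX Q i × Q₁.X i × Q₂.X i))
  · obtain ⟨b, hb⟩ := h.bounded
    obtain ⟨b₁, hb₁⟩ := h₁.bounded
    obtain ⟨b₂, hb₂⟩ := h₂.bounded
    refine ⟨b + 1 + b₁ + b₂, fun i hi => ?_⟩
    have := hb₁ i (by omega)
    have := hb₂ i (by omega)
    have : Subsingleton (predX Q i) := by
      cases i with
      | zero => exact inferInstanceAs (Subsingleton PUnit)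
      | succ n => exact hb n (by omega)
    exact inferInstanceAs (Subsingleton (predX Q i × Q₁.X i × Q₂.X i))

end MVCone

open MVCone

variable {R : Type} [Ring R] {A B₁ B₂ C : ChainComplex (ModuleCat.{0} R) ℕ}

/-- The degree-shifted components of a homotopy. -/
def predHom {Q B : ChainComplex (ModuleCat.{0} R) ℕ} {f g : Q ⟶ B} (H : Homotopy f g) :
    ∀ n, predX Q n →ₗ[R] B.X n
  | 0 => 0
  | n + 1 => (H.hom n (n + 1)).hom

theorem homotopy_apply {Q B : ChainComplex (ModuleCat.{0} R) ℕ} {f g : Q ⟶ B} (H : Homotopy f g)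
    (n : ℕ) (a : Q.X n) :
    f.f n a = B.d (n + 1) n (predHom H (n + 1) a) + predHom H n (predD Q n a) + g.f n a := by
  have h := LinearMap.congr_fun (congrArg ModuleCat.Hom.hom (H.comm n)) a
  refine Eq.trans h ?_
  rw [Homotopy.prevD_chainComplex]
  cases n with
  | zero =>
    rw [Homotopy.dNext_zero_chainComplex, zero_add, ModuleCat.hom_add]
    change _ = _ + 0 + _
    rw [add_zero]
    rfl
  | succ n =>
    rw [Homotopy.dNext_succ_chainComplex, ModuleCat.hom_add, ModuleCat.hom_add, LinearMap.add_apply,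
      LinearMap.add_apply, add_comm ((Q.d (n + 1) n ≫ H.hom n (n + 1)).hom a)]
    rfl

/-- A quasi-isomorphism `q : Q ⟶ B` of complexes of projectives admits lifts up to homotopy. -/
theorem exists_lift_of_quasiIso {P Q B : ChainComplex (ModuleCat.{0} R) ℕ} (q : Q ⟶ B)
    (hq : QuasiIso q) [∀ n, Projective (Q.X n)] [∀ n, Projective (B.X n)] (f : P ⟶ B) :
    ∃ g : P ⟶ Q, Nonempty (Homotopy f (g ≫ q)) := by
  obtain ⟨e, he⟩ := (ChainComplex.quasiIso_iff_of_projective q).1 hq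
  refine ⟨f ≫ e.inv, ⟨?_⟩⟩
  have H := e.homotopyInvHomId
  rw [he] at H
  exact (Homotopy.ofEq (by simp)).trans ((H.compLeft f).symm.trans (Homotopy.ofEq (by simp)))

theorem IsFiniteFree.projective {Q : ChainComplex (ModuleCat.{0} R) ℕ} (h : IsFiniteFree Q)
    (n : ℕ) : Projective (Q.X n) := by
  have := h.free n
  exact (IsProjective.iff_projective (R := R) (P := Q.X n)).1 (Module.Projective.of_free)

/-- If `0 ⟶ A ⟶ B₁ ⊕ B₂ ⟶ C ⟶ 0` is exact and `A`, `B₁`, `B₂` are of finite free type, so is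
`C`. -/
theorem HasFiniteFreeType.mayerVietoris
    [∀ n, Projective (B₁.X n)] [∀ n, Projective (B₂.X n)]
    (hA : HasFiniteFreeType A) (hB₁ : HasFiniteFreeType B₁) (hB₂ : HasFiniteFreeType B₂)
    (i₁ : A ⟶ B₁) (i₂ : A ⟶ B₂) (j₁ : B₁ ⟶ C) (j₂ : B₂ ⟶ C)
    (hcomm : ∀ n (a : A.X n), j₁.f n (i₁.f n a) = j₂.f n (i₂.f n a))
    (hinj : ∀ n, Function.Injective (i₁.f n))
    (hex : ∀ n (b₁ : B₁.X n) (b₂ : B₂.X n), j₁.f n b₁ = j₂.f n b₂ →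
      ∃ a, i₁.f n a = b₁ ∧ i₂.f n a = b₂)
    (hsurj : ∀ n (z : C.X n), ∃ b₁ b₂, z = j₁.f n b₁ - j₂.f n b₂) :
    HasFiniteFreeType C := by
  obtain ⟨Q, q, hQ, hq⟩ := hA
  obtain ⟨Q₁, q₁, hQ₁, hq₁⟩ := hB₁
  obtain ⟨Q₂, q₂, hQ₂, hq₂⟩ := hB₂
  have := hQ₁.projective
  have := hQ₂.projective
  obtain ⟨g₁, ⟨H₁⟩⟩ := exists_lift_of_quasiIso q₁ hq₁ (q ≫ i₁)
  obtain ⟨g₂, ⟨H₂⟩⟩ := exists_lift_of_quasiIso q₂ hq₂ (q ≫ i₂)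
  have e₁ : ∀ n (a : Q.X n), i₁.f n (q.f n a) = B₁.d (n + 1) n (predHom H₁ (n + 1) a) +
      predHom H₁ n (predD Q n a) + q₁.f n (g₁.f n a) := homotopy_apply H₁
  have e₂ : ∀ n (a : Q.X n), i₂.f n (q.f n a) = B₂.d (n + 1) n (predHom H₂ (n + 1) a) +
      predHom H₂ n (predD Q n a) + q₂.f n (g₂.f n a) := homotopy_apply H₂
  let Fl : ∀ n, predX Q n × Q₁.X n × Q₂.X n →ₗ[R] C.X n := fun n =>
    (j₁.f n).hom ∘ₗ ((q₁.f n).hom ∘ₗ LinearMap.fst R _ _ ∘ₗ LinearMap.snd R _ _ -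
        predHom H₁ n ∘ₗ LinearMap.fst R _ _) -
      (j₂.f n).hom ∘ₗ ((q₂.f n).hom ∘ₗ LinearMap.snd R _ _ ∘ₗ LinearMap.snd R _ _ -
        predHom H₂ n ∘ₗ LinearMap.fst R _ _)
  let F : cone g₁ g₂ ⟶ C :=
    { f := fun n => ModuleCat.ofHom (Fl n)
      comm' := by
        rintro i n hn
        obtain rfl : n + 1 = i := hn
        ext x
        obtain ⟨a, b₁, b₂, rfl⟩ := exists_mk g₁ g₂ x
        change C.d (n + 1) n (Fl (n + 1) (mk g₁ g₂ (n + 1) a b₁ b₂)) = Fl n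
          ((cone g₁ g₂).d (n + 1) n (mk g₁ g₂ (n + 1) a b₁ b₂))
        rw [show (cone g₁ g₂).d (n + 1) n (mk g₁ g₂ (n + 1) a b₁ b₂) = _ from cone_d g₁ g₂ n a b₁ b₂]
        change C.d (n + 1) n (j₁.f (n + 1) (q₁.f (n + 1) b₁ - predHom H₁ (n + 1) a) -
            j₂.f (n + 1) (q₂.f (n + 1) b₂ - predHom H₂ (n + 1) a)) =
          j₁.f n (q₁.f n (g₁.f n a + Q₁.d (n + 1) n b₁) - predHom H₁ n (-(predD Q n a))) -
          j₂.f n (q₂.f n (g₂.f n a + Q₂.d (n + 1) n b₂) - predHom H₂ n (-(predD Q n a)))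
        have h := hcomm n (q.f n a)
        rw [e₁, e₂] at h
        simp only [map_add, map_sub, map_neg, hom_d_apply] at h ⊢
        rw [← sub_eq_zero] at h ⊢
        rw [← neg_eq_zero, ← h]
        abel }
  have hF : ∀ n a b₁ b₂, F.f n (mk g₁ g₂ n a b₁ b₂) =
      j₁.f n (q₁.f n b₁ - predHom H₁ n a) - j₂.f n (q₂.f n b₂ - predHom H₂ n a) :=
    fun _ _ _ _ => rfl
  refine ⟨cone g₁ g₂, F, isFiniteFree_cone g₁ g₂ hQ hQ₁ hQ₂, ?_⟩
  rw [quasiIso_iff_elementwise] at hq hq₁ hq₂ ⊢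
  have hi₁ : ∀ n (a : A.X n), i₁.f n a = 0 → a = 0 := fun n a h =>
    hinj n (by rw [h, map_zero])
  constructor
  · intro n z hz
    obtain ⟨b₁, b₂, hb⟩ := hsurj n z
    have key : ∃ (x : predX Q n) (c₁ : B₁.X n) (c₂ : B₂.X n), z = j₁.f n c₁ - j₂.f n c₂ ∧
        (∃ y₁, IsCycle (c₁ - predHom H₁ n x - q₁.f n y₁) ∧
          ∃ y₂, IsCycle (c₂ - predHom H₂ n x - q₂.f n y₂) ∧
          IsCycle (mk g₁ g₂ n (-x) y₁ y₂)) := by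
      cases n with
      | zero =>
        exact ⟨0, b₁, b₂, hb, 0, isCycle_zero_degree _, 0, isCycle_zero_degree _,
          isCycle_zero_degree _⟩
      | succ n =>
        have h := hz n
        rw [hb, map_sub, hom_d_apply, hom_d_apply, sub_eq_zero] at h
        obtain ⟨a, ha₁, ha₂⟩ := hex n _ _ h
        have ha : IsCycle a := fun j => hi₁ _ _ (by
          rw [← hom_d_apply, ha₁, d_d_apply])
        obtain ⟨x, hx, a', ha'⟩ := hq.1 n a ha
        have hxd := predD_eq_zero hx
        have t₁ := e₁ n x
        have t₂ := e₂ n x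
        rw [hxd, map_zero, add_zero] at t₁ t₂
        have s₁ : B₁.d (n + 1) n (b₁ - i₁.f (n + 1) a' - predHom H₁ (n + 1) x) =
            q₁.f n (g₁.f n x) := by
          rw [map_sub, map_sub, hom_d_apply, ha', ← ha₁, map_sub, t₁]
          abel
        have s₂ : B₂.d (n + 1) n (b₂ - i₂.f (n + 1) a' - predHom H₂ (n + 1) x) =
            q₂.f n (g₂.f n x) := by
          rw [map_sub, map_sub, hom_d_apply, ha', ← ha₂, map_sub, t₂]
          abel
        obtain ⟨y₁, hy₁⟩ := hq₁.2 n _ (hx.map g₁) ⟨_, s₁⟩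
        obtain ⟨y₂, hy₂⟩ := hq₂.2 n _ (hx.map g₂) ⟨_, s₂⟩
        refine ⟨x, b₁ - i₁.f (n + 1) a', b₂ - i₂.f (n + 1) a', ?_, y₁, isCycle_succ ?_, y₂,
          isCycle_succ ?_, isCycle_succ ?_⟩
        · rw [map_sub, map_sub, hcomm, hb]; abel
        · rw [map_sub, s₁, hom_d_apply, hy₁, sub_self]
        · rw [map_sub, s₂, hom_d_apply, hy₂, sub_self]
        · change (cone g₁ g₂).d (n + 1) n (mk g₁ g₂ (n + 1) (-x : Q.X n) y₁ y₂) = 0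
          rw [cone_d, map_neg, hxd, hy₁, hy₂, map_neg, map_neg, neg_add_cancel, neg_add_cancel]
          simp only [neg_zero]
          rfl
    obtain ⟨x, c₁, c₂, rfl, y₁, k₁, y₂, k₂, k⟩ := key
    obtain ⟨u₁, hu₁, v₁, hv₁⟩ := hq₁.1 n _ k₁
    obtain ⟨u₂, hu₂, v₂, hv₂⟩ := hq₂.1 n _ k₂
    refine ⟨mk g₁ g₂ n (-x) (y₁ + u₁) (y₂ + u₂), ?_, j₁.f (n + 1) v₁ - j₂.f (n + 1) v₂, ?_⟩
    · have : mk g₁ g₂ n (-x) (y₁ + u₁) (y₂ + u₂) =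
          mk g₁ g₂ n (-x) y₁ y₂ + mk g₁ g₂ n 0 u₁ u₂ := by
        change ((-x, y₁ + u₁, y₂ + u₂) : predX Q n × Q₁.X n × Q₂.X n) = (-x + 0, y₁ + u₁, y₂ + u₂)
        rw [add_zero]
      rw [this]
      refine k.add ?_
      cases n with
      | zero => exact isCycle_zero_degree _
      | succ n =>
        refine isCycle_succ ?_
        have := cone_d g₁ g₂ n 0 u₁ u₂
        refine this.trans ?_
        rw [map_zero, map_zero, map_zero, hu₁ n, hu₂ n, add_zero, add_zero, neg_zero]
        rfl
    · rw [hF, map_sub, hom_d_apply, hom_d_apply, hv₁, hv₂]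
      simp only [map_sub, map_add, map_neg]
      abel
  · rintro n x hx ⟨w, hw⟩
    obtain ⟨a, y₁, y₂, rfl⟩ := exists_mk g₁ g₂ x
    obtain ⟨w₁, w₂, rfl⟩ := hsurj _ w
    rw [hF, map_sub, hom_d_apply, hom_d_apply] at hw
    obtain ⟨e, he₁, he₂⟩ := hex n (q₁.f n y₁ - predHom H₁ n a - B₁.d (n + 1) n w₁)
      (q₂.f n y₂ - predHom H₂ n a - B₂.d (n + 1) n w₂) (by
        rw [map_sub _ _ (B₁.d (n + 1) n w₁), map_sub _ _ (B₂.d (n + 1) n w₂)]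
        rw [← sub_eq_zero] at hw ⊢
        rw [← neg_eq_zero, ← hw]
        abel)
    have key : ∃ u : Q.X n, predD Q n u = -a ∧ ∃ e', e = q.f n u + A.d (n + 1) n e' := by
      cases n with
      | zero =>
        obtain ⟨c, -, e', he'⟩ := hq.1 0 e (isCycle_zero_degree e)
        exact ⟨c, rfl, e', by rw [he']; abel⟩
      | succ n =>
        have hx' := (cone_d g₁ g₂ n a y₁ y₂).symm.trans (hx n)
        obtain ⟨z₀, z₁, z₂⟩ := mk_inj g₁ g₂ (a' := 0) (b₁' := 0) (b₂' := 0) hx'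
        have za : predD Q n (a : Q.X n) = 0 := neg_eq_zero.1 z₀
        have t₁ := e₁ n a
        rw [za, map_zero, add_zero] at t₁
        have hde : A.d (n + 1) n e = -(q.f n a) := by
          apply hinj n
          rw [← hom_d_apply, he₁, map_neg, t₁, map_sub, map_sub, d_d_apply, hom_d_apply,
            eq_neg_of_add_eq_zero_right z₁, map_neg]
          abel
        obtain ⟨v, hv⟩ := hq.2 n (a : Q.X n) (isCycle_of_predD za)
          ⟨-e, by rw [map_neg, hde, neg_neg]⟩
        obtain ⟨c, hc, e', he'⟩ := hq.1 (n + 1) (e + q.f (n + 1) v) (isCycle_succ (by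
          rw [map_add, hde, hom_d_apply, hv, neg_add_cancel]))
        refine ⟨c - v, ?_, e', ?_⟩
        · change Q.d (n + 1) n (c - v) = -a
          rw [map_sub, hc n, hv, zero_sub]
        · rw [he', map_sub]; abel
    obtain ⟨u, hu, e', rfl⟩ := key
    have m₁ := e₁ n u
    have m₂ := e₂ n u
    rw [hu, map_neg] at m₁ m₂
    have c₁ : IsCycle (y₁ - g₁.f n u) := by
      cases n with
      | zero => exact isCycle_zero_degree _
      | succ n =>
        have hx' := (cone_d g₁ g₂ n a y₁ y₂).symm.trans (hx n)
        obtain ⟨z₀, z₁, z₂⟩ := mk_inj g₁ g₂ (a' := 0) (b₁' := 0) (b₂' := 0) hx'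
        have hu : Q.d (n + 1) n u = -(a : Q.X n) := hu
        refine isCycle_succ ?_
        rw [map_sub, hom_d_apply, hu, map_neg, eq_neg_of_add_eq_zero_right z₁]
        abel
    have c₂ : IsCycle (y₂ - g₂.f n u) := by
      cases n with
      | zero => exact isCycle_zero_degree _
      | succ n =>
        have hx' := (cone_d g₁ g₂ n a y₁ y₂).symm.trans (hx n)
        obtain ⟨z₀, z₁, z₂⟩ := mk_inj g₁ g₂ (a' := 0) (b₁' := 0) (b₂' := 0) hx'
        have hu : Q.d (n + 1) n u = -(a : Q.X n) := hu
        refine isCycle_succ ?_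
        rw [map_sub, hom_d_apply, hu, map_neg, eq_neg_of_add_eq_zero_right z₂]
        abel
    obtain ⟨v₁, hv₁⟩ := hq₁.2 n _ c₁ ⟨w₁ + predHom H₁ (n + 1) u + i₁.f (n + 1) e', by
      rw [map_add, map_add, hom_d_apply, map_sub]
      rw [map_add, m₁] at he₁
      rw [← sub_eq_zero] at he₁ ⊢
      rw [← he₁]
      abel⟩
    obtain ⟨v₂, hv₂⟩ := hq₂.2 n _ c₂ ⟨w₂ + predHom H₂ (n + 1) u + i₂.f (n + 1) e', by
      rw [map_add, map_add, hom_d_apply, map_sub]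
      rw [map_add, m₂] at he₂
      rw [← sub_eq_zero] at he₂ ⊢
      rw [← he₂]
      abel⟩
    refine ⟨mk g₁ g₂ (n + 1) u v₁ v₂, ?_⟩
    rw [cone_d, hu, hv₁, hv₂, neg_neg, add_sub_cancel, add_sub_cancel]

end EndTheory

end

noncomputable section

namespace EndTheory

open Opposite Simplicial AlgebraicTopology

/-! ### Free abelian chains of simplicial sets -/

section FreeChains

/-- Integral chains of a simplicial set. -/
abbrev FChain (S : SSet.{0}) (n : ℕ) : Type := S.obj (op ⦋n⦌) →₀ ℤ

variable {S T : SSet.{0}}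

variable (S) in
/-- The boundary of an integral chain. -/
def fbdry (n : ℕ) : FChain S (n + 1) →+ FChain S n :=
  ∑ i : Fin (n + 2), (-1 : ℤ) ^ (i : ℕ) • Finsupp.mapDomain.addMonoidHom (S.δ i)

variable (S) in
theorem fbdry_apply (n : ℕ) (c : FChain S (n + 1)) :
    fbdry S n c = ∑ i : Fin (n + 2), (-1 : ℤ) ^ (i : ℕ) • Finsupp.mapDomain (S.δ i) c := by
  simp only [fbdry, AddMonoidHom.finsetSum_apply, AddMonoidHom.smul_apply]
  rfl

theorem fbdry_single (n : ℕ) (s : S.obj (op ⦋n + 1⦌)) :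
    fbdry S n (Finsupp.single s 1) =
      ∑ i : Fin (n + 2), (-1 : ℤ) ^ (i : ℕ) • Finsupp.single (S.δ i s) 1 := by
  simp only [fbdry, AddMonoidHom.finsetSum_apply, AddMonoidHom.smul_apply]
  refine Finset.sum_congr rfl fun i _ => ?_
  rw [Finsupp.mapDomain.addMonoidHom_apply, Finsupp.mapDomain_single]

theorem alternatingFaceMapComplex_d_apply {R : Type} [Ring R]
    (M : SimplicialObject (ModuleCat.{0} R)) (n : ℕ) (x : M.obj (op ⦋n + 1⦌)) :
    (((alternatingFaceMapComplex _).obj M).d (n + 1) n).hom x =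
      ∑ i : Fin (n + 2), (-1 : ℤ) ^ (i : ℕ) • (M.δ i).hom x := by
  have h : ((alternatingFaceMapComplex _).obj M).d (n + 1) n = _ := alternatingFaceMapComplex_obj_d M n
  have h' : (((alternatingFaceMapComplex _).obj M).d (n + 1) n).hom =
      ∑ i : Fin (n + 2), (-1 : ℤ) ^ (i : ℕ) • (M.δ i).hom := by
    rw [h, AlternatingFaceMapComplex.objD, ModuleCat.hom_sum]
    rfl
  refine (LinearMap.congr_fun h' x).trans ?_
  rw [LinearMap.sum_apply]
  rfl

variable (S) in
/-- The integral chains as a complex of `ℤ`-modules. -/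
abbrev freeComplex : ChainComplex (ModuleCat.{0} ℤ) ℕ :=
  (alternatingFaceMapComplex _).obj (((SimplicialObject.whiskering _ _).obj (ModuleCat.free ℤ)).obj S)

variable (S) in
theorem freeComplex_d (n : ℕ) (c : (freeComplex S).X (n + 1)) :
    (freeComplex S).d (n + 1) n c = fbdry S n c := by
  refine (alternatingFaceMapComplex_d_apply
    (((SimplicialObject.whiskering _ _).obj (ModuleCat.free ℤ)).obj S) n c).trans ?_
  exact (fbdry_apply S n c).symm

theorem exists_fchain_homotopy {f g : S ⟶ T} (H : SimplicialObject.Homotopy f g) :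
    ∃ h : ∀ n, FChain S n →+ FChain T (n + 1),
      (∀ c, Finsupp.mapDomain (f.app (op ⦋0⦌)) c =
        fbdry T 0 (h 0 c) + Finsupp.mapDomain (g.app (op ⦋0⦌)) c) ∧
      ∀ n c, Finsupp.mapDomain (f.app (op ⦋n + 1⦌)) c = h n (fbdry S n c) +
        fbdry T (n + 1) (h (n + 1) c) + Finsupp.mapDomain (g.app (op ⦋n + 1⦌)) c := by
  let K := (H.whiskerRight (ModuleCat.free ℤ)).toChainHomotopy
  refine ⟨fun n => ((K.hom n (n + 1)).hom : _ →ₗ[ℤ] _).toAddMonoidHom, fun c => ?_, fun n c => ?_⟩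
  · refine (homotopy_apply K 0 c).trans ?_
    exact congrArg₂ (· + ·) ((add_zero _).trans (freeComplex_d T 0 _)) rfl
  · refine (homotopy_apply K (n + 1) c).trans ?_
    refine congrArg₂ (· + ·) ((add_comm _ _).trans (congrArg₂ (· + ·) ?_
      (freeComplex_d T (n + 1) _))) rfl
    exact congrArg (K.hom n (n + 1)).hom (freeComplex_d S n c)

end FreeChains

/-! ### Chains of simplicial `G`-sets -/

section GChains

variable {G : Type} [Group G]

variable (G) in
/-- The chain complex of `ℤ[G]`-modules of a simplicial `G`-set. -/
def gChains : SimplicialObject (Action Type G) ⥤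
    ChainComplex (ModuleCat.{0} (MonoidAlgebra ℤ G)) ℕ :=
  (SimplicialObject.whiskering _ _).obj (Rep.linearization ℤ G ⋙ Rep.toModuleMonoidAlgebra) ⋙
    alternatingFaceMapComplex _

variable (G) in
/-- The simplicial set underlying a simplicial `G`-set. -/
abbrev underlying : SimplicialObject (Action Type G) ⥤ SSet.{0} :=
  (SimplicialObject.whiskering _ _).obj (Action.forget Type G)

variable (S T : SimplicialObject (Action Type G))

/-- The abelian group underlying the complex of a simplicial `G`-set. -/
def gEquiv (n : ℕ) : ((gChains G).obj S).X n ≃+ FChain ((underlying G).obj S) n :=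
  AddEquiv.trans (Representation.asModuleEquiv (Representation.linearize ℤ G
    (S.obj (op ⦋n⦌)))).toAddEquiv (MonoidAlgebra.coeffLinearEquiv ℤ).toAddEquiv

/-- The basis element given by a simplex. -/
def gen (n : ℕ) (s : (S.obj (op ⦋n⦌)).V) : ((gChains G).obj S).X n :=
  (gEquiv S n).symm (Finsupp.single s 1)

@[simp] theorem gEquiv_gen (n : ℕ) (s : (S.obj (op ⦋n⦌)).V) :
    gEquiv S n (gen S n s) = Finsupp.single s 1 :=
  (gEquiv S n).apply_symm_apply _

variable {S T}

theorem gChains_induction {n : ℕ} {p : ((gChains G).obj S).X n → Prop} (x)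
    (zero : p 0) (add : ∀ x y, p x → p y → p (x + y)) (neg : ∀ x, p x → p (-x))
    (hgen : ∀ s, p (gen S n s)) : p x := by
  obtain ⟨c, rfl⟩ := (gEquiv S n).symm.surjective x
  induction c using Finsupp.induction_linear with
  | zero => rwa [map_zero]
  | add f g hf hg => rw [map_add]; exact add _ _ hf hg
  | single s k =>
    have : ∀ m : ℕ, p ((gEquiv S n).symm (Finsupp.single s (m : ℤ))) := by
      intro m
      induction m with
      | zero => simpa using zero
      | succ m ih =>
        rw [Nat.cast_succ, Finsupp.single_add, map_add]
        exact add _ _ ih (hgen s)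
    obtain ⟨m, rfl | rfl⟩ := k.eq_nat_or_neg
    · exact this m
    · rw [Finsupp.single_neg, map_neg]
      exact neg _ (this m)

theorem gEquiv_map (f : S ⟶ T) (n : ℕ) (x : ((gChains G).obj S).X n) :
    gEquiv T n (((gChains G).map f).f n x) =
      Finsupp.mapDomain (f.app (op ⦋n⦌)).hom (gEquiv S n x) := rfl

theorem map_gen (f : S ⟶ T) (n : ℕ) (s : (S.obj (op ⦋n⦌)).V) :
    ((gChains G).map f).f n (gen S n s) = gen T n ((f.app (op ⦋n⦌)).hom s) := by
  apply (gEquiv T n).injective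
  rw [gEquiv_map, gEquiv_gen, gEquiv_gen, Finsupp.mapDomain_single]

theorem gEquiv_d (n : ℕ) (x : ((gChains G).obj S).X (n + 1)) :
    gEquiv S n (((gChains G).obj S).d (n + 1) n x) =
      fbdry ((underlying G).obj S) n (gEquiv S (n + 1) x) := by
  have h := alternatingFaceMapComplex_d_apply (((SimplicialObject.whiskering _ _).obj
        (Rep.linearization ℤ G ⋙ Rep.toModuleMonoidAlgebra)).obj S) n x
  refine (congrArg (gEquiv S n) h).trans ?_
  refine (map_sum (gEquiv S n) _ _).trans ?_
  rw [fbdry, AddMonoidHom.finsetSum_apply]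
  refine Finset.sum_congr rfl fun i _ => ?_
  exact map_zsmul (gEquiv S n) _ _

theorem single_smul_gen (n : ℕ) (g : G) (s : (S.obj (op ⦋n⦌)).V) :
    (MonoidAlgebra.single g (1 : ℤ)) • gen S n s = gen S n ((S.obj (op ⦋n⦌)).ρ g s) := by
  apply (gEquiv S n).injective
  have h := Representation.asModuleEquiv_map_smul (Representation.linearize ℤ G
    (S.obj (op ⦋n⦌))) (MonoidAlgebra.single g (1 : ℤ)) (gen S n s)
  rw [gEquiv_gen]
  refine (congrArg (MonoidAlgebra.coeffLinearEquiv ℤ) h).trans ?_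
  rw [Representation.asAlgebraHom_single, one_smul]
  change Finsupp.mapDomain _ _ = _
  refine (congrArg (Finsupp.mapDomain _) (gEquiv_gen S n s)).trans ?_
  exact Finsupp.mapDomain_single

end GChains

end EndTheory

end

noncomputable section

namespace EndTheory

open Opposite Simplicial AlgebraicTopology

/-! ### Quasi-isomorphisms of chains of simplicial `G`-sets -/

theorem quasiIso_of_relatively_acyclic {R : Type} [Ring R] {C D : ChainComplex (ModuleCat.{0} R) ℕ}
    (f : C ⟶ D) (hf : ∀ n, Function.Injective (f.f n))
    (h : ∀ n (z : D.X n), (∀ j, ∃ c, f.f j c = D.d n j z) →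
      ∃ w c, z - D.d (n + 1) n w = f.f n c) : QuasiIso f := by
  rw [quasiIso_iff_elementwise]
  constructor
  · intro n z hz
    obtain ⟨w, c, hw⟩ := h n z fun j => ⟨0, by rw [hz j, map_zero]⟩
    refine ⟨c, fun j => hf j ?_, w, by rw [← hw]; abel⟩
    rw [← hom_d_apply, ← hw, map_sub, hz j, d_d_apply, sub_zero, map_zero]
  · rintro n c - ⟨w, hw⟩
    obtain ⟨v, b, hb⟩ := h (n + 1) w (by
      intro j
      by_cases hj : j = n
      · subst hj; exact ⟨c, hw.symm⟩
      · exact ⟨0, by rw [D.shape _ j (by simpa using hj), map_zero]; rfl⟩)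
    refine ⟨b, hf n ?_⟩
    rw [← hom_d_apply, ← hb, map_sub, d_d_apply, sub_zero, hw]

section

variable {G : Type} [Group G] {S T : SimplicialObject (Action Type G)}

theorem gChains_injective (f : S ⟶ T) (n : ℕ) (hf : Function.Injective (f.app (op ⦋n⦌)).hom) :
    Function.Injective (((gChains G).map f).f n) := by
  intro x y hxy
  apply (gEquiv S n).injective
  apply Finsupp.mapDomain_injective hf
  rw [← gEquiv_map, ← gEquiv_map, hxy]

theorem gChains_surjective (f : S ⟶ T) (n : ℕ) (hf : Function.Surjective (f.app (op ⦋n⦌)).hom) :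
    Function.Surjective (((gChains G).map f).f n) := by
  intro x
  induction x using gChains_induction with
  | zero => exact ⟨0, map_zero _⟩
  | add x y hx hy =>
    obtain ⟨x, rfl⟩ := hx
    obtain ⟨y, rfl⟩ := hy
    exact ⟨x + y, map_add _ _ _⟩
  | neg x hx =>
    obtain ⟨x, rfl⟩ := hx
    exact ⟨-x, map_neg _ _⟩
  | hgen s =>
    obtain ⟨s, rfl⟩ := hf s
    exact ⟨gen S n s, map_gen f n s⟩

theorem gChains_quasiIso_of_bijective (f : S ⟶ T)
    (hf : ∀ n, Function.Bijective (f.app (op ⦋n⦌)).hom) : QuasiIso ((gChains G).map f) :=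
  quasiIso_of_bijective _ fun n =>
    ⟨gChains_injective f n (hf n).1, gChains_surjective f n (hf n).2⟩

theorem fbdry_mapDomain {S T : SSet.{0}} (r : S ⟶ T) (n : ℕ) (c : FChain S (n + 1)) :
    fbdry T n (Finsupp.mapDomain (r.app (op ⦋n + 1⦌)) c) =
      Finsupp.mapDomain (r.app (op ⦋n⦌)) (fbdry S n c) := by
  rw [fbdry_apply, fbdry_apply, Finsupp.mapDomain_finsetSum]
  refine Finset.sum_congr rfl fun i _ => ?_
  have h : ∀ x : FChain T n, ∀ k : ℤ, k • x = k • x := fun _ _ => rfl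
  have hs : Finsupp.mapDomain (r.app (op ⦋n⦌)) ((-1 : ℤ) ^ (i : ℕ) •
      Finsupp.mapDomain (S.δ i) c) = (-1 : ℤ) ^ (i : ℕ) • Finsupp.mapDomain (r.app (op ⦋n⦌))
        (Finsupp.mapDomain (S.δ i) c) := Finsupp.mapDomain_smul _ _
  rw [hs, ← Finsupp.mapDomain_comp, ← Finsupp.mapDomain_comp]
  congr 2
  funext s
  exact (ConcreteCategory.congr_hom (SimplicialObject.δ_naturality r i) s).symm

/-- A simplicial deformation retraction (not necessarily equivariant) onto a simplicial `G`-set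
is a quasi-isomorphism on chains. -/
theorem gChains_quasiIso_of_retraction (f : S ⟶ T)
    (r : (underlying G).obj T ⟶ (underlying G).obj S)
    (hr : (underlying G).map f ≫ r = 𝟙 _)
    (H : SimplicialObject.Homotopy (r ≫ (underlying G).map f) (𝟙 _)) :
    QuasiIso ((gChains G).map f) := by
  obtain ⟨h, h₀, h₁⟩ := exists_fchain_homotopy H
  have hid : ∀ n (c : FChain ((underlying G).obj T) n), Finsupp.mapDomain
      ((𝟙 ((underlying G).obj T) : _ ⟶ _).app (op ⦋n⦌)) c = c := fun n c => Finsupp.mapDomain_id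
  have hcomp : ∀ n (c : FChain ((underlying G).obj T) n), Finsupp.mapDomain
      ((r ≫ (underlying G).map f).app (op ⦋n⦌)) c = Finsupp.mapDomain
        (((underlying G).map f).app (op ⦋n⦌)) (Finsupp.mapDomain (r.app (op ⦋n⦌)) c) :=
    fun n c => (Finsupp.mapDomain_comp (f := r.app (op ⦋n⦌))
      (g := ((underlying G).map f).app (op ⦋n⦌)))
  have hret : ∀ n (c : FChain ((underlying G).obj S) n), Finsupp.mapDomain (r.app (op ⦋n⦌))
      (Finsupp.mapDomain (((underlying G).map f).app (op ⦋n⦌)) c) = c := by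
    intro n c
    have e : ∀ s, r.app (op ⦋n⦌) (((underlying G).map f).app (op ⦋n⦌) s) = s := fun s =>
      ConcreteCategory.congr_hom (congrArg (fun t : (underlying G).obj S ⟶ (underlying G).obj S =>
        (t.app (op ⦋n⦌) : ((underlying G).obj S).obj (op ⦋n⦌) ⟶ _)) hr) s
    rw [← Finsupp.mapDomain_comp]
    exact (congrArg (fun k => Finsupp.mapDomain k c) (funext e)).trans Finsupp.mapDomain_id
  rw [quasiIso_iff_elementwise]
  constructor
  · intro n z hz
    refine ⟨(gEquiv S n).symm (Finsupp.mapDomain (r.app (op ⦋n⦌)) (gEquiv T n z)), ?_,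
      -(gEquiv T (n + 1)).symm (h n (gEquiv T n z)), ?_⟩
    · cases n with
      | zero => exact isCycle_zero_degree _
      | succ n =>
        refine isCycle_succ ((gEquiv S n).injective ?_)
        rw [gEquiv_d, AddEquiv.apply_symm_apply, fbdry_mapDomain, ← gEquiv_d, hz n, map_zero,
          map_zero, Finsupp.mapDomain_zero]
    · apply (gEquiv T n).injective
      rw [gEquiv_d, map_neg, map_neg, AddEquiv.apply_symm_apply, map_sub, gEquiv_map,
        AddEquiv.apply_symm_apply]
      cases n with
      | zero =>
        have := h₀ (gEquiv T 0 z)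
        rw [hid, hcomp] at this
        refine Eq.trans ?_ (congrArg (gEquiv T 0 z - ·) this.symm)
        abel
      | succ n =>
        have := h₁ n (gEquiv T (n + 1) z)
        rw [hid, hcomp, ← gEquiv_d, hz n, map_zero, map_zero, zero_add] at this
        refine Eq.trans ?_ (congrArg (gEquiv T (n + 1) z - ·) this.symm)
        abel
  · rintro n c hc ⟨w, hw⟩
    refine ⟨(gEquiv S (n + 1)).symm (Finsupp.mapDomain (r.app (op ⦋n + 1⦌)) (gEquiv T (n + 1) w)),
      (gEquiv S n).injective ?_⟩
    rw [gEquiv_d, AddEquiv.apply_symm_apply, fbdry_mapDomain, ← gEquiv_d, hw, gEquiv_map]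
    exact hret n _

/-- The chains of a simplicial set with a free action of `G` are projective. -/
theorem gChains_projective (n : ℕ)
    (hfree : ∀ (g : G) (s : (S.obj (op ⦋n⦌)).V), (S.obj (op ⦋n⦌)).ρ g s = s → g = 1) :
    Projective (((gChains G).obj S).X n) := by
  let X := S.obj (op ⦋n⦌)
  have hmul : ∀ (g h : G) (s : X.V), X.ρ (g * h) s = X.ρ g (X.ρ h s) := fun g h s =>
    ConcreteCategory.congr_hom (X.ρ.map_mul g h) s
  have hone : ∀ s : X.V, X.ρ 1 s = s := fun s => ConcreteCategory.congr_hom (X.ρ.map_one) s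
  let rel : Setoid X.V :=
    { r := fun s t => ∃ g : G, X.ρ g s = t
      iseqv := ⟨fun s => ⟨1, hone s⟩, fun {s t} ⟨g, hg⟩ => ⟨g⁻¹, by
        rw [← hg, ← hmul, inv_mul_cancel, hone]⟩, fun {s t u} ⟨g, hg⟩ ⟨h, hh⟩ => ⟨h * g, by
        rw [hmul, hg, hh]⟩⟩ }
  let rep : X.V → X.V := fun s => Quotient.out (Quotient.mk rel s)
  have hrep : ∀ s, ∃ g : G, X.ρ g (rep s) = s := fun s =>
    Quotient.exact (s := rel) (Quotient.out_eq (Quotient.mk rel s))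
  choose γ hγ using hrep
  have hrep' : ∀ g s, rep (X.ρ g s) = rep s := fun g s =>
    congrArg Quotient.out (Quotient.sound (s := rel) (show rel.r _ _ from ⟨g⁻¹, by
      rw [← hmul, inv_mul_cancel, hone]⟩))
  have hγ' : ∀ g s, γ (X.ρ g s) = g * γ s := by
    intro g s
    have h := hγ (X.ρ g s)
    rw [hrep'] at h
    have h' : X.ρ (γ s)⁻¹ s = rep s := by
      refine (congrArg (X.ρ (γ s)⁻¹) (hγ s).symm).trans ?_
      rw [← hmul, inv_mul_cancel, hone]
    have : X.ρ ((g * γ s)⁻¹ * γ (X.ρ g s)) (rep s) = rep s := by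
      rw [hmul, h, ← hmul, mul_inv_rev, mul_assoc, inv_mul_cancel, mul_one, h']
    exact (inv_mul_eq_one.1 (hfree _ _ this)).symm
  let p : (X.V →₀ MonoidAlgebra ℤ G) →ₗ[MonoidAlgebra ℤ G] ((gChains G).obj S).X n :=
    Finsupp.linearCombination _ (gen S n)
  let v : X.V → (X.V →₀ MonoidAlgebra ℤ G) := fun s =>
    Finsupp.single (rep s) (MonoidAlgebra.single (γ s) (1 : ℤ))
  let i₀ : ((gChains G).obj S).X n →+ (X.V →₀ MonoidAlgebra ℤ G) :=
    AddMonoidHom.comp (Finsupp.liftAddHom fun s => zmultiplesHom _ (v s) :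
      (X.V →₀ ℤ) →+ (X.V →₀ MonoidAlgebra ℤ G)) (gEquiv S n).toAddMonoidHom
  have hi₀ : ∀ s, i₀ (gen S n s) = v s := fun s => by
    refine (congrArg (Finsupp.liftAddHom fun s => zmultiplesHom _ (v s)) (gEquiv_gen S n s)).trans ?_
    exact (Finsupp.liftAddHom_apply_single _ _ _).trans (one_zsmul _)
  have hsmul : ∀ (g : G) (x : ((gChains G).obj S).X n),
      i₀ (MonoidAlgebra.single g (1 : ℤ) • x) = MonoidAlgebra.single g (1 : ℤ) • i₀ x := by
    intro g x
    induction x using gChains_induction with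
    | zero => simp
    | add x y hx hy => rw [smul_add, map_add, map_add, smul_add, hx, hy]
    | neg x hx => rw [smul_neg, map_neg, map_neg, smul_neg, hx]
    | hgen s =>
      rw [single_smul_gen, hi₀, hi₀]
      simp only [v, Finsupp.smul_single, smul_eq_mul, MonoidAlgebra.single_mul_single, mul_one]
      rw [show rep ((S.obj (op ⦋n⦌)).ρ g s) = rep s from hrep' g s,
        show γ ((S.obj (op ⦋n⦌)).ρ g s) = g * γ s from hγ' g s]
  let i : ((gChains G).obj S).X n →ₗ[MonoidAlgebra ℤ G] (X.V →₀ MonoidAlgebra ℤ G) :=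
    { i₀ with
      map_smul' := fun l x => by
        change i₀ (l • x) = l • i₀ x
        induction l using MonoidAlgebra.induction_on with
        | of g => exact hsmul g x
        | add a b ha hb => rw [add_smul, map_add, add_smul, ha, hb]
        | smul k a ha => rw [smul_assoc, map_zsmul, smul_assoc, ha] }
  refine (IsProjective.iff_projective (R := MonoidAlgebra ℤ G) _).1
    (Module.Projective.of_split i p (LinearMap.ext fun x => ?_))
  change p (i₀ x) = x
  induction x using gChains_induction with
  | zero => simp
  | add x y hx hy => rw [map_add, map_add, hx, hy]
  | neg x hx => rw [map_neg, map_neg, hx]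
  | hgen s =>
    rw [hi₀]
    refine (Finsupp.linearCombination_single _ _ _).trans ?_
    rw [single_smul_gen]
    exact congrArg _ (hγ s)

end

/-! ### Mayer–Vietoris for simplicial `G`-sets -/

theorem HasFiniteFreeType.mayerVietoris_gChains {G : Type} [Group G]
    {A B₁ B₂ C : SimplicialObject (Action Type G)}
    (i₁ : A ⟶ B₁) (i₂ : A ⟶ B₂) (j₁ : B₁ ⟶ C) (j₂ : B₂ ⟶ C) (hcomm : i₁ ≫ j₁ = i₂ ≫ j₂)
    (hi₁ : ∀ n, Function.Injective (i₁.app (op ⦋n⦌)).hom)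
    (hj₁ : ∀ n, Function.Injective (j₁.app (op ⦋n⦌)).hom)
    (hj₂ : ∀ n, Function.Injective (j₂.app (op ⦋n⦌)).hom)
    (hpull : ∀ n b₁ b₂, (j₁.app (op ⦋n⦌)).hom b₁ = (j₂.app (op ⦋n⦌)).hom b₂ →
      ∃ a, (i₁.app (op ⦋n⦌)).hom a = b₁)
    (hsurj : ∀ n c, (∃ b, (j₁.app (op ⦋n⦌)).hom b = c) ∨ ∃ b, (j₂.app (op ⦋n⦌)).hom b = c)
    (hB₁ : ∀ n, Projective (((gChains G).obj B₁).X n))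
    (hB₂ : ∀ n, Projective (((gChains G).obj B₂).X n))
    (tA : HasFiniteFreeType ((gChains G).obj A)) (tB₁ : HasFiniteFreeType ((gChains G).obj B₁))
    (tB₂ : HasFiniteFreeType ((gChains G).obj B₂)) :
    HasFiniteFreeType ((gChains G).obj C) := by
  classical
  have hc : ∀ n (a : ((gChains G).obj A).X n),
      ((gChains G).map j₁).f n (((gChains G).map i₁).f n a) =
        ((gChains G).map j₂).f n (((gChains G).map i₂).f n a) := by
    intro n a
    rw [← ConcreteCategory.comp_apply, ← ConcreteCategory.comp_apply,
      ← HomologicalComplex.comp_f, ← HomologicalComplex.comp_f, ← Functor.map_comp,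
      ← Functor.map_comp, hcomm]
  refine tA.mayerVietoris tB₁ tB₂ ((gChains G).map i₁) ((gChains G).map i₂)
    ((gChains G).map j₁) ((gChains G).map j₂) hc (fun n => gChains_injective i₁ n (hi₁ n)) ?_ ?_
  · intro n b₁ b₂ h
    have key : ∃ a, ((gChains G).map i₁).f n a = b₁ := by
      refine ⟨(gEquiv A n).symm (Finsupp.comapDomain (i₁.app (op ⦋n⦌)).hom (gEquiv B₁ n b₁)
        (hi₁ n).injOn), (gEquiv B₁ n).injective ?_⟩
      rw [gEquiv_map, AddEquiv.apply_symm_apply]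
      refine Finsupp.mapDomain_comapDomain _ (hi₁ n) _ ?_
      intro s hs
      have h' := congrArg (gEquiv C n) h
      rw [gEquiv_map, gEquiv_map] at h'
      have hs' : (gEquiv C n (((gChains G).map j₁).f n b₁)) ((j₁.app (op ⦋n⦌)).hom s) ≠ 0 := by
        rw [gEquiv_map]
        refine ne_of_eq_of_ne (Finsupp.mapDomain_apply (hj₁ n) _ s) ?_
        exact Finsupp.mem_support_iff.1 hs
      rw [gEquiv_map, h'] at hs'
      have hs'' := Finsupp.mapDomain_support (Finsupp.mem_support_iff.2 hs')
      obtain ⟨t, -, ht⟩ := Finset.mem_image.1 hs''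
      exact hpull n s t ht.symm
    obtain ⟨a, ha⟩ := key
    refine ⟨a, ha, gChains_injective j₂ n (hj₂ n) ?_⟩
    rw [← hc, ha, h]
  · intro n z
    induction z using gChains_induction with
    | zero => exact ⟨0, 0, by simp⟩
    | add x y hx hy =>
      obtain ⟨a, b, rfl⟩ := hx
      obtain ⟨c, d, rfl⟩ := hy
      exact ⟨a + c, b + d, by rw [map_add, map_add]; abel⟩
    | neg x hx =>
      obtain ⟨a, b, rfl⟩ := hx
      exact ⟨-a, -b, by rw [map_neg, map_neg]; abel⟩
    | hgen s =>
      rcases hsurj n s with ⟨b, rfl⟩ | ⟨b, rfl⟩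
      · exact ⟨gen B₁ n b, 0, by rw [map_gen, map_zero, sub_zero]⟩
      · exact ⟨0, -gen B₂ n b, by rw [map_neg, map_gen, map_zero]; abel⟩

end EndTheory

end

noncomputable section

namespace EndTheory

open Opposite Simplicial AlgebraicTopology

/-! ### Singular simplices of a space over `X`, lifted to the universal cover of `X` -/

section OverMaps

variable {X Y Z : Type} [TopologicalSpace X] [TopologicalSpace Y] [TopologicalSpace Z]

/-- A map of `A` into a member of `𝒰` and a lift of its composition with `φ : Y → X` to the
universal cover of `X`. -/
@[ext]
structure OverMap (φ : C(Y, X)) (x₀ : X) (𝒰 : Set (Set Y)) (A : Type) [TopologicalSpace A] where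
  toMap : C(A, Y)
  mem : ∃ U ∈ 𝒰, ∀ a, toMap a ∈ U
  lift : ∀ a, Path.Homotopic.Quotient (φ (toMap a)) x₀
  compat : ∀ (a b : A) (p : Path a b),
    lift a = (Path.Homotopic.Quotient.mk (p.map (φ.comp toMap).continuous)).trans (lift b)

namespace OverMap

variable {φ : C(Y, X)} {x₀ : X} {𝒰 𝒱 : Set (Set Y)} {A B : Type} [TopologicalSpace A]
  [TopologicalSpace B]

/-- Precomposition. -/
def precomp (c : OverMap φ x₀ 𝒰 B) (ψ : C(A, B)) : OverMap φ x₀ 𝒰 A where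
  toMap := c.toMap.comp ψ
  mem := let ⟨U, hU, h⟩ := c.mem; ⟨U, hU, fun a => h (ψ a)⟩
  lift a := c.lift (ψ a)
  compat a b p := c.compat (ψ a) (ψ b) (p.map ψ.continuous)

theorem precomp_precomp {D : Type} [TopologicalSpace D] (c : OverMap φ x₀ 𝒰 D) (ψ : C(B, D))
    (χ : C(A, B)) : (c.precomp ψ).precomp χ = c.precomp (ψ.comp χ) := rfl

@[simp] theorem precomp_id (c : OverMap φ x₀ 𝒰 A) : c.precomp (.id A) = c := rfl

instance : MulAction (FundamentalGroup X x₀) (OverMap φ x₀ 𝒰 A) where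
  smul g c := ⟨c.toMap, c.mem, fun a => (c.lift a).trans g.toPath, fun a b p => by
    rw [c.compat a b p, Path.Homotopic.Quotient.trans_assoc]⟩
  one_smul c := OverMap.ext rfl (heq_of_eq (funext fun a =>
    Path.Homotopic.Quotient.trans_refl (c.lift a)))
  mul_smul g h c := OverMap.ext rfl (heq_of_eq (funext fun a =>
    (Path.Homotopic.Quotient.trans_assoc (c.lift a) h.toPath g.toPath).symm))

theorem smul_lift (g : FundamentalGroup X x₀) (c : OverMap φ x₀ 𝒰 A) (a : A) :
    (g • c).lift a = (c.lift a).trans g.toPath := rfl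

theorem eq_one_of_smul_eq [Nonempty A] (g : FundamentalGroup X x₀) (c : OverMap φ x₀ 𝒰 A)
    (h : g • c = c) : g = 1 := by
  obtain ⟨a⟩ := ‹Nonempty A›
  have h' : HEq (g • c).lift c.lift := by rw [h]
  have h'' := congrFun (eq_of_heq h') a
  rw [smul_lift] at h''
  have := congrArg (fun p => (c.lift a).symm.trans p) h''
  simp only [← Path.Homotopic.Quotient.trans_assoc, Path.Homotopic.Quotient.symm_trans,
    Path.Homotopic.Quotient.refl_trans] at this
  exact this

/-- Postcomposition with a map `f : Y → Z`. -/
def postcomp {φ : C(Z, X)} (f : C(Y, Z)) {𝒱 : Set (Set Z)}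
    (h : ∀ U ∈ 𝒰, ∃ V ∈ 𝒱, Set.MapsTo f U V) (c : OverMap (φ.comp f) x₀ 𝒰 A) :
    OverMap φ x₀ 𝒱 A where
  toMap := f.comp c.toMap
  mem := by
    obtain ⟨U, hU, hc⟩ := c.mem
    obtain ⟨V, hV, hf⟩ := h U hU
    exact ⟨V, hV, fun a => hf (hc a)⟩
  lift a := c.lift a
  compat := c.compat

/-- Enlarging the cover. -/
def incl (h : ∀ U ∈ 𝒰, ∃ V ∈ 𝒱, U ⊆ V) (c : OverMap φ x₀ 𝒰 A) : OverMap φ x₀ 𝒱 A where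
  toMap := c.toMap
  mem := by
    obtain ⟨U, hU, hc⟩ := c.mem
    obtain ⟨V, hV, hf⟩ := h U hU
    exact ⟨V, hV, fun a => hf (hc a)⟩
  lift := c.lift
  compat := c.compat

theorem incl_injective (h : ∀ U ∈ 𝒰, ∃ V ∈ 𝒱, U ⊆ V) :
    Function.Injective (incl h : OverMap φ x₀ 𝒰 A → OverMap φ x₀ 𝒱 A) := by
  rintro ⟨m, _, l, _⟩ ⟨m', _, l', _⟩ hc
  have h₁ : m = m' := congrArg OverMap.toMap hc
  subst h₁
  have h₂ : HEq l l' := by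
    have : HEq (incl h ⟨m, ‹_›, l, ‹_›⟩ : OverMap φ x₀ 𝒱 A).lift
      (incl h ⟨m, ‹_›, l', ‹_›⟩ : OverMap φ x₀ 𝒱 A).lift := by rw [hc]
    exact this
  exact OverMap.ext rfl h₂

theorem exists_incl_eq (h : ∀ U ∈ 𝒰, ∃ V ∈ 𝒱, U ⊆ V) (c : OverMap φ x₀ 𝒱 A)
    (hc : ∃ U ∈ 𝒰, ∀ a, c.toMap a ∈ U) : ∃ c', incl h c' = c :=
  ⟨⟨c.toMap, hc, c.lift, c.compat⟩, rfl⟩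

theorem postcomp_bijective {φ : C(Z, X)} (f : C(Y, Z)) (hf : IsEmbedding f)
    (h : ∀ U ∈ ({Set.univ} : Set (Set Y)), ∃ V ∈ ({Set.range f} : Set (Set Z)), Set.MapsTo f U V) :
    Function.Bijective (postcomp f h :
      OverMap (φ.comp f) x₀ {Set.univ} A → OverMap φ x₀ {Set.range f} A) := by
  constructor
  · rintro ⟨m, _, l, _⟩ ⟨m', _, l', _⟩ hc
    have h₁ : m = m' := ContinuousMap.ext fun a => hf.injective
      (congrArg (fun c : OverMap φ x₀ {Set.range f} A => c.toMap a) hc)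
    subst h₁
    have h₂ : HEq l l' := by
      have : HEq (postcomp f h ⟨m, ‹_›, l, ‹_›⟩ : OverMap φ x₀ {Set.range f} A).lift
        (postcomp f h ⟨m, ‹_›, l', ‹_›⟩ : OverMap φ x₀ {Set.range f} A).lift := by rw [hc]
      exact this
    exact OverMap.ext rfl h₂
  · rintro ⟨m, hm, l, hl⟩
    have hr : ∀ a, m a ∈ Set.range f := by
      obtain ⟨U, rfl, hU⟩ := hm
      exact hU
    let m' : C(A, Y) := ⟨fun a => hf.toHomeomorph.symm ⟨m a, hr a⟩, by fun_prop⟩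
    have hm' : m = f.comp m' := by
      ext a
      exact (congrArg Subtype.val (hf.toHomeomorph.apply_symm_apply ⟨m a, hr a⟩)).symm
    clear_value m'
    subst hm'
    exact ⟨⟨m', ⟨_, rfl, fun _ => trivial⟩, l, hl⟩, rfl⟩

end OverMap

/-- The singular simplicial set of `Y` (small of order `𝒰`), pulled back to the universal cover
of `X`. -/
def overSet (φ : C(Y, X)) (x₀ : X) (𝒰 : Set (Set Y)) :
    SimplicialObject (Action (Type) (FundamentalGroup X x₀)) where
  obj n := Action.ofMulAction (FundamentalGroup X x₀)
    (OverMap φ x₀ 𝒰 (SimplexCategory.toTop₀.obj n.unop))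
  map ψ := ⟨↾fun c => c.precomp (SimplexCategory.toTop₀.map ψ.unop).hom, fun _ => rfl⟩
  map_id n := Action.hom_ext _ _ (by
    ext c
    change c.precomp (SimplexCategory.toTop₀.map (𝟙 n.unop)).hom = c
    rw [SimplexCategory.toTop₀.map_id]; rfl)
  map_comp φ ψ := Action.hom_ext _ _ (by
    ext c
    change c.precomp (SimplexCategory.toTop₀.map (ψ.unop ≫ φ.unop)).hom = _
    rw [SimplexCategory.toTop₀.map_comp]; rfl)

variable (φ : C(Y, X)) (x₀ : X) (𝒰 : Set (Set Y))

/-- The chains of `Y`, small of order `𝒰`, with coefficients in `ℤ[π₁(X)]`. -/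
abbrev overChains : ChainComplex (ModuleCat.{0} (GroupRing X x₀)) ℕ :=
  (gChains (FundamentalGroup X x₀)).obj (overSet φ x₀ 𝒰)

theorem overChains_projective (n : ℕ) : Projective ((overChains φ x₀ 𝒰).X n) :=
  gChains_projective n fun g s h => OverMap.eq_one_of_smul_eq g
    (show OverMap φ x₀ 𝒰 (SimplexCategory.toTop₀.obj ⦋n⦌) from s) h

variable {φ x₀ 𝒰}

/-- Postcomposition as a map of simplicial sets. -/
def overSetMap {φ : C(Z, X)} (f : C(Y, Z)) {𝒱 : Set (Set Z)}
    (h : ∀ U ∈ 𝒰, ∃ V ∈ 𝒱, Set.MapsTo f U V) :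
    overSet (φ.comp f) x₀ 𝒰 ⟶ overSet φ x₀ 𝒱 where
  app _ := ⟨↾fun c => OverMap.postcomp f h c, fun _ => rfl⟩

/-- Enlarging the cover as a map of simplicial sets. -/
def overSetIncl {𝒱 : Set (Set Y)} (h : ∀ U ∈ 𝒰, ∃ V ∈ 𝒱, U ⊆ V) :
    overSet φ x₀ 𝒰 ⟶ overSet φ x₀ 𝒱 where
  app _ := ⟨↾fun c => OverMap.incl h c, fun _ => rfl⟩

theorem quasiIso_overSetMap_of_embedding {φ : C(Z, X)} (f : C(Y, Z)) (hf : IsEmbedding f)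
    (h : ∀ U ∈ ({Set.univ} : Set (Set Y)), ∃ V ∈ ({Set.range f} : Set (Set Z)), Set.MapsTo f U V) :
    QuasiIso ((gChains _).map (overSetMap f h : overSet (φ.comp f) x₀ _ ⟶ overSet φ x₀ _)) :=
  gChains_quasiIso_of_bijective _ fun _ => OverMap.postcomp_bijective f hf h

/-- The comparison with the singular simplicial set of the universal cover. -/
def overSetToCover (X : Type) [TopologicalSpace X] (x₀ : X) :
    overSet (ContinuousMap.id X) x₀ {Set.univ} ⟶ coverSingularSet X x₀ where
  app _ := ⟨↾fun c => ⟨c.toMap, c.lift, c.compat⟩, fun _ => rfl⟩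

theorem quasiIso_overSetToCover (X : Type) [TopologicalSpace X] (x₀ : X) :
    QuasiIso ((gChains _).map (overSetToCover X x₀)) := by
  refine gChains_quasiIso_of_bijective _ fun n => ⟨?_, ?_⟩
  · rintro ⟨m, _, l, _⟩ ⟨m', _, l', _⟩ hc
    have h₁ : m = m' := congrArg CoverMap.toMap hc
    subst h₁
    have h₂ : HEq l l' := by
      have : HEq (CoverMap.mk m l ‹_› : CoverMap X x₀ _).lift
        (CoverMap.mk m l' ‹_› : CoverMap X x₀ _).lift := by
          exact congr_arg_heq CoverMap.lift hc
      exact this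
    exact OverMap.ext rfl h₂
  · rintro ⟨m, l, h⟩
    exact ⟨⟨m, ⟨_, rfl, fun _ => trivial⟩, l, h⟩, rfl⟩

theorem coverChains_projective (X : Type) [TopologicalSpace X] (x₀ : X) (n : ℕ) :
    Projective ((coverChains X x₀).X n) := by
  refine gChains_projective (S := coverSingularSet X x₀) n fun g s h => ?_
  obtain ⟨a⟩ : Nonempty (SimplexCategory.toTop₀.obj ⦋n⦌) := inferInstance
  obtain ⟨c, hc⟩ : ∃ c : CoverMap X x₀ (SimplexCategory.toTop₀.obj ⦋n⦌), c = s := ⟨s, rfl⟩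
  have h' : g • c = c := by rw [hc]; exact h
  refine OverMap.eq_one_of_smul_eq g (⟨c.toMap, ⟨Set.univ, rfl, fun _ => trivial⟩, c.lift,
    c.compat⟩ : OverMap (ContinuousMap.id X) x₀ {Set.univ} _) (OverMap.ext rfl ?_)
  exact congr_arg_heq CoverMap.lift h'

variable (φ x₀) in
/-- The chains of `U ⊆ Y` with coefficients in `ℤ[π₁(X)]` are of finite free type. -/
def IsFiniteTypeOver (U : Set Y) : Prop := HasFiniteFreeType (overChains φ x₀ {U})

theorem isFiniteTypeOver_empty : IsFiniteTypeOver φ x₀ (∅ : Set Y) := by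
  refine hasFiniteFreeType_of_subsingleton fun n => ?_
  have : IsEmpty (((underlying _).obj (overSet φ x₀ {∅})).obj (op ⦋n⦌)) := by
    refine ⟨fun c => ?_⟩
    obtain ⟨U, rfl, h⟩ := OverMap.mem (show OverMap φ x₀ {∅} (SimplexCategory.toTop₀.obj ⦋n⦌) from c)
    obtain ⟨a⟩ : Nonempty (SimplexCategory.toTop₀.obj ⦋n⦌) := inferInstance
    exact h a
  exact (gEquiv (overSet φ x₀ {∅}) n).injective.subsingleton

end OverMaps

end EndTheory

end

noncomputable section

namespace EndTheory

open Opposite Simplicial AlgebraicTopology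

/-! ### Formal barycentric subdivision -/

section Additive

variable {α M N : Type*} [AddCommGroup M] [AddCommGroup N]

/-- Additive extension of a function to integral chains. -/
def additiveExt (g : α → M) : (α →₀ ℤ) →+ M := (Finsupp.linearCombination ℤ g).toAddMonoidHom

@[simp] theorem additiveExt_single (g : α → M) (a : α) : additiveExt g (Finsupp.single a 1) = g a := by
  refine (Finsupp.linearCombination_single ℤ (1 : ℤ) a).trans (one_smul _ _)

theorem finsupp_addHom_ext {f g : (α →₀ ℤ) →+ M} (h : ∀ a, f (.single a 1) = g (.single a 1)) :
    f = g := by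
  refine Finsupp.addHom_ext fun a k => ?_
  have : (Finsupp.single a k : α →₀ ℤ) = k • Finsupp.single a 1 := by simp
  rw [this, map_zsmul, map_zsmul, h]

theorem finsupp_addHom_congr {f g : (α →₀ ℤ) →+ M} (h : ∀ a, f (.single a 1) = g (.single a 1))
    (c : α →₀ ℤ) : f c = g c := DFunLike.congr_fun (finsupp_addHom_ext h) c

end Additive

section Subdivision

variable {S S' : SSet.{0}}

/-- The map on integral chains induced by a simplicial map. -/
def fmap (r : S ⟶ S') (n : ℕ) : FChain S n →+ FChain S' n :=
  Finsupp.mapDomain.addMonoidHom (r.app (op ⦋n⦌))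

theorem fmap_single (r : S ⟶ S') (n : ℕ) (s : S.obj (op ⦋n⦌)) :
    fmap r n (.single s 1) = .single (r.app (op ⦋n⦌) s) 1 := Finsupp.mapDomain_single

theorem fbdry_fmap (r : S ⟶ S') (n : ℕ) (c : FChain S (n + 1)) :
    fbdry S' n (fmap r (n + 1) c) = fmap r n (fbdry S n c) := fbdry_mapDomain r n c

theorem fbdry_fbdry (n : ℕ) (c : FChain S (n + 2)) : fbdry S n (fbdry S (n + 1) c) = 0 := by
  refine (freeComplex_d S n _).symm.trans ?_
  refine (congrArg ((freeComplex S).d (n + 1) n) (freeComplex_d S (n + 1) c).symm).trans ?_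
  exact d_d_apply (C := freeComplex S) _ _ _ c

/-- The simplicial set of all finite sequences in `T`. -/
def tuples (T : Type) : SSet.{0} where
  obj n := Fin (n.unop.len + 1) → T
  map f := ↾fun w => w ∘ f.unop.toOrderHom

variable {T T' : Type}

/-- A function induces a map of sequences. -/
def tuplesMap (u : T → T') : tuples T ⟶ tuples T' where
  app _ := ↾fun w => u ∘ w

/-- A sequence as a chain. -/
def tup {n : ℕ} (w : Fin (n + 1) → T) : FChain (tuples T) n := Finsupp.single w 1

theorem tuples_hom_congr {M : Type*} [AddCommGroup M] {n : ℕ} {f g : FChain (tuples T) n →+ M}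
    (h : ∀ w : Fin (n + 1) → T, f (tup w) = g (tup w)) (c : FChain (tuples T) n) : f c = g c :=
  finsupp_addHom_congr h c

theorem fbdry_tup (n : ℕ) (w : Fin (n + 2) → T) :
    fbdry (tuples T) n (tup w) = ∑ i : Fin (n + 2), (-1 : ℤ) ^ (i : ℕ) • tup (w ∘ i.succAbove) :=
  fbdry_single (S := tuples T) n w

theorem fmap_tup (u : T → T') {n : ℕ} (w : Fin (n + 1) → T) :
    fmap (tuplesMap u) n (tup w) = tup (u ∘ w) := fmap_single _ _ _

/-- Coning off. -/
def coneTup (b : T) (n : ℕ) : FChain (tuples T) n →+ FChain (tuples T) (n + 1) :=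
  Finsupp.mapDomain.addMonoidHom fun w : Fin (n + 1) → T => (Fin.cons b w : Fin (n + 2) → T)

theorem coneTup_tup (b : T) {n : ℕ} (w : Fin (n + 1) → T) :
    coneTup b n (tup w) = tup (Fin.cons b w : Fin (n + 2) → T) := Finsupp.mapDomain_single

theorem fbdry_coneTup (b : T) (n : ℕ) (c : FChain (tuples T) (n + 1)) :
    fbdry (tuples T) (n + 1) (coneTup b (n + 1) c) = c - coneTup b n (fbdry (tuples T) n c) := by
  refine tuples_hom_congr (f := (fbdry (tuples T) (n + 1)).comp (coneTup b (n + 1)))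
    (g := AddMonoidHom.id _ - (coneTup b n).comp (fbdry (tuples T) n)) (fun w => ?_) c
  change fbdry (tuples T) (n + 1) (coneTup b (n + 1) (tup w)) =
    tup w - coneTup b n (fbdry (tuples T) n (tup w))
  rw [coneTup_tup, fbdry_tup, fbdry_tup, Fin.sum_univ_succ, map_sum, sub_eq_add_neg,
    ← Finset.sum_neg_distrib]
  congr 1
  · simp only [Fin.val_zero, pow_zero, one_smul]
    congr 1
  · refine Finset.sum_congr rfl fun i _ => ?_
    rw [map_zsmul, coneTup_tup, Fin.val_succ, pow_succ, mul_neg_one, neg_smul]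
    congr 3
    funext j
    refine Fin.cases ?_ (fun j => ?_) j <;> simp

/-- The augmentation. -/
def augTup (T : Type) : FChain (tuples T) 0 →+ ℤ := additiveExt fun _ => 1

theorem fbdry_coneTup_zero (b : T) (c : FChain (tuples T) 0) :
    fbdry (tuples T) 0 (coneTup b 0 c) = c - augTup T c • tup fun _ => b := by
  refine tuples_hom_congr (f := (fbdry (tuples T) 0).comp (coneTup b 0))
    (g := AddMonoidHom.id _ - (zmultiplesHom _ (tup fun _ => b)).comp
      (augTup T)) (fun w => ?_) c
  have : augTup T (tup w) = 1 := additiveExt_single _ _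
  change fbdry (tuples T) 0 (coneTup b 0 (tup w)) = tup w - augTup T (tup w) • tup fun _ => b
  rw [coneTup_tup, fbdry_tup, Fin.sum_univ_two, this]
  simp only [Fin.val_zero, pow_zero, one_smul, Fin.val_one, pow_one, neg_smul, sub_eq_add_neg]
  refine congrArg₂ (· + ·) (congrArg tup (funext fun j => ?_))
    (congrArg (fun v => -tup v) (funext fun j => ?_)) <;>
  · obtain rfl : j = (0 : Fin 1) := Subsingleton.elim (α := Fin 1) j 0
    rfl

theorem augTup_fbdry (c : FChain (tuples T) 1) : augTup T (fbdry (tuples T) 0 c) = 0 := by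
  refine tuples_hom_congr (f := (augTup T).comp (fbdry (tuples T) 0)) (g := 0) (fun w => ?_) c
  change augTup T (fbdry (tuples T) 0 (tup w)) = 0
  have h : ∀ v, augTup T (tup v) = 1 := fun v => additiveExt_single _ _
  rw [fbdry_tup, Fin.sum_univ_two, map_add, map_zsmul, map_zsmul, h, h]
  rfl

variable (bary : ∀ n : ℕ, (Fin (n + 1) → T) → T)

/-- Barycentric subdivision. -/
def sdTup (n : ℕ) : FChain (tuples T) n →+ FChain (tuples T) n :=
  match n with
  | 0 => AddMonoidHom.id _
  | n + 1 => additiveExt fun w : Fin (n + 2) → T =>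
      coneTup (bary (n + 1) w) n (sdTup n (fbdry (tuples T) n (tup w)))

/-- The homotopy between the identity and barycentric subdivision. -/
def sdHtpy (n : ℕ) : FChain (tuples T) n →+ FChain (tuples T) (n + 1) :=
  match n with
  | 0 => 0
  | n + 1 => additiveExt fun w : Fin (n + 2) → T =>
      coneTup (bary (n + 1) w) (n + 1) (tup w - sdHtpy n (fbdry (tuples T) n (tup w)))

theorem sdTup_succ {n : ℕ} (w : Fin (n + 2) → T) : sdTup bary (n + 1) (tup w) =
    coneTup (bary (n + 1) w) n (sdTup bary n (fbdry (tuples T) n (tup w))) :=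
  additiveExt_single _ _

theorem sdHtpy_succ {n : ℕ} (w : Fin (n + 2) → T) : sdHtpy bary (n + 1) (tup w) =
    coneTup (bary (n + 1) w) (n + 1) (tup w - sdHtpy bary n (fbdry (tuples T) n (tup w))) :=
  additiveExt_single _ _

theorem fbdry_sdTup (n : ℕ) (c : FChain (tuples T) (n + 1)) :
    fbdry (tuples T) n (sdTup bary (n + 1) c) = sdTup bary n (fbdry (tuples T) n c) := by
  induction n with
  | zero =>
    refine tuples_hom_congr (f := (fbdry (tuples T) 0).comp (sdTup bary 1))
      (g := (sdTup bary 0).comp (fbdry (tuples T) 0)) (fun w => ?_) c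
    change fbdry (tuples T) 0 (sdTup bary 1 (tup w)) = sdTup bary 0 (fbdry (tuples T) 0 (tup w))
    rw [sdTup_succ, fbdry_coneTup_zero]
    have : augTup T (sdTup bary 0 (fbdry (tuples T) 0 (tup w))) = 0 := augTup_fbdry _
    rw [this, zero_smul, sub_zero]
  | succ n ih =>
    refine tuples_hom_congr (f := (fbdry (tuples T) (n + 1)).comp (sdTup bary (n + 2)))
      (g := (sdTup bary (n + 1)).comp (fbdry (tuples T) (n + 1))) (fun w => ?_) c
    change fbdry (tuples T) (n + 1) (sdTup bary (n + 2) (tup w)) =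
      sdTup bary (n + 1) (fbdry (tuples T) (n + 1) (tup w))
    rw [sdTup_succ, fbdry_coneTup, ih, fbdry_fbdry, map_zero, map_zero, sub_zero]

theorem fbdry_sdHtpy (n : ℕ) (c : FChain (tuples T) (n + 1)) :
    fbdry (tuples T) (n + 1) (sdHtpy bary (n + 1) c) =
      c - sdTup bary (n + 1) c - sdHtpy bary n (fbdry (tuples T) n c) := by
  refine tuples_hom_congr (f := (fbdry (tuples T) (n + 1)).comp (sdHtpy bary (n + 1)))
    (g := AddMonoidHom.id _ - sdTup bary (n + 1) - (sdHtpy bary n).comp (fbdry (tuples T) n))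
    (fun w => ?_) c
  change fbdry (tuples T) (n + 1) (sdHtpy bary (n + 1) (tup w)) =
    tup w - sdTup bary (n + 1) (tup w) - sdHtpy bary n (fbdry (tuples T) n (tup w))
  suffices h : fbdry (tuples T) n (tup w - sdHtpy bary n (fbdry (tuples T) n (tup w))) =
      sdTup bary n (fbdry (tuples T) n (tup w)) by
    rw [sdHtpy_succ, fbdry_coneTup, h, sdTup_succ]
    abel
  cases n with
  | zero => exact congrArg _ (sub_zero _)
  | succ n =>
    rw [map_sub, fbdry_sdHtpy n, fbdry_fbdry, map_zero, sub_zero, sub_sub_cancel]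

variable {bary} {bary' : ∀ n : ℕ, (Fin (n + 1) → T') → T'}

theorem fmap_coneTup (u : T → T') (b : T) (n : ℕ) (c : FChain (tuples T) n) :
    fmap (tuplesMap u) (n + 1) (coneTup b n c) = coneTup (u b) n (fmap (tuplesMap u) n c) := by
  refine tuples_hom_congr (f := (fmap (tuplesMap u) (n + 1)).comp (coneTup b n))
    (g := (coneTup (u b) n).comp (fmap (tuplesMap u) n)) (fun w => ?_) c
  change fmap (tuplesMap u) (n + 1) (coneTup b n (tup w)) =
    coneTup (u b) n (fmap (tuplesMap u) n (tup w))
  rw [coneTup_tup, fmap_tup, fmap_tup, coneTup_tup]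
  congr 1
  funext j
  refine Fin.cases ?_ (fun j => ?_) j <;> simp

theorem fmap_sdTup (u : T → T') (h : ∀ n w, u (bary n w) = bary' n (u ∘ w)) (n : ℕ)
    (c : FChain (tuples T) n) :
    fmap (tuplesMap u) n (sdTup bary n c) = sdTup bary' n (fmap (tuplesMap u) n c) := by
  induction n with
  | zero => rfl
  | succ n ih =>
    refine tuples_hom_congr (f := (fmap (tuplesMap u) (n + 1)).comp (sdTup bary (n + 1)))
      (g := (sdTup bary' (n + 1)).comp (fmap (tuplesMap u) (n + 1))) (fun w => ?_) c
    change fmap (tuplesMap u) (n + 1) (sdTup bary (n + 1) (tup w)) =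
      sdTup bary' (n + 1) (fmap (tuplesMap u) (n + 1) (tup w))
    rw [sdTup_succ, fmap_coneTup, ih, fmap_tup, sdTup_succ, h, ← fbdry_fmap, fmap_tup]

theorem fmap_sdHtpy (u : T → T') (h : ∀ n w, u (bary n w) = bary' n (u ∘ w)) (n : ℕ)
    (c : FChain (tuples T) n) :
    fmap (tuplesMap u) (n + 1) (sdHtpy bary n c) = sdHtpy bary' n (fmap (tuplesMap u) n c) := by
  induction n with
  | zero => exact map_zero _
  | succ n ih =>
    refine tuples_hom_congr (f := (fmap (tuplesMap u) (n + 2)).comp (sdHtpy bary (n + 1)))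
      (g := (sdHtpy bary' (n + 1)).comp (fmap (tuplesMap u) (n + 1))) (fun w => ?_) c
    change fmap (tuplesMap u) (n + 2) (sdHtpy bary (n + 1) (tup w)) =
      sdHtpy bary' (n + 1) (fmap (tuplesMap u) (n + 1) (tup w))
    rw [sdHtpy_succ, fmap_coneTup, map_sub, ih, fmap_tup, sdHtpy_succ, h, ← fbdry_fmap, fmap_tup]

end Subdivision

end EndTheory

end

noncomputable section

namespace EndTheory

open Opposite Simplicial AlgebraicTopology

/-! ### Affine simplices in the standard simplex -/

section Affine

/-- The standard simplex. -/
abbrev Spx (n : ℕ) : Type := stdSimplex ℝ (Fin (n + 1))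

variable {n m k : ℕ}

/-- The affine map between standard simplices with given vertices. -/
def affMap (w : Fin (m + 1) → Spx n) : C(Spx m, Spx n) where
  toFun t := ⟨∑ i, t i • (w i).1, (convex_stdSimplex ℝ _).sum_mem (fun i _ => stdSimplex.zero_le t i)
    (stdSimplex.sum_eq_one t) fun i _ => (w i).2⟩
  continuous_toFun := by
    refine Continuous.subtype_mk (continuous_finsetSum _ fun i _ => ?_) _
    exact ((continuous_apply i).comp continuous_subtype_val).smul continuous_const

theorem affMap_coe (w : Fin (m + 1) → Spx n) (t : Spx m) :
    (affMap w t).1 = ∑ i, t i • (w i).1 := rfl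

theorem affMap_apply (w : Fin (m + 1) → Spx n) (t : Spx m) (j : Fin (n + 1)) :
    affMap w t j = ∑ i, t i * w i j := by
  change (affMap w t).1 j = _
  rw [affMap_coe, Finset.sum_apply]
  rfl

theorem affMap_vertex : affMap (fun i : Fin (n + 1) => (stdSimplex.vertex i : Spx n)) = .id _ := by
  ext t j
  change affMap _ t j = t j
  rw [affMap_apply, Finset.sum_eq_single j]
  · simp
  · intro i _ hi
    rw [stdSimplex.vertex_coe, Pi.single_eq_of_ne hi.symm, mul_zero]
  · simp

theorem affMap_affMap (w : Fin (m + 1) → Spx n) (v : Fin (k + 1) → Spx m) (t : Spx k) :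
    affMap w (affMap v t) = affMap (affMap w ∘ v) t := by
  ext j
  simp only [affMap_apply, Function.comp_apply, Finset.sum_mul, Finset.mul_sum]
  rw [Finset.sum_comm]
  simp only [mul_assoc]

theorem affMap_apply_vertex (w : Fin (m + 1) → Spx n) (i : Fin (m + 1)) :
    affMap w (stdSimplex.vertex i) = w i := by
  ext j
  rw [affMap_apply, Finset.sum_eq_single i]
  · simp
  · intro i' _ hi
    rw [stdSimplex.vertex_coe, Pi.single_eq_of_ne hi, zero_mul]
  · simp

theorem affMap_comp (w : Fin (m + 1) → Spx n) (θ : Fin (k + 1) → Fin (m + 1)) (t : Spx k) :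
    affMap (w ∘ θ) t = affMap w (stdSimplex.map θ t) := by
  ext j
  simp only [affMap_apply, Function.comp_apply, stdSimplex.map_coe,
    FunOnFinite.linearMap_apply_apply, Finset.sum_mul]
  rw [← Finset.sum_fiberwise Finset.univ θ]
  exact Finset.sum_congr rfl fun i _ => Finset.sum_congr rfl fun a ha => by
    rw [(Finset.mem_filter.1 ha).2]

/-- The barycenter of the vertices of an affine simplex. -/
def affBary (m : ℕ) (w : Fin (m + 1) → Spx n) : Spx n := affMap w stdSimplex.barycenter

theorem affMap_affBary (u : Fin (m + 1) → Spx n) (k : ℕ) (w : Fin (k + 1) → Spx m) :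
    affMap u (affBary k w) = affBary k (affMap u ∘ w) := affMap_affMap _ _ _

theorem dist_affMap_le (w : Fin (m + 1) → Spx n) (t : Spx m) (x : Spx n) (r : ℝ)
    (h : ∀ i, dist (w i) x ≤ r) : dist (affMap w t) x ≤ r :=
  (convex_closedBall x.1 r).sum_mem (fun i _ => stdSimplex.zero_le t i)
    (stdSimplex.sum_eq_one t) fun i _ => h i

theorem dist_affBary_le (w : Fin (m + 1) → Spx n) (δ : ℝ) (h : ∀ i j, dist (w i) (w j) ≤ δ)
    (j : Fin (m + 1)) : dist (affBary m w) (w j) ≤ m / (m + 1) * δ := by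
  have hm : (0 : ℝ) < m + 1 := by positivity
  have h₁ : (affBary m w).1 - (w j).1 = ((m : ℝ) + 1)⁻¹ • ∑ i ∈ Finset.univ.erase j,
      ((w i).1 - (w j).1) := by
    have e : (affBary m w).1 = ((m : ℝ) + 1)⁻¹ • ∑ i, (w i).1 := by
      rw [affBary, affMap_coe, Finset.smul_sum]
      refine Finset.sum_congr rfl fun i _ => ?_
      congr 1
      refine (stdSimplex.barycenter_apply i).trans ?_
      simp
    rw [e, Finset.sum_erase _ (sub_self _), Finset.sum_sub_distrib, smul_sub]
    congr 1
    rw [Finset.sum_const, Finset.card_univ, Fintype.card_fin, ← Nat.cast_smul_eq_nsmul ℝ, smul_smul]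
    push_cast
    rw [inv_mul_cancel₀ hm.ne', one_smul]
  rw [Subtype.dist_eq, dist_eq_norm, h₁, norm_smul, norm_inv, Real.norm_of_nonneg hm.le]
  have h₂ : ‖∑ i ∈ Finset.univ.erase j, ((w i).1 - (w j).1)‖ ≤ m * δ := by
    refine (norm_sum_le_of_le (f := fun i => (w i).1 - (w j).1) _ (n := fun _ => δ)
      fun i _ => ?_).trans ?_
    · rw [← dist_eq_norm]; exact h i j
    · rw [Finset.sum_const, Finset.card_erase_of_mem (Finset.mem_univ _), Finset.card_univ,
        Fintype.card_fin, nsmul_eq_mul]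
      simp
  calc ((m : ℝ) + 1)⁻¹ * _ ≤ ((m : ℝ) + 1)⁻¹ * (m * δ) := by gcongr
    _ = m / (m + 1) * δ := by ring

theorem exists_support_of_hom {α β : Type*} (F : (α →₀ ℤ) →+ (β →₀ ℤ)) (c : α →₀ ℤ) (b : β)
    (hb : b ∈ (F c).support) : ∃ a ∈ c.support, b ∈ (F (.single a 1)).support := by
  by_contra! h
  refine Finsupp.mem_support_iff.1 hb ?_
  have : c = ∑ a ∈ c.support, c a • Finsupp.single a 1 := by
    conv_lhs => rw [← Finsupp.sum_single c]
    exact Finset.sum_congr rfl fun a _ => by simp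
  rw [this, map_sum, Finsupp.finsetSum_apply]
  refine Finset.sum_eq_zero fun a ha => ?_
  rw [map_zsmul, Finsupp.smul_apply, Finsupp.notMem_support_iff.1 (h a ha), smul_zero]

theorem exists_support_sum {ι β : Type*} (s : Finset ι) (f : ι → β →₀ ℤ) (b : β)
    (hb : b ∈ (∑ i ∈ s, f i).support) : ∃ i ∈ s, b ∈ (f i).support := by
  by_contra! h
  refine Finsupp.mem_support_iff.1 hb ?_
  rw [Finsupp.finsetSum_apply]
  exact Finset.sum_eq_zero fun i hi => Finsupp.notMem_support_iff.1 (h i hi)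

theorem exists_support_coneTup {T : Type} (b : T) (c : FChain (tuples T) m)
    (w : Fin (m + 2) → T) (hw : w ∈ (coneTup b m c).support) :
    ∃ v : Fin (m + 1) → T, v ∈ c.support ∧ w = (Fin.cons b v : Fin (m + 2) → T) := by
  classical
  obtain ⟨v, hv, e⟩ := Finset.mem_image.1 (Finsupp.mapDomain_support hw)
  exact ⟨v, hv, e.symm⟩

theorem mem_support_tup {T : Type} {w v : Fin (m + 1) → T} (h : v ∈ (tup w).support) : v = w :=
  Finset.mem_singleton.1 (Finsupp.support_single_subset h)

theorem exists_support_sdTup {T : Type} (bary : ∀ n : ℕ, (Fin (n + 1) → T) → T)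
    (w : Fin (m + 2) → T) (w' : Fin (m + 2) → T)
    (h : w' ∈ (sdTup bary (m + 1) (tup w)).support) :
    ∃ (i : Fin (m + 2)) (v : Fin (m + 1) → T), v ∈ (sdTup bary m (tup (w ∘ i.succAbove))).support ∧
      w' = (Fin.cons (bary (m + 1) w) v : Fin (m + 2) → T) := by
  rw [sdTup_succ] at h
  obtain ⟨v, hv, rfl⟩ := exists_support_coneTup _ _ _ h
  rw [fbdry_tup, map_sum] at hv
  obtain ⟨i, -, hi⟩ := exists_support_sum _ _ _ hv
  rw [map_zsmul] at hi
  exact ⟨i, v, Finsupp.support_smul hi, rfl⟩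

theorem sdTup_diam (w w' : Fin (m + 1) → Spx n)
    (h : w' ∈ (sdTup (affBary (n := n)) m (tup w)).support) :
    (∀ x r, (∀ i, dist (w i) x ≤ r) → ∀ i, dist (w' i) x ≤ r) ∧
    ∀ δ, (∀ i j, dist (w i) (w j) ≤ δ) → ∀ i j, dist (w' i) (w' j) ≤ m / (m + 1) * δ := by
  induction m with
  | zero =>
    obtain rfl := mem_support_tup h
    refine ⟨fun x r h => h, fun δ hδ i j => ?_⟩
    rw [Subsingleton.elim (α := Fin 1) i j, dist_self]
    simp
  | succ m ih =>
    obtain ⟨i, v, hv, rfl⟩ := exists_support_sdTup _ _ _ h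
    obtain ⟨ih₁, ih₂⟩ := ih _ _ hv
    refine ⟨fun x r hr j => ?_, fun δ hδ => ?_⟩
    rotate_left
    · have hb : ∀ j, dist (v j) (affBary (m + 1) w) ≤ (m + 1 : ℕ) / ((m + 1 : ℕ) + 1) * δ := by
        refine ih₁ _ _ fun a => ?_
        rw [dist_comm]
        exact dist_affBary_le w δ hδ _
      have hδ₀ : 0 ≤ δ := by simpa using hδ 0 0
      have hr : (m : ℝ) / (m + 1) * δ ≤ (m + 1 : ℕ) / ((m + 1 : ℕ) + 1) * δ := by
        refine mul_le_mul_of_nonneg_right ?_ hδ₀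
        rw [div_le_div_iff₀ (by positivity) (by positivity)]
        push_cast
        nlinarith
      intro a j
      induction a using Fin.cases with
      | zero =>
        induction j using Fin.cases with
        | zero => rw [dist_self]; positivity
        | succ j => rw [dist_comm]; exact hb j
      | succ a =>
        induction j using Fin.cases with
        | zero => exact hb a
        | succ j => exact (ih₂ δ (fun _ _ => hδ _ _) a j).trans hr
    · induction j using Fin.cases with
      | zero => exact dist_affMap_le _ _ _ _ hr
      | succ j => exact ih₁ x r (fun a => hr _) j

theorem sdTup_iterate_diam (c : FChain (tuples (Spx n)) m) (δ : ℝ)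
    (hc : ∀ w : Fin (m + 1) → Spx n, w ∈ c.support → ∀ i j, dist (w i) (w j) ≤ δ) (k : ℕ)
    (w : Fin (m + 1) → Spx n) (hw : w ∈ ((sdTup (affBary (n := n)) m)^[k] c).support) (i j) :
    dist (w i) (w j) ≤ (m / (m + 1)) ^ k * δ := by
  induction k generalizing w i j with
  | zero => simpa using hc w hw i j
  | succ k ih =>
    rw [Function.iterate_succ_apply'] at hw
    obtain ⟨v, hv, hw⟩ := exists_support_of_hom _ _ _ hw
    have := (sdTup_diam v w hw).2 _ (fun i j => ih v hv i j) i j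
    rwa [← mul_assoc, ← pow_succ'] at this

end Affine

end EndTheory

end

noncomputable section

namespace EndTheory

open Opposite Simplicial AlgebraicTopology

/-! ### Subdivision of singular chains and small simplices -/

section OverSubdivision

variable {X Y : Type} [TopologicalSpace X] [TopologicalSpace Y]
  {φ : C(Y, X)} {x₀ : X} {𝒰 𝒱 : Set (Set Y)}

variable (φ x₀ 𝒰) in
/-- The simplicial set underlying `overSet`. -/
abbrev overSSet : SSet.{0} := (underlying (FundamentalGroup X x₀)).obj (overSet φ x₀ 𝒰)

/-- A simplex as a chain. -/
def osimp {n : ℕ} (s : OverMap φ x₀ 𝒰 (Spx n)) : FChain (overSSet φ x₀ 𝒰) n := Finsupp.single s 1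

theorem over_hom_congr {M : Type*} [AddCommGroup M] {n : ℕ}
    {f g : FChain (overSSet φ x₀ 𝒰) n →+ M}
    (h : ∀ s : OverMap φ x₀ 𝒰 (Spx n), f (osimp s) = g (osimp s)) (c : FChain (overSSet φ x₀ 𝒰) n) :
    f c = g c :=
  finsupp_addHom_congr h c

/-- The affine simplices of a singular simplex. -/
def tupleSimplex {n : ℕ} (s : OverMap φ x₀ 𝒰 (Spx n)) : tuples (Spx n) ⟶ overSSet φ x₀ 𝒰 where
  app m := ↾fun w => s.precomp (affMap (m := m.unop.len) w)
  naturality m k f := by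
    ext w
    change Fin (m.unop.len + 1) → Spx n at w
    change s.precomp (affMap (m := k.unop.len) (w ∘ f.unop.toOrderHom)) =
      s.precomp ((affMap w).comp ⟨_, stdSimplex.continuous_map f.unop⟩)
    congr 1
    ext1 t
    exact affMap_comp w f.unop.toOrderHom t

theorem fmap_tupleSimplex {n m : ℕ} (s : OverMap φ x₀ 𝒰 (Spx n)) (w : Fin (m + 1) → Spx n) :
    fmap (tupleSimplex s) m (tup w) = osimp (s.precomp (affMap w)) := fmap_single _ _ _

/-- The vertices of the standard simplex. -/
def vert (n : ℕ) (i : Fin (n + 1)) : Spx n := stdSimplex.vertex i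

theorem fmap_tupleSimplex_vert {n : ℕ} (s : OverMap φ x₀ 𝒰 (Spx n)) :
    fmap (tupleSimplex s) n (tup (vert n)) = osimp s := by
  rw [fmap_tupleSimplex]
  exact congrArg osimp ((congrArg s.precomp affMap_vertex).trans (OverMap.precomp_id s))

theorem fmap_tupleSimplex_precomp {n m k : ℕ} (s : OverMap φ x₀ 𝒰 (Spx n))
    (w : Fin (m + 1) → Spx n) (c : FChain (tuples (Spx m)) k) :
    fmap (tupleSimplex (s.precomp (affMap w))) k c =
      fmap (tupleSimplex s) k (fmap (tuplesMap (affMap w)) k c) := by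
  refine tuples_hom_congr (f := fmap (tupleSimplex (s.precomp (affMap w))) k)
    (g := (fmap (tupleSimplex s) k).comp (fmap (tuplesMap (affMap w)) k)) (fun v => ?_) c
  rw [fmap_tupleSimplex, AddMonoidHom.comp_apply, fmap_tup, fmap_tupleSimplex,
    OverMap.precomp_precomp]
  exact congrArg osimp (congrArg s.precomp (ContinuousMap.ext fun t => affMap_affMap _ _ _))

variable (φ x₀ 𝒰) in
/-- Subdivision of singular chains. -/
def sdOver (n : ℕ) : FChain (overSSet φ x₀ 𝒰) n →+ FChain (overSSet φ x₀ 𝒰) n :=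
  additiveExt fun s : OverMap φ x₀ 𝒰 (Spx n) =>
    fmap (tupleSimplex s) n (sdTup affBary n (tup (vert n)))

variable (φ x₀ 𝒰) in
/-- The homotopy between the identity and subdivision of singular chains. -/
def htOver (n : ℕ) : FChain (overSSet φ x₀ 𝒰) n →+ FChain (overSSet φ x₀ 𝒰) (n + 1) :=
  additiveExt fun s : OverMap φ x₀ 𝒰 (Spx n) =>
    fmap (tupleSimplex s) (n + 1) (sdHtpy affBary n (tup (vert n)))

theorem sdOver_osimp {n : ℕ} (s : OverMap φ x₀ 𝒰 (Spx n)) : sdOver φ x₀ 𝒰 n (osimp s) =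
    fmap (tupleSimplex s) n (sdTup affBary n (tup (vert n))) := additiveExt_single _ _

theorem htOver_osimp {n : ℕ} (s : OverMap φ x₀ 𝒰 (Spx n)) : htOver φ x₀ 𝒰 n (osimp s) =
    fmap (tupleSimplex s) (n + 1) (sdHtpy affBary n (tup (vert n))) := additiveExt_single _ _

theorem affMap_comp_vert {n m : ℕ} (w : Fin (m + 1) → Spx n) : affMap w ∘ vert m = w :=
  funext fun i => affMap_apply_vertex w i

theorem sdOver_fmap {n m : ℕ} (s : OverMap φ x₀ 𝒰 (Spx n)) (c : FChain (tuples (Spx n)) m) :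
    sdOver φ x₀ 𝒰 m (fmap (tupleSimplex s) m c) =
      fmap (tupleSimplex s) m (sdTup affBary m c) := by
  refine tuples_hom_congr (f := (sdOver φ x₀ 𝒰 m).comp (fmap (tupleSimplex s) m))
    (g := (fmap (tupleSimplex s) m).comp (sdTup affBary m)) (fun w => ?_) c
  rw [AddMonoidHom.comp_apply, AddMonoidHom.comp_apply, fmap_tupleSimplex, sdOver_osimp,
    fmap_tupleSimplex_precomp, fmap_sdTup (bary' := affBary) _ (fun k v => affMap_affBary w k v),
    fmap_tup, affMap_comp_vert]

theorem htOver_fmap {n m : ℕ} (s : OverMap φ x₀ 𝒰 (Spx n)) (c : FChain (tuples (Spx n)) m) :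
    htOver φ x₀ 𝒰 m (fmap (tupleSimplex s) m c) =
      fmap (tupleSimplex s) (m + 1) (sdHtpy affBary m c) := by
  refine tuples_hom_congr (f := (htOver φ x₀ 𝒰 m).comp (fmap (tupleSimplex s) m))
    (g := (fmap (tupleSimplex s) (m + 1)).comp (sdHtpy affBary m)) (fun w => ?_) c
  rw [AddMonoidHom.comp_apply, AddMonoidHom.comp_apply, fmap_tupleSimplex, htOver_osimp,
    fmap_tupleSimplex_precomp, fmap_sdHtpy (bary' := affBary) _ (fun k v => affMap_affBary w k v),
    fmap_tup, affMap_comp_vert]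

theorem fbdry_htOver (n : ℕ) (c : FChain (overSSet φ x₀ 𝒰) (n + 1)) :
    fbdry _ (n + 1) (htOver φ x₀ 𝒰 (n + 1) c) =
      c - sdOver φ x₀ 𝒰 (n + 1) c - htOver φ x₀ 𝒰 n (fbdry _ n c) := by
  refine over_hom_congr (f := (fbdry _ (n + 1)).comp (htOver φ x₀ 𝒰 (n + 1)))
    (g := AddMonoidHom.id _ - sdOver φ x₀ 𝒰 (n + 1) - (htOver φ x₀ 𝒰 n).comp (fbdry _ n))
    (fun s => ?_) c
  change fbdry _ (n + 1) (htOver φ x₀ 𝒰 (n + 1) (osimp s)) =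
    osimp s - sdOver φ x₀ 𝒰 (n + 1) (osimp s) - htOver φ x₀ 𝒰 n (fbdry _ n (osimp s))
  rw [← fmap_tupleSimplex_vert s, htOver_fmap, fbdry_fmap, fbdry_sdHtpy, map_sub, map_sub,
    sdOver_fmap, fbdry_fmap, htOver_fmap]

theorem fbdry_sdOver (n : ℕ) (c : FChain (overSSet φ x₀ 𝒰) (n + 1)) :
    fbdry _ n (sdOver φ x₀ 𝒰 (n + 1) c) = sdOver φ x₀ 𝒰 n (fbdry _ n c) := by
  refine over_hom_congr (f := (fbdry _ n).comp (sdOver φ x₀ 𝒰 (n + 1)))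
    (g := (sdOver φ x₀ 𝒰 n).comp (fbdry _ n)) (fun s => ?_) c
  change fbdry _ n (sdOver φ x₀ 𝒰 (n + 1) (osimp s)) = sdOver φ x₀ 𝒰 n (fbdry _ n (osimp s))
  rw [← fmap_tupleSimplex_vert s, sdOver_fmap, fbdry_fmap, fbdry_sdTup, fbdry_fmap, sdOver_fmap]

/-- Enlarging the cover. -/
abbrev inclSSet (x₀ : X) (φ : C(Y, X)) (h : ∀ U ∈ 𝒰, ∃ V ∈ 𝒱, U ⊆ V) :
    overSSet φ x₀ 𝒰 ⟶ overSSet φ x₀ 𝒱 := (underlying _).map (overSetIncl h)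

theorem fmap_incl_osimp (h : ∀ U ∈ 𝒰, ∃ V ∈ 𝒱, U ⊆ V) {n : ℕ} (s : OverMap φ x₀ 𝒰 (Spx n)) :
    fmap (inclSSet x₀ φ h) n (osimp s) = osimp (OverMap.incl h s) := fmap_single _ _ _

theorem fmap_incl_tupleSimplex (h : ∀ U ∈ 𝒰, ∃ V ∈ 𝒱, U ⊆ V) {n m : ℕ}
    (s : OverMap φ x₀ 𝒰 (Spx n)) (c : FChain (tuples (Spx n)) m) :
    fmap (inclSSet x₀ φ h) m (fmap (tupleSimplex s) m c) =
      fmap (tupleSimplex (OverMap.incl h s)) m c := by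
  refine tuples_hom_congr (f := (fmap (inclSSet x₀ φ h) m).comp (fmap (tupleSimplex s) m))
    (g := fmap (tupleSimplex (OverMap.incl h s)) m) (fun w => ?_) c
  rw [AddMonoidHom.comp_apply, fmap_tupleSimplex, fmap_tupleSimplex, fmap_incl_osimp]
  rfl

theorem sdOver_incl (h : ∀ U ∈ 𝒰, ∃ V ∈ 𝒱, U ⊆ V) {n : ℕ} (c : FChain (overSSet φ x₀ 𝒰) n) :
    sdOver φ x₀ 𝒱 n (fmap (inclSSet x₀ φ h) n c) = fmap (inclSSet x₀ φ h) n (sdOver φ x₀ 𝒰 n c) := by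
  refine over_hom_congr (f := (sdOver φ x₀ 𝒱 n).comp (fmap (inclSSet x₀ φ h) n))
    (g := (fmap (inclSSet x₀ φ h) n).comp (sdOver φ x₀ 𝒰 n)) (fun s => ?_) c
  rw [AddMonoidHom.comp_apply, AddMonoidHom.comp_apply, fmap_incl_osimp, sdOver_osimp,
    sdOver_osimp, fmap_incl_tupleSimplex]

theorem htOver_incl (h : ∀ U ∈ 𝒰, ∃ V ∈ 𝒱, U ⊆ V) {n : ℕ} (c : FChain (overSSet φ x₀ 𝒰) n) :
    htOver φ x₀ 𝒱 n (fmap (inclSSet x₀ φ h) n c) =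
      fmap (inclSSet x₀ φ h) (n + 1) (htOver φ x₀ 𝒰 n c) := by
  refine over_hom_congr (f := (htOver φ x₀ 𝒱 n).comp (fmap (inclSSet x₀ φ h) n))
    (g := (fmap (inclSSet x₀ φ h) (n + 1)).comp (htOver φ x₀ 𝒰 n)) (fun s => ?_) c
  rw [AddMonoidHom.comp_apply, AddMonoidHom.comp_apply, fmap_incl_osimp, htOver_osimp,
    htOver_osimp, fmap_incl_tupleSimplex]

/-- Iterated subdivision makes every chain small. -/
theorem exists_sdOver_iterate_small (h : ∀ U ∈ 𝒰, ∃ V ∈ 𝒱, U ⊆ V)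
    (hopen : ∀ V ∈ 𝒱, ∀ y ∈ V, ∃ U ∈ 𝒰, ∃ O, IsOpen O ∧ y ∈ O ∧ O ∩ V ⊆ U) (n : ℕ)
    (c : FChain (overSSet φ x₀ 𝒱) n) :
    ∃ K : ℕ, ∀ k ≥ K, ∃ b, (sdOver φ x₀ 𝒱 n)^[k] c = fmap (inclSSet x₀ φ h) n b := by
  have hadd : ∀ k c d, (sdOver φ x₀ 𝒱 n)^[k] (c + d) =
      (sdOver φ x₀ 𝒱 n)^[k] c + (sdOver φ x₀ 𝒱 n)^[k] d := fun k c d => iterate_map_add _ _ _ _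
  induction c using Finsupp.induction_linear with
  | zero => exact ⟨0, fun k _ => ⟨0, by rw [map_zero]; exact iterate_map_zero _ _⟩⟩
  | add c d hc hd =>
    obtain ⟨K, hK⟩ := hc
    obtain ⟨L, hL⟩ := hd
    refine ⟨max K L, fun k hk => ?_⟩
    obtain ⟨b, hb⟩ := hK k (le_of_max_le_left hk)
    obtain ⟨e, he⟩ := hL k (le_of_max_le_right hk)
    exact ⟨b + e, by rw [map_add, ← hb, ← he]; exact hadd k c d⟩
  | single s z =>
    change OverMap φ x₀ 𝒱 (Spx n) at s
    have hs : (Finsupp.single s z : FChain (overSSet φ x₀ 𝒱) n) = z • osimp s := by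
      exact ((Finsupp.smul_single z s (1 : ℤ)).trans (congrArg _ (mul_one z))).symm
    suffices H : ∃ K : ℕ, ∀ k ≥ K, ∀ w : Fin (n + 1) → Spx n,
        w ∈ ((sdTup (affBary (n := n)) n)^[k] (tup (vert n))).support →
          ∃ U ∈ 𝒰, ∀ t, s.toMap (affMap w t) ∈ U by
      obtain ⟨K, hK⟩ := H
      refine ⟨K, fun k hk => ?_⟩
      have hit : (sdOver φ x₀ 𝒱 n)^[k] (osimp s) =
          fmap (tupleSimplex s) n ((sdTup (affBary (n := n)) n)^[k] (tup (vert n))) := by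
        clear hk
        induction k with
        | zero => exact (fmap_tupleSimplex_vert s).symm
        | succ k ih => rw [Function.iterate_succ_apply', ih, sdOver_fmap,
            Function.iterate_succ_apply']
      have key : ∀ c : FChain (tuples (Spx n)) n,
          (∀ w : Fin (n + 1) → Spx n, w ∈ c.support → ∃ U ∈ 𝒰, ∀ t, s.toMap (affMap w t) ∈ U) →
          ∃ b, fmap (tupleSimplex s) n c = fmap (inclSSet x₀ φ h) n b := by
        intro c hc
        have hsum : c = ∑ w ∈ c.support, c w • tup w := by
          conv_lhs => rw [← Finsupp.sum_single c]
          refine Finset.sum_congr rfl fun w _ => ?_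
          exact ((Finsupp.smul_single (c w) w (1 : ℤ)).trans (congrArg _ (mul_one _))).symm
        rw [hsum, map_sum]
        refine Finset.sum_induction _ (fun x => ∃ b, x = fmap (inclSSet x₀ φ h) n b) ?_
          ⟨0, (map_zero _).symm⟩ fun w hw => ?_
        · rintro _ _ ⟨b, rfl⟩ ⟨d, rfl⟩
          exact ⟨b + d, (map_add _ _ _).symm⟩
        · obtain ⟨g, hg⟩ := OverMap.exists_incl_eq h (s.precomp (affMap w)) (hc w hw)
          refine ⟨c w • osimp g, ?_⟩
          rw [map_zsmul, map_zsmul, fmap_incl_osimp, hg]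
          exact congrArg _ (fmap_tupleSimplex s w)
      obtain ⟨b, hb⟩ := key _ (hK k hk)
      refine ⟨z • b, ?_⟩
      rw [map_zsmul, ← hb, ← hit]
      refine (congrArg (sdOver φ x₀ 𝒱 n)^[k] hs).trans ?_
      exact iterate_map_zsmul _ _ _ _
    obtain ⟨V, hV, hsV⟩ := s.mem
    obtain ⟨δ, hδ, hball⟩ := lebesgue_number_lemma_of_metric_sUnion (s := (Set.univ : Set (Spx n)))
      (c := {N | IsOpen N ∧ ∃ U ∈ 𝒰, ∀ t ∈ N, s.toMap t ∈ U}) isCompact_univ (fun _ h => h.1) (by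
        intro t _
        obtain ⟨U, hU, O, hO, hy, hOU⟩ := hopen V hV (s.toMap t) (hsV t)
        exact ⟨s.toMap ⁻¹' O, ⟨hO.preimage s.toMap.continuous, U, hU,
          fun t' ht' => hOU ⟨ht', hsV t'⟩⟩, hy⟩)
    set r : ℝ := n / (n + 1) with hr
    have hr₀ : 0 ≤ r := by positivity
    have hr₁ : r < 1 := by rw [hr, div_lt_one (by positivity)]; linarith
    obtain ⟨D, hD⟩ := Metric.isBounded_iff.1 (isCompact_univ (X := Spx n)).isBounded
    have hlim : Filter.Tendsto (fun k : ℕ => r ^ k * D) Filter.atTop (𝓝 0) := by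
      simpa using (tendsto_pow_atTop_nhds_zero_of_lt_one hr₀ hr₁).mul_const D
    obtain ⟨K, hK⟩ := Filter.eventually_atTop.1 (hlim.eventually_lt_const hδ)
    refine ⟨K, fun k hk w hw => ?_⟩
    obtain ⟨N, ⟨-, U, hU, hN⟩, hwN⟩ := hball (w 0) trivial
    refine ⟨U, hU, fun t => hN _ (hwN ?_)⟩
    refine (dist_affMap_le w t (w 0) (r ^ k * D) fun i => ?_).trans_lt (hK k hk)
    exact sdTup_iterate_diam (tup (vert n)) D (fun v _ i j => hD trivial trivial) k w hw i 0

theorem quasiIso_overSetIncl (h : ∀ U ∈ 𝒰, ∃ V ∈ 𝒱, U ⊆ V)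
    (hopen : ∀ V ∈ 𝒱, ∀ y ∈ V, ∃ U ∈ 𝒰, ∃ O, IsOpen O ∧ y ∈ O ∧ O ∩ V ⊆ U) :
    QuasiIso ((gChains (FundamentalGroup X x₀)).map
      (overSetIncl h : overSet φ x₀ 𝒰 ⟶ overSet φ x₀ 𝒱)) := by
  set f := (gChains (FundamentalGroup X x₀)).map
      (overSetIncl h : overSet φ x₀ 𝒰 ⟶ overSet φ x₀ 𝒱) with hf
  have hfmap : ∀ n x, gEquiv (overSet φ x₀ 𝒱) n (f.f n x) =
    fmap (inclSSet x₀ φ h) n (gEquiv _ n x) := fun n x => rfl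
  refine quasiIso_of_relatively_acyclic _ (fun n => gChains_injective _ n
    (OverMap.incl_injective h)) fun n z hz => ?_
  suffices H : ∃ w b, gEquiv (overSet φ x₀ 𝒱) n z - fbdry _ n w = fmap (inclSSet x₀ φ h) n b by
    obtain ⟨w, b, hw⟩ := H
    refine ⟨(gEquiv _ (n + 1)).symm w, (gEquiv _ n).symm b, (gEquiv _ n).injective ?_⟩
    rw [map_sub, gEquiv_d, AddEquiv.apply_symm_apply, hw, hfmap, AddEquiv.apply_symm_apply]
  obtain ⟨K, hK⟩ := exists_sdOver_iterate_small (φ := φ) (x₀ := x₀) h hopen n (gEquiv _ n z)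
  obtain ⟨b, hb⟩ := hK K le_rfl
  cases n with
  | zero =>
    refine ⟨0, b, ?_⟩
    rw [map_zero, sub_zero, ← hb]
    have : sdOver φ x₀ 𝒱 0 = AddMonoidHom.id _ := by
      refine AddMonoidHom.ext fun c => ?_
      exact over_hom_congr (g := AddMonoidHom.id _) (fun s => (sdOver_osimp s).trans
        (show fmap (tupleSimplex s) 0 (tup (vert 0)) = osimp s from fmap_tupleSimplex_vert s)) c
    rw [this]
    exact (Function.iterate_id K ▸ rfl)
  | succ n =>
    obtain ⟨c, hc⟩ := hz n
    have hz' : ∃ c, fbdry _ n (gEquiv (overSet φ x₀ 𝒱) (n + 1) z) = fmap (inclSSet x₀ φ h) n c :=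
      ⟨gEquiv _ n c, by rw [← gEquiv_d, ← hc, hfmap]⟩
    generalize gEquiv (overSet φ x₀ 𝒱) (n + 1) z = y at hz' hb
    clear hK
    induction K generalizing y with
    | zero => exact ⟨0, b, by rw [map_zero, sub_zero]; exact hb⟩
    | succ K ih =>
      obtain ⟨c, hc⟩ := hz'
      obtain ⟨w, e, he⟩ := ih (sdOver φ x₀ 𝒱 (n + 1) y)
        ⟨sdOver φ x₀ 𝒰 n c, by rw [fbdry_sdOver, hc, sdOver_incl]⟩ hb
      refine ⟨htOver φ x₀ 𝒱 (n + 1) y + w, e + htOver φ x₀ 𝒰 n c, ?_⟩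
      rw [map_add, map_add, fbdry_htOver, hc, htOver_incl, ← he]
      abel

end OverSubdivision

section MayerVietoris

variable {X Y : Type} [TopologicalSpace X] [TopologicalSpace Y] {φ : C(Y, X)} {x₀ : X}

theorem OverMap.mem_singleton {U : Set Y} {A : Type} [TopologicalSpace A]
    (s : OverMap φ x₀ {U} A) (a : A) : s.toMap a ∈ U := by
  obtain ⟨V, rfl, h⟩ := s.mem
  exact h a

/-- Mayer–Vietoris: if `U` and `V` are relatively open in their union and `U`, `V`, `U ∩ V` are of
finite free type then so is `U ∪ V`. -/
theorem IsFiniteTypeOver.union {U V O P : Set Y} (hO : IsOpen O) (hP : IsOpen P)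
    (hUO : (U ∪ V) ∩ O = U) (hVP : (U ∪ V) ∩ P = V)
    (hU : IsFiniteTypeOver φ x₀ U) (hV : IsFiniteTypeOver φ x₀ V)
    (hUV : IsFiniteTypeOver φ x₀ (U ∩ V)) : IsFiniteTypeOver φ x₀ (U ∪ V) := by
  have h : ∀ S ∈ ({U, V} : Set (Set Y)), ∃ T ∈ ({U ∪ V} : Set (Set Y)), S ⊆ T := by
    rintro S (rfl | rfl)
    · exact ⟨_, rfl, Set.subset_union_left⟩
    · exact ⟨_, rfl, Set.subset_union_right⟩
  have hopen : ∀ T ∈ ({U ∪ V} : Set (Set Y)), ∀ y ∈ T, ∃ S ∈ ({U, V} : Set (Set Y)),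
      ∃ O, IsOpen O ∧ y ∈ O ∧ O ∩ T ⊆ S := by
    rintro T rfl y (hy | hy)
    · refine ⟨U, .inl rfl, O, hO, ?_, ?_⟩
      · rw [← hUO] at hy; exact hy.2
      · rw [Set.inter_comm]; exact hUO.le
    · refine ⟨V, .inr rfl, P, hP, ?_, ?_⟩
      · rw [← hVP] at hy; exact hy.2
      · rw [Set.inter_comm]; exact hVP.le
  refine HasFiniteFreeType.of_quasiIso (C := overChains φ x₀ {U, V}) ?_ _
    (quasiIso_overSetIncl h hopen)
  have h₁ : ∀ S ∈ ({U ∩ V} : Set (Set Y)), ∃ T ∈ ({U} : Set (Set Y)), S ⊆ T := by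
    rintro S rfl; exact ⟨_, rfl, Set.inter_subset_left⟩
  have h₂ : ∀ S ∈ ({U ∩ V} : Set (Set Y)), ∃ T ∈ ({V} : Set (Set Y)), S ⊆ T := by
    rintro S rfl; exact ⟨_, rfl, Set.inter_subset_right⟩
  have k₁ : ∀ S ∈ ({U} : Set (Set Y)), ∃ T ∈ ({U, V} : Set (Set Y)), S ⊆ T := by
    rintro S rfl; exact ⟨_, .inl rfl, subset_rfl⟩
  have k₂ : ∀ S ∈ ({V} : Set (Set Y)), ∃ T ∈ ({U, V} : Set (Set Y)), S ⊆ T := by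
    rintro S rfl; exact ⟨_, .inr rfl, subset_rfl⟩
  refine HasFiniteFreeType.mayerVietoris_gChains (overSetIncl h₁) (overSetIncl h₂)
    (overSetIncl k₁) (overSetIncl k₂) rfl (fun n => OverMap.incl_injective h₁)
    (fun n => OverMap.incl_injective k₁) (fun n => OverMap.incl_injective k₂) ?_ ?_
    (overChains_projective φ x₀ _) (overChains_projective φ x₀ _) hUV hU hV
  · intro n b₁ b₂ hb
    change OverMap φ x₀ {U} (Spx n) at b₁
    change OverMap φ x₀ {V} (Spx n) at b₂
    have hm : b₁.toMap = b₂.toMap := congrArg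
      (OverMap.toMap (φ := φ) (x₀ := x₀) (𝒰 := {U, V}) (A := Spx n)) hb
    exact OverMap.exists_incl_eq h₁ b₁ ⟨_, rfl, fun a => ⟨b₁.mem_singleton a,
      by rw [hm]; exact b₂.mem_singleton a⟩⟩
  · intro n c
    change OverMap φ x₀ {U, V} (Spx n) at c
    obtain ⟨S, rfl | rfl, hS⟩ := c.mem
    · exact .inl (OverMap.exists_incl_eq k₁ c ⟨_, rfl, hS⟩)
    · exact .inr (OverMap.exists_incl_eq k₂ c ⟨_, rfl, hS⟩)

end MayerVietoris

end EndTheory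

end

noncomputable section

namespace EndTheory

open Opposite Simplicial AlgebraicTopology

/-! ### Homotopy invariance -/

section Slide

variable {X Y : Type} [TopologicalSpace X] [TopologicalSpace Y]

instance : ContractibleSpace unitInterval := (convex_Icc (0 : ℝ) 1).contractibleSpace ⟨0, by simp⟩

theorem eq_of_projLeft_eq {A : Type} [TopologicalSpace A] {a b : A} {r t : unitInterval}
    (p q : Path.Homotopic.Quotient (a, r) (b, t))
    (h : Path.Homotopic.projLeft p = Path.Homotopic.projLeft q) : p = q := by
  rw [← Path.Homotopic.prod_projLeft_projRight p, ← Path.Homotopic.prod_projLeft_projRight q, h,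
    Subsingleton.elim (Path.Homotopic.projRight p) (Path.Homotopic.projRight q)]

variable {Φ : C(Y × unitInterval, X)} {x₀ : X} {A B : Type} [TopologicalSpace A] [TopologicalSpace B]

/-- The class of the paths over a segment `{y} × I`. -/
def vertClass (Φ : C(Y × unitInterval, X)) (y : Y) (r t : unitInterval) : Path.Homotopic.Quotient (Φ (y, r)) (Φ (y, t)) :=
  .mk ((PathConnectedSpace.somePath r t).map (f := fun u => Φ (y, u)) (by fun_prop))

theorem vertClass_self (y : Y) (r : unitInterval) : vertClass Φ y r r = .refl _ := by
  have h : (Path.Homotopic.Quotient.mk (PathConnectedSpace.somePath r r)) = .mk (.refl r) :=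
    Subsingleton.elim _ _
  exact congrArg (fun p => Path.Homotopic.Quotient.map p
    (⟨fun u => Φ (y, u), by fun_prop⟩ : C(unitInterval, X))) h

/-- The inclusion of `Y × {ε}`. -/
def levelMap (Y : Type) [TopologicalSpace Y] (ε : unitInterval) : C(Y, Y × unitInterval) :=
  ⟨fun y => (y, ε), by fun_prop⟩

namespace OverMap

/-- Moving the `I`-coordinate of a map to `Y × I`. -/
def slide (s : OverMap Φ x₀ {Set.univ} A) (v : C(A, unitInterval)) : OverMap Φ x₀ {Set.univ} A where
  toMap := ⟨fun a => ((s.toMap a).1, v a), by fun_prop⟩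
  mem := ⟨_, rfl, fun _ => trivial⟩
  lift a := (vertClass Φ (s.toMap a).1 (v a) (s.toMap a).2).trans (s.lift a)
  compat a b p := by
    let G : C(A × unitInterval, X) := ⟨fun z => Φ ((s.toMap z.1).1, z.2), by fun_prop⟩
    let P : ∀ a : A, Path (a, v a) (a, (s.toMap a).2) := fun a =>
      (Path.refl a).prod (PathConnectedSpace.somePath _ _)
    let Q₁ : Path (a, (s.toMap a).2) (b, (s.toMap b).2) := p.prod (p.map (f := fun a => (s.toMap a).2) (by fun_prop))
    let Q₀ : Path (a, v a) (b, v b) := p.prod (p.map v.continuous)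
    have key : (Path.Homotopic.Quotient.mk (P a)).trans (.mk Q₁) = (.trans (.mk Q₀) (.mk (P b))) := by
      refine eq_of_projLeft_eq _ _ ?_
      rw [← Path.Homotopic.Quotient.mk_trans, ← Path.Homotopic.Quotient.mk_trans]
      have h₁ : ((P a).trans Q₁).map continuous_fst = (Path.refl a).trans p := by
        rw [Path.map_trans]; rfl
      have h₂ : (Q₀.trans (P b)).map continuous_fst = p.trans (Path.refl b) := by
        rw [Path.map_trans]; rfl
      refine (congrArg Path.Homotopic.Quotient.mk h₁).trans
        (Eq.trans ?_ (congrArg Path.Homotopic.Quotient.mk h₂).symm)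
      rw [Path.Homotopic.Quotient.mk_trans, Path.Homotopic.Quotient.mk_trans,
        Path.Homotopic.Quotient.mk_refl, Path.Homotopic.Quotient.mk_refl,
        Path.Homotopic.Quotient.refl_trans, Path.Homotopic.Quotient.trans_refl]
    have key' : (vertClass Φ (s.toMap a).1 (v a) (s.toMap a).2).trans
        (.mk (p.map (Φ.comp s.toMap).continuous)) =
        (Path.Homotopic.Quotient.mk (p.map (f := fun a => Φ ((s.toMap a).1, v a))
          (by fun_prop))).trans (vertClass Φ (s.toMap b).1 (v b) (s.toMap b).2) := by
      rw [← Path.Homotopic.Quotient.mk_trans, ← Path.Homotopic.Quotient.mk_trans] at key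
      have k := congrArg (fun q => Path.Homotopic.Quotient.map q G) key
      simp only [← Path.Homotopic.Quotient.mk_map, Path.map_trans] at k
      exact k
    rw [s.compat a b p, ← Path.Homotopic.Quotient.trans_assoc, key',
      Path.Homotopic.Quotient.trans_assoc]

theorem slide_precomp (s : OverMap Φ x₀ {Set.univ} B) (v : C(B, unitInterval)) (ψ : C(A, B)) :
    (s.slide v).precomp ψ = (s.precomp ψ).slide (v.comp ψ) := rfl

theorem slide_self (s : OverMap Φ x₀ {Set.univ} A) (v : C(A, unitInterval)) (hv : ∀ a, v a = (s.toMap a).2) :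
    s.slide v = s := by
  obtain rfl : v = ⟨fun a => (s.toMap a).2, by fun_prop⟩ := ContinuousMap.ext hv
  refine OverMap.ext rfl (heq_of_eq (funext fun a => ?_))
  change (vertClass Φ (s.toMap a).1 (s.toMap a).2 (s.toMap a).2).trans (s.lift a) = s.lift a
  rw [vertClass_self, Path.Homotopic.Quotient.refl_trans]

/-- Moving a map to `Y × I` to `Y × {ε}`. -/
def project (s : OverMap Φ x₀ {Set.univ} A) (ε : unitInterval) :
    OverMap (Φ.comp (levelMap Y ε)) x₀ {Set.univ} A where
  toMap := ⟨fun a => (s.toMap a).1, by fun_prop⟩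
  mem := ⟨_, rfl, fun _ => trivial⟩
  lift := (s.slide (.const A ε)).lift
  compat := (s.slide (.const A ε)).compat

end OverMap

theorem mapsTo_univ {Y Z : Type} {f : Y → Z} : ∀ U ∈ ({Set.univ} : Set (Set Y)),
    ∃ V ∈ ({Set.univ} : Set (Set Z)), Set.MapsTo f U V :=
  fun _ _ => ⟨_, rfl, fun _ _ => trivial⟩

/-- Projection to `Y × {ε}` as a simplicial map. -/
def projectMap (Φ : C(Y × unitInterval, X)) (x₀ : X) (ε : unitInterval) :
    overSSet Φ x₀ {Set.univ} ⟶ overSSet (Φ.comp (levelMap Y ε)) x₀ {Set.univ} where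
  app _ := ↾fun s => OverMap.project s ε

/-- The second barycentric coordinate of the image of a point under a map to the `1`-simplex. -/
def edgeCoord {n : ℕ} (e : Fin (n + 1) → Fin 2) : C(Spx n, unitInterval) :=
  ⟨fun a => ⟨stdSimplex.map e a 1, stdSimplex.zero_le _ _, stdSimplex.le_one _ _⟩, by
    refine Continuous.subtype_mk ?_ _
    exact (continuous_apply (1 : Fin 2)).comp
      (continuous_subtype_val.comp (stdSimplex.continuous_map e))⟩

theorem edgeCoord_map {n m : ℕ} (e : Fin (n + 1) → Fin 2) (f : Fin (m + 1) → Fin (n + 1))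
    (a : Spx m) : edgeCoord e (stdSimplex.map f a) = edgeCoord (e ∘ f) a :=
  Subtype.ext (DFunLike.congr_fun (stdSimplex.map_comp_apply f e a) 1)

theorem edgeCoord_zero {n : ℕ} (a : Spx n) : edgeCoord (fun _ => 0) a = 0 := by
  refine Subtype.ext ?_
  change stdSimplex.map (fun _ => 0) a 1 = 0
  rw [stdSimplex.map_coe, FunOnFinite.linearMap_apply_apply]
  simp

theorem edgeCoord_one {n : ℕ} (a : Spx n) : edgeCoord (fun _ => 1) a = 1 := by
  refine Subtype.ext ?_
  change stdSimplex.map (fun _ => 1) a 1 = 1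
  rw [stdSimplex.map_coe, FunOnFinite.linearMap_apply_apply]
  simp

/-- Sliding a simplex along a contraction `h` of the unit interval. -/
def OverMap.slideEdge (h : C(unitInterval × unitInterval, unitInterval)) {n : ℕ}
    (s : OverMap Φ x₀ {Set.univ} (Spx n)) (e : Fin (n + 1) → Fin 2) :
    OverMap Φ x₀ {Set.univ} (Spx n) :=
  s.slide ⟨fun a => h ((s.toMap a).2, edgeCoord e a), by fun_prop⟩

theorem OverMap.slideEdge_precomp (h : C(unitInterval × unitInterval, unitInterval)) {n m : ℕ}
    (s : OverMap Φ x₀ {Set.univ} (Spx n)) (e : Fin (n + 1) → Fin 2)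
    (f : Fin (m + 1) → Fin (n + 1)) :
    (s.precomp ⟨_, stdSimplex.continuous_map f⟩).slideEdge h (e ∘ f) =
      (s.slideEdge h e).precomp ⟨_, stdSimplex.continuous_map f⟩ := by
  refine Eq.trans ?_ (OverMap.slide_precomp s _ _).symm
  refine congrArg (OverMap.slide _) (ContinuousMap.ext fun a => ?_)
  exact congrArg (fun u => h ((s.toMap (stdSimplex.map f a)).2, u)) (edgeCoord_map e f a).symm

theorem OverMap.project_postcomp (ε : unitInterval)
    (s : OverMap (Φ.comp (levelMap Y ε)) x₀ {Set.univ} A) :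
    (OverMap.postcomp (levelMap Y ε) mapsTo_univ s).project ε = s := by
  refine OverMap.ext rfl (heq_of_eq (funext fun a => ?_))
  change (vertClass Φ (s.toMap a) ε ε).trans (s.lift a) = s.lift a
  rw [vertClass_self]
  exact Path.Homotopic.Quotient.refl_trans _

open MonoidalCategory in
/-- Sliding simplices along a contraction `h` of the unit interval. -/
def slideHomotopy (Φ : C(Y × unitInterval, X)) (x₀ : X)
    (h : C(unitInterval × unitInterval, unitInterval)) :
    overSSet Φ x₀ {Set.univ} ⊗ Δ[1] ⟶ overSSet Φ x₀ {Set.univ} where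
  app n := ↾fun p => OverMap.slideEdge (n := n.unop.len) h p.1
    (SSet.stdSimplex.objEquiv p.2).toOrderHom
  naturality n m f := by
    ext p
    exact OverMap.slideEdge_precomp (n := n.unop.len) (m := m.unop.len) h p.1
      (SSet.stdSimplex.objEquiv p.2).toOrderHom f.unop.toOrderHom

theorem quasiIso_levelMap (Φ : C(Y × unitInterval, X)) (x₀ : X) (ε : unitInterval)
    (h : C(unitInterval × unitInterval, unitInterval)) (h₀ : ∀ t, h (t, 0) = ε)
    (h₁ : ∀ t, h (t, 1) = t) :
    QuasiIso ((gChains _).map (overSetMap (x₀ := x₀) (φ := Φ) (levelMap Y ε) mapsTo_univ)) := by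
  let H : SSet.Homotopy (projectMap Φ x₀ ε ≫ (underlying _).map
      (overSetMap (x₀ := x₀) (φ := Φ) (levelMap Y ε) mapsTo_univ)) (𝟙 _) :=
    { h := slideHomotopy Φ x₀ h
      h₀ := by
        ext n s
        change OverMap Φ x₀ {Set.univ} (Spx n.unop.len) at s
        change OverMap.slide s _ = OverMap.slide s (.const _ ε)
        congr 1
        ext a : 1
        refine Eq.trans (congrArg (fun u => h ((s.toMap a).2, u)) ?_) (h₀ _)
        exact edgeCoord_zero a
      h₁ := by
        ext n s
        change OverMap Φ x₀ {Set.univ} (Spx n.unop.len) at s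
        refine OverMap.slide_self s _ fun a => ?_
        refine Eq.trans (congrArg (fun u => h ((s.toMap a).2, u)) ?_) (h₁ _)
        exact edgeCoord_one a
      rel := by ext _ ⟨⟨_, ⟨⟩⟩, _⟩ }
  refine gChains_quasiIso_of_retraction _ (projectMap Φ x₀ ε) ?_ H.toSimplicialObjectHomotopy
  ext n s
  change OverMap (Φ.comp (levelMap Y ε)) x₀ {Set.univ} (Spx n.unop.len) at s
  exact OverMap.project_postcomp ε s

theorem quasiIso_levelMap_zero (Φ : C(Y × unitInterval, X)) (x₀ : X) :
    QuasiIso ((gChains _).map (overSetMap (x₀ := x₀) (φ := Φ) (levelMap Y 0) mapsTo_univ)) :=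
  quasiIso_levelMap Φ x₀ 0 ⟨fun p => p.1 * p.2, by fun_prop⟩ (fun t => mul_zero t)
    (fun t => mul_one t)

theorem quasiIso_levelMap_one (Φ : C(Y × unitInterval, X)) (x₀ : X) :
    QuasiIso ((gChains _).map (overSetMap (x₀ := x₀) (φ := Φ) (levelMap Y 1) mapsTo_univ)) :=
  quasiIso_levelMap Φ x₀ 1 ⟨fun p => unitInterval.symm (unitInterval.symm p.1 * p.2), by fun_prop⟩
    (fun t => by simp) (fun t => by simp)

end Slide

end EndTheory

end

noncomputable section

namespace EndTheory

open Opposite Simplicial AlgebraicTopology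

section HomotopyEquivalence

variable {X Y Z : Type} [TopologicalSpace X] [TopologicalSpace Y] [TopologicalSpace Z] {x₀ : X}

variable (x₀) in
/-- The map on chains induced by `f : Y → Z` over `φ : Z → X`. -/
abbrev overChainsMap (φ : C(Z, X)) (f : C(Y, Z)) :
    overChains (φ.comp f) x₀ {Set.univ} ⟶ overChains φ x₀ {Set.univ} :=
  (gChains _).map (overSetMap f mapsTo_univ)

theorem overChainsMap_comp {T : Type} [TopologicalSpace T] (φ : C(Z, X)) (f : C(Y, Z))
    (g : C(T, Y)) : overChainsMap x₀ φ (f.comp g) =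
      overChainsMap x₀ (φ.comp f) g ≫ overChainsMap x₀ φ f :=
  (gChains _).map_comp (overSetMap (x₀ := x₀) (φ := φ.comp f) g mapsTo_univ)
    (overSetMap f mapsTo_univ)

theorem quasiIso_overChainsMap_id (φ : C(Y, X)) (f : C(Y, Y)) (hf : f = .id Y) :
    QuasiIso (overChainsMap x₀ φ f) := by
  subst hf
  exact gChains_quasiIso_of_bijective _ fun n => Function.bijective_id

theorem quasiIso_overChainsMap_level (φ : C(Y, X)) (K : C(Y × unitInterval, Y))
    (hK : K.comp (levelMap Y 1) = .id Y) : QuasiIso (overChainsMap x₀ φ (K.comp (levelMap Y 0))) := by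
  have h₂ := quasiIso_overChainsMap_id (x₀ := x₀) φ _ hK
  rw [overChainsMap_comp] at h₂
  have h₃ := quasiIso_levelMap_one (φ.comp K) x₀
  have h₄ := quasiIso_levelMap_zero (φ.comp K) x₀
  have h₅ : QuasiIso (overChainsMap x₀ φ K) :=
    quasiIso_of_comp_left (overChainsMap x₀ (φ.comp K) (levelMap Y 1)) (overChainsMap x₀ φ K)
  rw [overChainsMap_comp]
  infer_instance

theorem quasiIso_overChainsMap_of_homotopic (φ : C(Y, X)) (f : C(Y, Y)) (hf : f.Homotopic (.id Y)) :
    QuasiIso (overChainsMap x₀ φ f) := by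
  obtain ⟨H⟩ := hf
  have h := quasiIso_overChainsMap_level (x₀ := x₀) φ ⟨fun p => H (p.2, p.1), by fun_prop⟩
    (ContinuousMap.ext fun y => H.apply_one y)
  have e : ContinuousMap.comp ⟨fun p => H (p.2, p.1), by fun_prop⟩ (levelMap Y 0) = f :=
    ContinuousMap.ext fun y => H.apply_zero y
  rwa [e] at h

theorem quasiIso_of_two_out_of_six {R : Type} [Ring R] {C₁ C₂ C₃ C₄ : ChainComplex (ModuleCat.{0} R) ℕ}
    (f : C₁ ⟶ C₂) (g : C₂ ⟶ C₃) (h : C₃ ⟶ C₄) (hfg : QuasiIso (f ≫ g)) (hgh : QuasiIso (g ≫ h)) :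
    QuasiIso h := by
  have hg : QuasiIso g := by
    rw [quasiIso_iff] at hfg hgh ⊢
    simp only [quasiIsoAt_iff_isIso_homologyMap, ConcreteCategory.isIso_iff_bijective,
      HomologicalComplex.homologyMap_comp] at hfg hgh ⊢
    intro n
    constructor
    · refine Function.Injective.of_comp (f := HomologicalComplex.homologyMap h n) ?_
      exact (hgh n).1
    · refine Function.Surjective.of_comp (g := HomologicalComplex.homologyMap f n) ?_
      exact (hfg n).2
  exact quasiIso_of_comp_left g h

/-- Finite free type is invariant under homotopy equivalences. -/
theorem IsFiniteTypeOver.of_homotopyEquiv (e : ContinuousMap.HomotopyEquiv Y Z) (φ : C(Z, X))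
    (h : IsFiniteTypeOver (φ.comp e.toFun) x₀ Set.univ) : IsFiniteTypeOver φ x₀ Set.univ := by
  refine HasFiniteFreeType.of_quasiIso h (overChainsMap x₀ φ e.toFun) ?_
  refine quasiIso_of_two_out_of_six
    (overChainsMap x₀ ((φ.comp e.toFun).comp e.invFun) e.toFun)
    (overChainsMap x₀ (φ.comp e.toFun) e.invFun) _ ?_ ?_
  · rw [← overChainsMap_comp]
    exact quasiIso_overChainsMap_of_homotopic _ _ e.left_inv
  · rw [← overChainsMap_comp]
    exact quasiIso_overChainsMap_of_homotopic _ _ e.right_inv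

end HomotopyEquivalence

/-! ### Contractible spaces -/

section Point

theorem hasFiniteFreeType_of_resolution {R : Type} [Ring R] {C : ChainComplex (ModuleCat.{0} R) ℕ}
    (s : C.X 0) (hs : Function.Bijective fun r : R => r • s) (h₀ : ∀ x, C.d 1 0 x = 0)
    (h : ∀ n (z : C.X (n + 1)), C.d (n + 1) n z = 0 → IsBdry z) : HasFiniteFreeType C := by
  let M : ModuleCat.{0} R := ModuleCat.of R R
  let f : (ChainComplex.single₀ _).obj M ⟶ C := (ChainComplex.fromSingle₀Equiv C M).symm
    (ModuleCat.ofHom (LinearMap.toSpanSingleton R _ s))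
  have hf : ∀ r : R, f.f 0 r = r • s := fun r => by
    have : f.f 0 = ModuleCat.ofHom (LinearMap.toSpanSingleton R _ s) :=
      ChainComplex.fromSingle₀Equiv_symm_apply_f_zero _
    exact ConcreteCategory.congr_hom this r
  have hz : ∀ n, Subsingleton (((ChainComplex.single₀ _).obj M).X (n + 1)) := fun n =>
    ModuleCat.subsingleton_of_isZero (HomologicalComplex.isZero_single_obj_X _ _ _ _ (by simp))
  refine ⟨_, f, ⟨?_, ?_, 0, ?_⟩, ?_⟩
  · rintro (_ | n)
    · exact inferInstanceAs (Module.Finite R R)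
    · have := hz n; infer_instance
  · rintro (_ | n)
    · exact inferInstanceAs (Module.Free R R)
    · have := hz n; infer_instance
  · rintro (_ | n) hn
    · exact absurd hn (lt_irrefl _)
    · exact hz n
  · rw [quasiIso_iff_elementwise]
    constructor
    · rintro (_ | n) z hzc
      · obtain ⟨r, hr⟩ := hs.2 z
        exact ⟨r, isCycle_zero_degree _, 0, by rw [map_zero, hf]; exact (sub_eq_zero.2 hr.symm).symm⟩
      · refine ⟨0, fun j => map_zero _, ?_⟩
        rw [map_zero, sub_zero]
        exact h n z (hzc n)
    · rintro (_ | n) c hc ⟨w, hw⟩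
      · refine ⟨0, ?_⟩
        rw [map_zero]
        refine (hs.1 (a₁ := c) (a₂ := 0) ?_).symm
        refine ((hf c).symm.trans ?_).trans (zero_smul R s).symm
        rw [← hw, h₀]
      · exact ⟨0, (hz n).elim _ _⟩

theorem smul_gen_bijective {G : Type} [Group G] {S : SimplicialObject (Action Type G)} {n : ℕ}
    (s : (S.obj (op ⦋n⦌)).V) (hs : Function.Bijective fun g : G => (S.obj (op ⦋n⦌)).ρ g s) :
    Function.Bijective fun r : MonoidAlgebra ℤ G => r • gen S n s := by
  choose γ hγ using hs.2
  have hγ' : ∀ g, γ ((S.obj (op ⦋n⦌)).ρ g s) = g := fun g => hs.1 (hγ _)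
  constructor
  · let Ψ : FChain ((underlying G).obj S) n →+ MonoidAlgebra ℤ G :=
      additiveExt fun t : (S.obj (op ⦋n⦌)).V => MonoidAlgebra.single (γ t) (1 : ℤ)
    refine Function.LeftInverse.injective (g := fun x => Ψ (gEquiv S n x)) fun r => ?_
    change Ψ (gEquiv S n (r • gen S n s)) = r
    induction r using MonoidAlgebra.induction_on with
    | of g =>
      have : (MonoidAlgebra.of ℤ G g) • gen S n s = gen S n ((S.obj (op ⦋n⦌)).ρ g s) :=
        single_smul_gen n g s
      rw [this, gEquiv_gen]
      refine (additiveExt_single _ _).trans ?_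
      rw [hγ']; rfl
    | add a b ha hb => rw [add_smul, map_add, map_add, ha, hb]
    | smul k a ha => rw [smul_assoc, map_zsmul, map_zsmul, ha]
  · intro x
    induction x using gChains_induction with
    | zero => exact ⟨0, zero_smul _ _⟩
    | add x y hx hy =>
      obtain ⟨a, rfl⟩ := hx
      obtain ⟨b, rfl⟩ := hy
      exact ⟨a + b, add_smul _ _ _⟩
    | neg x hx =>
      obtain ⟨a, rfl⟩ := hx
      exact ⟨-a, neg_smul _ _⟩
    | hgen t =>
      refine ⟨MonoidAlgebra.single (γ t) 1, (single_smul_gen n _ _).trans ?_⟩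
      exact congrArg (gen S n) (hγ t)

theorem fbdry_of_constant {S : SSet.{0}} {n : ℕ} (h : ∀ i : Fin (n + 2), ∀ s, S.δ i s = S.δ 0 s)
    (c : FChain S (n + 1)) :
    fbdry S n c = if Even n then 0 else Finsupp.mapDomain (S.δ 0) c := by
  have h' : ∀ i : Fin (n + 2), Finsupp.mapDomain (S.δ i) c = Finsupp.mapDomain (S.δ 0) c :=
    fun i => congrArg (fun f => Finsupp.mapDomain f c) (funext (h i))
  rw [fbdry_apply]
  simp only [h']
  have e : ∑ i : Fin (n + 2), (-1 : ℤ) ^ (i : ℕ) • Finsupp.mapDomain (S.δ 0) c =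
      (∑ i : Fin (n + 2), (-1 : ℤ) ^ (i : ℕ)) • Finsupp.mapDomain (S.δ 0) c :=
    (Finset.sum_smul (f := fun i : Fin (n + 2) => (-1 : ℤ) ^ (i : ℕ))).symm
  refine e.trans ?_
  rw [Fin.sum_neg_one_pow]
  have : Even (n + 2) ↔ Even n := by simp [Nat.even_add]
  simp only [this]
  split_ifs
  · exact zero_smul _ _
  · exact one_smul _ _

variable {X : Type} [TopologicalSpace X] {x₀ : X}

theorem OverMap.lift_eq_of_unit {φ : C(Unit, X)} {A : Type} [TopologicalSpace A]
    [PathConnectedSpace A] (s : OverMap φ x₀ {Set.univ} A) (a b : A) :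
    (s.lift a : Path.Homotopic.Quotient (φ ()) x₀) = s.lift b := by
  refine (s.compat a b (PathConnectedSpace.somePath a b)).trans ?_
  have : (PathConnectedSpace.somePath a b).map (φ.comp s.toMap).continuous = Path.refl (φ ()) := by
    ext; rfl
  refine Eq.trans (congrArg (fun p : Path (φ ()) (φ ()) =>
    (Path.Homotopic.Quotient.mk p).trans (s.lift b)) this) ?_
  exact Path.Homotopic.Quotient.refl_trans _

/-- The constant simplex. -/
def constOver (φ : C(Unit, X)) (p : Path.Homotopic.Quotient (φ ()) x₀) (A : Type)
    [TopologicalSpace A] : OverMap φ x₀ {Set.univ} A where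
  toMap := .const A ()
  mem := ⟨_, rfl, fun _ => trivial⟩
  lift _ := p
  compat a b q := by
    refine (Path.Homotopic.Quotient.refl_trans _).symm.trans ?_
    refine congrArg (fun r : Path (φ ()) (φ ()) => (Path.Homotopic.Quotient.mk r).trans p) ?_
    ext; rfl

theorem OverMap.eq_constOver {φ : C(Unit, X)} {A : Type} [TopologicalSpace A]
    [PathConnectedSpace A] (s : OverMap φ x₀ {Set.univ} A) (a : A) :
    s = constOver φ (s.lift a) A :=
  OverMap.ext rfl (heq_of_eq (funext fun b => s.lift_eq_of_unit b a))

instance (n : ℕ) : PathConnectedSpace (Spx n) :=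
  inferInstanceAs (PathConnectedSpace (SimplexCategory.toTop₀.obj ⦋n⦌))

/-- The lift of a simplex over a point. -/
def OverMap.unitLift {φ : C(Unit, X)} {n : ℕ} (s : OverMap φ x₀ {Set.univ} (Spx n)) :
    Path.Homotopic.Quotient (φ ()) x₀ := s.lift (vert n 0)

theorem isFiniteTypeOver_unit (φ : C(Unit, X)) : IsFiniteTypeOver φ x₀ Set.univ := by
  let S := overSSet φ x₀ {Set.univ}
  have hδ : ∀ n (i : Fin (n + 2)) (s : OverMap φ x₀ {Set.univ} (Spx (n + 1))),
      S.δ i s = constOver φ (s.lift (vert _ 0)) (Spx n) := by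
    intro n i s
    refine (OverMap.eq_constOver (show OverMap φ x₀ {Set.univ} (Spx n) from S.δ i s)
      (vert _ 0)).trans ?_
    exact congrArg (fun p => constOver φ p (Spx n)) (s.lift_eq_of_unit _ _)
  have hc : ∀ n (i : Fin (n + 2)) (s : OverMap φ x₀ {Set.univ} (Spx (n + 1))),
      S.δ i s = S.δ 0 s := fun n i s => (hδ n i s).trans (hδ n 0 s).symm
  have hb : ∀ n, Function.Bijective (S.δ (0 : Fin (n + 2))) := by
    intro n
    constructor
    · intro s t hst
      change OverMap φ x₀ {Set.univ} (Spx (n + 1)) at s t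
      have h := (hδ n 0 s).symm.trans (hst.trans (hδ n 0 t))
      have h' : s.lift (vert _ 0) = t.lift (vert _ 0) := congrArg
        (OverMap.unitLift (n := n)) h
      rw [s.eq_constOver (vert _ 0), t.eq_constOver (vert _ 0), h']
    · intro t
      change OverMap φ x₀ {Set.univ} (Spx n) at t
      exact ⟨constOver φ (t.lift (vert _ 0)) (Spx (n + 1)), (hδ n 0 _).trans
        (t.eq_constOver (vert _ 0)).symm⟩
  rcases isEmpty_or_nonempty (Path.Homotopic.Quotient (φ ()) x₀) with he | ⟨⟨p⟩⟩
  · refine hasFiniteFreeType_of_subsingleton fun n => ?_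
    have : IsEmpty (S.obj (op ⦋n⦌)) :=
      ⟨fun s => he.elim (OverMap.lift (show OverMap φ x₀ {Set.univ} (Spx n) from s) (vert _ 0))⟩
    exact (gEquiv (overSet φ x₀ {Set.univ}) n).injective.subsingleton
  · refine hasFiniteFreeType_of_resolution (gen (overSet φ x₀ {Set.univ}) 0
      (constOver φ p (Spx 0))) (smul_gen_bijective _ ⟨?_, ?_⟩) ?_ ?_
    · intro g h hgh
      have h' : p.trans g.toPath = p.trans h.toPath := congrArg
        (OverMap.unitLift (n := 0)) hgh
      have := congrArg (fun q => p.symm.trans q) h'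
      simp only [← Path.Homotopic.Quotient.trans_assoc, Path.Homotopic.Quotient.symm_trans,
        Path.Homotopic.Quotient.refl_trans] at this
      exact this
    · intro s
      change OverMap φ x₀ {Set.univ} (Spx 0) at s
      refine ⟨(p.symm.trans (s.lift (vert _ 0)) :), ?_⟩
      refine Eq.trans ?_ (s.eq_constOver (vert _ 0)).symm
      refine OverMap.ext rfl (heq_of_eq (funext fun a => ?_))
      change p.trans (p.symm.trans (s.lift (vert _ 0))) = s.lift (vert _ 0)
      rw [← Path.Homotopic.Quotient.trans_assoc, Path.Homotopic.Quotient.trans_symm]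
      exact Path.Homotopic.Quotient.refl_trans _
    · intro x
      apply (gEquiv _ 0).injective
      rw [gEquiv_d, map_zero]
      exact (fbdry_of_constant (hc 0) _).trans (if_pos (by simp))
    · intro n z hz
      have hz' : fbdry S n (gEquiv _ (n + 1) z) = 0 := by
        rw [← gEquiv_d, hz, map_zero]
      rw [fbdry_of_constant (hc n)] at hz'
      by_cases hn : Even n
      · refine ⟨(gEquiv _ (n + 2)).symm (Finsupp.mapDomain
          (Function.surjInv (hb (n + 1)).2) (gEquiv _ (n + 1) z)), (gEquiv _ (n + 1)).injective ?_⟩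
        rw [gEquiv_d, AddEquiv.apply_symm_apply]
        refine (fbdry_of_constant (hc (n + 1)) _).trans ?_
        rw [if_neg (by simpa [Nat.even_add_one] using hn), ← Finsupp.mapDomain_comp]
        have : (S.δ (0 : Fin (n + 3))) ∘ Function.surjInv (hb (n + 1)).2 = id :=
          funext (Function.surjInv_eq (hb (n + 1)).2)
        exact (congrArg (fun k => Finsupp.mapDomain k _) this).trans Finsupp.mapDomain_id
      · rw [if_neg hn] at hz'
        have : gEquiv _ (n + 1) z = 0 := Finsupp.mapDomain_injective (hb n).1
          (hz'.trans Finsupp.mapDomain_zero.symm)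
        rw [(gEquiv _ (n + 1)).map_eq_zero_iff.1 this]
        exact ⟨0, map_zero _⟩

end Point

end EndTheory

end

noncomputable section

namespace EndTheory

/-! ### Semilinear sets -/

section Semilinear

variable {V V' : Type} [NormedAddCommGroup V] [NormedSpace ℝ V] [NormedAddCommGroup V']
  [NormedSpace ℝ V']

/-- `U` is determined by the signs of the functionals in `𝓕`. -/
def IsDetermined (𝓕 : Finset (V →ᵃ[ℝ] ℝ)) (U : Set V) : Prop :=
  ∀ x y, (∀ l ∈ 𝓕, SignType.sign (l x) = SignType.sign (l y)) → x ∈ U → y ∈ U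

/-- A set cut out by the signs of finitely many affine functionals. -/
def IsSemilinear (U : Set V) : Prop := ∃ 𝓕, IsDetermined 𝓕 U

theorem IsDetermined.mono {𝓕 𝓖 : Finset (V →ᵃ[ℝ] ℝ)} {U : Set V} (h : IsDetermined 𝓕 U)
    (hsub : 𝓕 ⊆ 𝓖) : IsDetermined 𝓖 U := fun x y hxy => h x y fun l hl => hxy l (hsub hl)

namespace IsSemilinear

theorem compl {U : Set V} (h : IsSemilinear U) : IsSemilinear Uᶜ := by
  obtain ⟨𝓕, h⟩ := h
  exact ⟨𝓕, fun x y hxy hx hy => hx (h y x (fun l hl => (hxy l hl).symm) hy)⟩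

theorem inter {U W : Set V} (h : IsSemilinear U) (h' : IsSemilinear W) : IsSemilinear (U ∩ W) := by
  classical
  obtain ⟨𝓕, h⟩ := h
  obtain ⟨𝓖, h'⟩ := h'
  exact ⟨𝓕 ∪ 𝓖, fun x y hxy hx => ⟨h.mono Finset.subset_union_left x y hxy hx.1,
    h'.mono Finset.subset_union_right x y hxy hx.2⟩⟩

theorem union {U W : Set V} (h : IsSemilinear U) (h' : IsSemilinear W) : IsSemilinear (U ∪ W) := by
  have := (h.compl.inter h'.compl).compl
  rwa [Set.compl_inter, compl_compl, compl_compl] at this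

theorem diff {U W : Set V} (h : IsSemilinear U) (h' : IsSemilinear W) : IsSemilinear (U \ W) :=
  h.inter h'.compl

theorem empty : IsSemilinear (∅ : Set V) := ⟨∅, fun _ _ _ h => h⟩

theorem biUnion {ι : Type*} (s : Finset ι) (U : ι → Set V) (h : ∀ i ∈ s, IsSemilinear (U i)) :
    IsSemilinear (⋃ i ∈ s, U i) := by
  classical
  induction s using Finset.induction_on with
  | empty => simpa using empty
  | insert a s ha ih =>
    rw [Finset.set_biUnion_insert]
    exact (h a (by simp)).union (ih fun i hi => h i (by simp [hi]))

theorem biInter {ι : Type*} (s : Finset ι) (U : ι → Set V) (h : ∀ i ∈ s, IsSemilinear (U i)) :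
    IsSemilinear (⋂ i ∈ s, U i) := by
  have := (biUnion s (fun i => (U i)ᶜ) fun i hi => (h i hi).compl).compl
  simpa [Set.compl_iUnion] using this

theorem preimage {U : Set V'} (h : IsSemilinear U) (g : V →ᵃ[ℝ] V') : IsSemilinear (g ⁻¹' U) := by
  classical
  obtain ⟨𝓕, h⟩ := h
  exact ⟨𝓕.image fun l => l.comp g, fun x y hxy hx => h (g x) (g y)
    (fun l hl => hxy _ (Finset.mem_image_of_mem _ hl)) hx⟩

theorem pos (l : V →ᵃ[ℝ] ℝ) : IsSemilinear {x | 0 < l x} := by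
  refine ⟨{l}, fun x y hxy hx => ?_⟩
  have := hxy l (by simp)
  rw [Set.mem_ofPred_eq] at hx ⊢
  rwa [← sign_eq_one_iff, ← this, sign_eq_one_iff]

theorem nonneg (l : V →ᵃ[ℝ] ℝ) : IsSemilinear {x | 0 ≤ l x} := by
  have := (pos (-l)).compl
  have e : {x | 0 < (-l) x}ᶜ = {x | 0 ≤ l x} := by ext x; simp
  rwa [e] at this

theorem eq_zero (l : V →ᵃ[ℝ] ℝ) : IsSemilinear {x | l x = 0} := by
  have := (nonneg l).inter (nonneg (-l))
  have e : {x | 0 ≤ l x} ∩ {x | 0 ≤ (-l) x} = {x | l x = 0} := by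
    ext x
    simp only [Set.mem_inter_iff, Set.mem_ofPred_eq, AffineMap.coe_neg, Pi.neg_apply, neg_nonneg]
    exact ⟨fun h => le_antisymm h.2 h.1, fun h => ⟨h.ge, h.le⟩⟩
  rwa [e] at this

variable [FiniteDimensional ℝ V]

theorem convexHull_of_affineIndependent (t : Finset V)
    (ht : AffineIndependent ℝ ((↑) : t → V)) : IsSemilinear (convexHull ℝ (t : Set V)) := by
  classical
  obtain ⟨T, htT, hT, htop⟩ := exists_subset_affineIndependent_affineSpan_eq_top (s := (t : Set V)) ht
  let b : AffineBasis T ℝ V := ⟨(↑), hT, by rw [Subtype.range_coe, htop]⟩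
  have : Finite T := b.finite
  have := Fintype.ofFinite T
  have hb : ∀ i : T, b i = i := fun i => rfl
  have e : convexHull ℝ (t : Set V) = (⋂ i ∈ (Finset.univ : Finset T), {x | 0 ≤ b.coord i x}) ∩
      ⋂ i ∈ Finset.univ.filter (fun i : T => (i : V) ∉ t), {x | b.coord i x = 0} := by
    apply Set.Subset.antisymm
    · refine convexHull_min ?_ ?_
      · intro x hx
        simp only [Finset.mem_univ, Set.iInter_true, Finset.mem_filter, true_and, Set.mem_inter_iff,
          Set.mem_iInter, Set.mem_ofPred_eq]
        have hx' : x = b ⟨x, htT hx⟩ := rfl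
        constructor
        · intro i
          rw [hx', b.coord_apply]
          split_ifs <;> simp
        · intro i hi
          rw [hx', b.coord_apply_ne]
          rintro rfl
          exact hi hx
      · refine Convex.inter (convex_iInter fun i => convex_iInter fun _ => ?_)
          (convex_iInter fun i => convex_iInter fun _ => ?_)
        · exact (convex_Ici (0 : ℝ)).affine_preimage (b.coord i)
        · exact (convex_singleton (0 : ℝ)).affine_preimage (b.coord i)
    · intro x hx
      simp only [Finset.mem_univ, Set.iInter_true, Finset.mem_filter, true_and, Set.mem_inter_iff,
          Set.mem_iInter, Set.mem_ofPred_eq] at hx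
      obtain ⟨h₁, h₂⟩ := hx
      have hs := b.sum_coord_apply_eq_one x
      have hx := b.linear_combination_coord_eq_self x
      rw [← Finset.sum_filter_of_ne (p := fun i : T => (i : V) ∈ t)] at hs hx
      · rw [← hx]
        exact (convex_convexHull ℝ _).sum_mem (fun i _ => h₁ i) hs fun i hi =>
          subset_convexHull ℝ _ (Finset.mem_filter.1 hi).2
      · intro i _ hne
        by_contra hi
        exact hne (by rw [h₂ i hi, zero_smul])
      · intro i _ hne
        by_contra hi
        exact hne (h₂ i hi)
  rw [e]
  exact (biInter _ _ fun i _ => nonneg _).inter (biInter _ _ fun i _ => eq_zero _)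

theorem convexHull_finset (s : Finset V) : IsSemilinear (convexHull ℝ (s : Set V)) := by
  classical
  have e : convexHull ℝ (s : Set V) = ⋃ t ∈ s.powerset.filter
      (fun t : Finset V => AffineIndependent ℝ ((↑) : t → V)), convexHull ℝ (t : Set V) := by
    rw [convexHull_eq_union]
    ext x
    simp only [Set.mem_iUnion, Finset.mem_filter, Finset.mem_powerset, Finset.coe_subset, exists_prop,
      and_assoc]
  rw [e]
  exact biUnion _ _ fun t ht => convexHull_of_affineIndependent t (Finset.mem_filter.1 ht).2

end IsSemilinear

theorem IsCompactPolyhedron.isSemilinear [FiniteDimensional ℝ V] {K : Set V}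
    (h : IsCompactPolyhedron K) : IsSemilinear K := by
  obtain ⟨𝒮, rfl⟩ := h
  exact IsSemilinear.biUnion _ _ fun S _ => IsSemilinear.convexHull_finset S

theorem IsCompactPolyhedron.isCompact {K : Set V} (h : IsCompactPolyhedron K) : IsCompact K := by
  obtain ⟨𝒮, rfl⟩ := h
  exact 𝒮.isCompact_biUnion fun S _ => S.finite_toSet.isCompact_convexHull ℝ

theorem IsCompactPolyhedron.union {K L : Set V} (h : IsCompactPolyhedron K)
    (h' : IsCompactPolyhedron L) : IsCompactPolyhedron (K ∪ L) := by
  classical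
  obtain ⟨𝒮, rfl⟩ := h
  obtain ⟨𝒯, rfl⟩ := h'
  exact ⟨𝒮 ∪ 𝒯, by rw [Finset.set_biUnion_union]⟩

theorem isCompactPolyhedron_empty : IsCompactPolyhedron (∅ : Set V) := ⟨∅, by simp⟩

theorem IsCompactPolyhedron.biUnion {ι : Type*} (s : Finset ι) (K : ι → Set V)
    (h : ∀ i ∈ s, IsCompactPolyhedron (K i)) : IsCompactPolyhedron (⋃ i ∈ s, K i) := by
  classical
  induction s using Finset.induction_on with
  | empty => simpa using isCompactPolyhedron_empty
  | insert a s ha ih =>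
    rw [Finset.set_biUnion_insert]
    exact (h a (by simp)).union (ih fun i hi => h i (by simp [hi]))

/-! #### Faces -/

section Faces

variable (𝓕 : Finset (V →ᵃ[ℝ] ℝ))

/-- The sign vector of a point. -/
def signVec (x : V) (l : 𝓕) : SignType := SignType.sign (l.1 x)

variable {𝓕}

theorem IsDetermined.mem_of_signVec_eq {U : Set V} (h : IsDetermined 𝓕 U) {x y : V}
    (e : signVec 𝓕 x = signVec 𝓕 y) (hx : x ∈ U) : y ∈ U :=
  h x y (fun l hl => congrFun e ⟨l, hl⟩) hx

theorem sign_combination {a b t : ℝ} (ht : 0 < t) (ht' : t ≤ 1)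
    (h : SignType.sign a = 0 ∨ SignType.sign a = SignType.sign b) :
    SignType.sign ((1 - t) * a + t * b) = SignType.sign b := by
  have h1 : 0 ≤ 1 - t := by linarith
  rcases h with h | h
  · rw [sign_eq_zero_iff] at h
    rw [h, mul_zero, zero_add, sign_mul, sign_pos ht, one_mul]
  · rcases lt_trichotomy b 0 with hb | hb | hb
    · rw [sign_neg hb, sign_eq_neg_one_iff] at h
      rw [sign_neg hb, sign_eq_neg_one_iff]
      nlinarith
    · rw [hb, sign_zero, sign_eq_zero_iff] at h
      rw [h, hb]
      simp
    · rw [sign_pos hb, sign_eq_one_iff] at h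
      rw [sign_pos hb, sign_eq_one_iff]
      nlinarith

theorem affine_combination (l : V →ᵃ[ℝ] ℝ) (x y : V) (t : ℝ) :
    l ((1 - t) • x + t • y) = (1 - t) * l x + t * l y := by
  have := Convex.combo_affine_apply (f := l) (x := x) (y := y) (a := 1 - t) (b := t) (by ring)
  simpa using this

/-- Points in the interior of a segment ending in a lower face have the sign vector of the other
end point. -/
theorem signVec_combination {x y : V} {t : ℝ} (ht : 0 < t) (ht' : t ≤ 1)
    (h : ∀ l, signVec 𝓕 x l = 0 ∨ signVec 𝓕 x l = signVec 𝓕 y l) :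
    signVec 𝓕 ((1 - t) • x + t • y) = signVec 𝓕 y := by
  funext l
  rw [signVec, affine_combination]
  exact sign_combination ht ht' (h l)

theorem tendsto_combination (x y : V) :
    Filter.Tendsto (fun t : ℝ => (1 - t) • x + t • y) (𝓝[>] 0) (𝓝 x) := by
  have : Continuous fun t : ℝ => (1 - t) • x + t • y := by fun_prop
  have h := this.tendsto 0
  simp only [sub_zero, one_smul, zero_smul, add_zero] at h
  exact h.mono_left nhdsWithin_le_nhds

/-- The closed face of a sign vector. -/
def closedFace (𝓕 : Finset (V →ᵃ[ℝ] ℝ)) (s : 𝓕 → SignType) : Set V :=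
  {x | ∀ l, signVec 𝓕 x l = 0 ∨ signVec 𝓕 x l = s l}

theorem closedFace_eq (s : 𝓕 → SignType) : closedFace 𝓕 s =
    ⋂ l : 𝓕, l.1 ⁻¹' (if s l = 0 then {0} else if s l = 1 then Set.Ici 0 else Set.Iic 0) := by
  ext x
  simp only [closedFace, Set.mem_ofPred_eq, Set.mem_iInter, Set.mem_preimage, signVec]
  refine forall_congr' fun l => ?_
  have h : s l = 0 ∨ s l = 1 ∨ s l = -1 := by cases s l <;> decide
  rcases h with h | h | h <;> rw [h, sign_eq_zero_iff]
  · simp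
  · rw [if_neg (by decide), if_pos rfl, sign_eq_one_iff, Set.mem_Ici, le_iff_eq_or_lt, eq_comm]
  · rw [if_neg (by decide), if_neg (by decide), sign_eq_neg_one_iff, Set.mem_Iic, le_iff_eq_or_lt]

theorem convex_closedFace (s : 𝓕 → SignType) : Convex ℝ (closedFace 𝓕 s) := by
  rw [closedFace_eq]
  refine convex_iInter fun l => Convex.affine_preimage l.1 ?_
  split_ifs
  · exact convex_singleton _
  · exact convex_Ici _
  · exact convex_Iic _

/-- A compact convex set determined by signs is a polytope. -/
theorem exists_convexHull_eq {U : Set V} (h : IsDetermined 𝓕 U) (hc : IsCompact U)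
    (hconv : Convex ℝ U) : ∃ S : Finset V, U = convexHull ℝ (S : Set V) := by
  have hinj : Set.InjOn (signVec 𝓕) (U.extremePoints ℝ) := by
    intro x hx y hy hxy
    by_contra hne
    have hev : ∀ᶠ ε in 𝓝[>] (0 : ℝ), x + ε • (x - y) ∈ U := by
      have : ∀ l : 𝓕, ∀ᶠ ε in 𝓝[>] (0 : ℝ), signVec 𝓕 (x + ε • (x - y)) l = signVec 𝓕 x l := by
        intro l
        have hl : ∀ ε : ℝ, l.1 (x + ε • (x - y)) = l.1 x + ε * (l.1 x - l.1 y) := by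
          intro ε
          have := affine_combination l.1 x y (-ε)
          have e : x + ε • (x - y) = (1 - -ε) • x + (-ε) • y := by module
          rw [e, this]; ring
        have hlim : Filter.Tendsto (fun ε : ℝ => l.1 x + ε * (l.1 x - l.1 y)) (𝓝[>] 0)
            (𝓝 (l.1 x)) := by
          have : Continuous fun ε : ℝ => l.1 x + ε * (l.1 x - l.1 y) := by fun_prop
          have h := this.tendsto 0
          simp only [zero_mul, add_zero] at h
          exact h.mono_left nhdsWithin_le_nhds
        have hs := congrFun hxy l
        rcases lt_trichotomy (l.1 x) 0 with h0 | h0 | h0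
        · filter_upwards [hlim.eventually_lt_const h0] with ε hε
          rw [signVec, signVec, hl, sign_neg hε, sign_neg h0]
        · have hy0 : l.1 y = 0 := by
            simp only [signVec, h0, sign_zero] at hs
            exact sign_eq_zero_iff.1 hs.symm
          refine Filter.Eventually.of_forall fun ε => ?_
          rw [signVec, signVec, hl, h0, hy0]; simp
        · filter_upwards [hlim.eventually_const_lt h0] with ε hε
          rw [signVec, signVec, hl, sign_pos hε, sign_pos h0]
      filter_upwards [Filter.eventually_all.2 this] with ε hε
      exact h.mem_of_signVec_eq (funext fun l => (hε l).symm) hx.1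
    obtain ⟨ε, hε, hε0⟩ := (hev.and self_mem_nhdsWithin).exists
    have hmem : x ∈ openSegment ℝ (x + ε • (x - y)) y := by
      refine ⟨1 / (1 + ε), ε / (1 + ε), by positivity, by positivity, by field_simp, ?_⟩
      rw [← smul_right_inj (show (1 + ε : ℝ) ≠ 0 by positivity), smul_add, smul_smul, smul_smul,
        mul_div_cancel₀ _ (by positivity), mul_div_cancel₀ _ (by positivity)]
      module
    have := (mem_extremePoints.1 hx).2 _ hε _ hy.1 hmem
    exact hne this.2.symm
  have hfin : (U.extremePoints ℝ).Finite := Set.Finite.of_injOn (Set.mapsTo_univ _ _) hinj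
    Set.finite_univ
  refine ⟨hfin.toFinset, ?_⟩
  rw [Set.Finite.coe_toFinset]
  conv_lhs => rw [← closure_convexHull_extremePoints hc hconv]
  exact (hfin.isCompact_convexHull ℝ).isClosed.closure_eq

variable [FiniteDimensional ℝ V]

theorem affine_continuous (l : V →ᵃ[ℝ] ℝ) : Continuous l := l.continuous_of_finiteDimensional

theorem isClosed_closedFace (s : 𝓕 → SignType) : IsClosed (closedFace 𝓕 s) := by
  rw [closedFace_eq]
  refine isClosed_iInter fun l => IsClosed.preimage (affine_continuous l.1) ?_
  split_ifs
  · exact isClosed_singleton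
  · exact isClosed_Ici
  · exact isClosed_Iic

/-- Compact semilinear sets are compact polyhedra. -/
theorem IsSemilinear.isCompactPolyhedron {U : Set V} (h : IsSemilinear U) (hc : IsCompact U) :
    IsCompactPolyhedron U := by
  classical
  obtain ⟨𝓕, h⟩ := h
  have hsub : ∀ x ∈ U, closedFace 𝓕 (signVec 𝓕 x) ⊆ U := by
    intro x hx y hy
    refine hc.isClosed.mem_of_tendsto (tendsto_combination y x) ?_
    filter_upwards [Ioc_mem_nhdsGT (zero_lt_one' ℝ)] with t ht
    exact h.mem_of_signVec_eq (signVec_combination ht.1 ht.2 hy).symm hx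
  have hU : U = ⋃ s ∈ Finset.univ.filter fun s => ∃ x ∈ U, signVec 𝓕 x = s, closedFace 𝓕 s := by
    apply Set.Subset.antisymm
    · intro x hx
      simp only [Finset.mem_filter, Finset.mem_univ, true_and, Set.mem_iUnion]
      exact ⟨signVec 𝓕 x, ⟨x, hx, rfl⟩, fun l => .inr rfl⟩
    · refine Set.iUnion₂_subset fun s hs => ?_
      obtain ⟨x, hx, rfl⟩ := (Finset.mem_filter.1 hs).2
      exact hsub x hx
  rw [hU]
  refine IsCompactPolyhedron.biUnion _ _ fun s hs => ?_
  obtain ⟨x, hx, rfl⟩ := (Finset.mem_filter.1 hs).2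
  obtain ⟨S, hS⟩ := exists_convexHull_eq (𝓕 := 𝓕) (U := closedFace 𝓕 (signVec 𝓕 x))
    (fun y z hyz hy l => by
      have := hyz l.1 l.2
      simp only [signVec] at this ⊢
      rw [← this]; exact hy l) (hc.of_isClosed_subset (isClosed_closedFace _) (hsub x hx)) (convex_closedFace _)
  exact ⟨{S}, by simp [hS]⟩

end Faces

end Semilinear

end EndTheory

end

noncomputable section

namespace EndTheory

section SemilinearFinite

variable {V : Type} [NormedAddCommGroup V] [NormedSpace ℝ V]
  {X : Type} [TopologicalSpace X] {x₀ : X}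

theorem IsFiniteTypeOver.of_subset {Z : Type} [TopologicalSpace Z] {U Y : Set Z} (h : U ⊆ Y)
    {φ : C(Y, X)}
    (hU : IsFiniteTypeOver (φ.comp ⟨Set.inclusion h, continuous_inclusion h⟩) x₀ Set.univ) :
    IsFiniteTypeOver φ x₀ (Subtype.val ⁻¹' U) := by
  have hr : Set.range (⟨Set.inclusion h, continuous_inclusion h⟩ : C(U, Y)) =
      (Subtype.val ⁻¹' U : Set Y) := Set.range_inclusion h
  rw [← hr]
  have := quasiIso_overSetMap_of_embedding (φ := φ) (x₀ := x₀)
    (⟨Set.inclusion h, continuous_inclusion h⟩ : C(U, Y)) (IsEmbedding.inclusion h)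
    (fun U hU => ⟨_, rfl, fun a _ => ⟨a, rfl⟩⟩)
  exact HasFiniteFreeType.of_quasiIso hU _ this

theorem IsFiniteTypeOver.of_subset_of_contractible {Z : Type} [TopologicalSpace Z] {U Y : Set Z}
    (h : U ⊆ Y) [ContractibleSpace U] (φ : C(Y, X)) :
    IsFiniteTypeOver φ x₀ (Subtype.val ⁻¹' U) :=
  .of_subset h (.of_homotopyEquiv (ContractibleSpace.hequiv Unit U).some _
    (isFiniteTypeOver_unit _))

open scoped Classical in
/-- The sign vectors of the points of `U`. -/
def signs (𝓕 : Finset (V →ᵃ[ℝ] ℝ)) (U : Set V) : Finset (𝓕 → SignType) :=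
  Finset.univ.filter fun s => ∃ x ∈ U, signVec 𝓕 x = s

variable {𝓕 : Finset (V →ᵃ[ℝ] ℝ)}

theorem mem_signs {U : Set V} {s : 𝓕 → SignType} : s ∈ signs 𝓕 U ↔ ∃ x ∈ U, signVec 𝓕 x = s := by
  simp [signs]

/-- The number of hyperplanes containing a face. -/
def zeros (s : 𝓕 → SignType) : ℕ := (Finset.univ.filter fun l => s l = 0).card

/-- The open star of a face. -/
def openStar (𝓕 : Finset (V →ᵃ[ℝ] ℝ)) (s : 𝓕 → SignType) : Set V :=
  {x | ∀ l, s l ≠ 0 → signVec 𝓕 x l = s l}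

theorem isDetermined_openStar (s : 𝓕 → SignType) : IsDetermined 𝓕 (openStar 𝓕 s) :=
  fun _ _ hxy hx l hl => (hxy l.1 l.2).symm.trans (hx l hl)

theorem isDetermined_face (s : 𝓕 → SignType) : IsDetermined 𝓕 {x | signVec 𝓕 x = s} :=
  fun x y hxy hx => (funext fun l => (hxy l.1 l.2).symm : signVec 𝓕 y = signVec 𝓕 x).trans hx

theorem IsDetermined.inter {U W : Set V} (h : IsDetermined 𝓕 U) (h' : IsDetermined 𝓕 W) :
    IsDetermined 𝓕 (U ∩ W) := fun x y hxy hx => ⟨h x y hxy hx.1, h' x y hxy hx.2⟩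

theorem IsDetermined.diff {U W : Set V} (h : IsDetermined 𝓕 U) (h' : IsDetermined 𝓕 W) :
    IsDetermined 𝓕 (U \ W) := fun x y hxy hx =>
  ⟨h x y hxy hx.1, fun hy => hx.2 (h' y x (fun l hl => (hxy l hl).symm) hy)⟩

theorem signs_mono {U W : Set V} (h : U ⊆ W) : signs 𝓕 U ⊆ signs 𝓕 W := fun s hs => by
  obtain ⟨x, hx, e⟩ := mem_signs.1 hs
  exact mem_signs.2 ⟨x, h hx, e⟩

theorem inter_closedFace_eq {U : Set V} {s : 𝓕 → SignType}
    (hmax : ∀ t ∈ signs 𝓕 U, zeros t ≤ zeros s) :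
    U ∩ closedFace 𝓕 s = U ∩ {x | signVec 𝓕 x = s} := by
  ext x
  refine and_congr_right fun hx => ⟨fun h => ?_, fun h l => .inr (congrFun h l)⟩
  have hsub : (Finset.univ.filter fun l => s l = 0) ⊆
      Finset.univ.filter fun l => signVec 𝓕 x l = 0 := fun l hl => by
    simp only [Finset.mem_filter, Finset.mem_univ, true_and] at hl ⊢
    rcases h l with h | h
    · exact h
    · rw [h, hl]
  have he := Finset.eq_of_subset_of_card_le hsub (hmax _ (mem_signs.2 ⟨x, hx, rfl⟩))
  funext l
  rcases h l with h | h
  · have : l ∈ Finset.univ.filter fun l => signVec 𝓕 x l = 0 := by simp [h]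
    rw [← he] at this
    rw [h, (Finset.mem_filter.1 this).2]
  · exact h

theorem starConvex_openStar {U : Set V} (h : IsDetermined 𝓕 U) {p : V} (hp : p ∈ U) :
    StarConvex ℝ p (U ∩ openStar 𝓕 (signVec 𝓕 p)) := by
  intro y hy a b ha hb hab
  obtain rfl : a = 1 - b := by linarith
  rcases hb.eq_or_lt with rfl | hb
  · simpa using ⟨hp, fun l _ => rfl⟩
  · refine (h.inter (isDetermined_openStar _)).mem_of_signVec_eq
      (signVec_combination hb (by linarith) fun l => ?_).symm hy
    by_cases hl : signVec 𝓕 p l = 0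
    · exact .inl hl
    · exact .inr (hy.2 l hl).symm

variable [FiniteDimensional ℝ V]

theorem isOpen_openStar (s : 𝓕 → SignType) : IsOpen (openStar 𝓕 s) := by
  have e : openStar 𝓕 s = ⋂ l : 𝓕, {x | s l ≠ 0 → signVec 𝓕 x l = s l} := by
    ext x; simp [openStar]
  rw [e]
  refine isOpen_iInter_of_finite fun l => ?_
  have h : s l = 0 ∨ s l = 1 ∨ s l = -1 := by cases s l <;> decide
  rcases h with h | h | h
  · simp [h]
  · have : {x | s l ≠ 0 → signVec 𝓕 x l = s l} = l.1 ⁻¹' Set.Ioi 0 := by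
      ext x; simp [h, signVec, sign_eq_one_iff]
    rw [this]
    exact isOpen_Ioi.preimage (affine_continuous l.1)
  · have : {x | s l ≠ 0 → signVec 𝓕 x l = s l} = l.1 ⁻¹' Set.Iio 0 := by
      ext x; simp [h, signVec, sign_eq_neg_one_iff]
    rw [this]
    exact isOpen_Iio.preimage (affine_continuous l.1)

theorem IsDetermined.isFiniteTypeOver {Y : Set V} (φ : C(Y, X)) (U : Set V)
    (h : IsDetermined 𝓕 U) (hUY : U ⊆ Y) : IsFiniteTypeOver φ x₀ (Subtype.val ⁻¹' U) := by
  induction hn : (signs 𝓕 U).card using Nat.strong_induction_on generalizing U with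
  | _ n ih =>
    subst hn
    rcases U.eq_empty_or_nonempty with rfl | ⟨p₀, hp₀⟩
    · exact isFiniteTypeOver_empty
    obtain ⟨s, hs, hmax⟩ := (signs 𝓕 U).exists_max_image zeros ⟨_, mem_signs.2 ⟨p₀, hp₀, rfl⟩⟩
    have hface := inter_closedFace_eq hmax
    obtain ⟨p, hp, rfl⟩ := mem_signs.1 hs
    set S := U ∩ openStar 𝓕 (signVec 𝓕 p) with hS
    set D := U \ {x | signVec 𝓕 x = signVec 𝓕 p} with hD
    have hSd : IsDetermined 𝓕 S := h.inter (isDetermined_openStar _)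
    have hDd : IsDetermined 𝓕 D := h.diff (isDetermined_face _)
    have hlt : (signs 𝓕 D).card < (signs 𝓕 U).card := by
      refine Finset.card_lt_card (Finset.ssubset_iff_subset_ne.2 ⟨signs_mono Set.sdiff_subset, ?_⟩)
      intro e
      rw [← e] at hs
      obtain ⟨x, hx, hxp⟩ := mem_signs.1 hs
      exact hx.2 hxp
    have hDU : D ∪ S = U := by
      apply Set.Subset.antisymm (Set.union_subset Set.sdiff_subset Set.inter_subset_left)
      intro x hx
      by_cases e : signVec 𝓕 x = signVec 𝓕 p
      · exact .inr ⟨hx, fun l _ => congrFun e l⟩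
      · exact .inl ⟨hx, e⟩
    have : ContractibleSpace S := (starConvex_openStar h hp).contractibleSpace
      ⟨p, hp, fun l _ => rfl⟩
    have hDS : Subtype.val ⁻¹' D ∪ Subtype.val ⁻¹' S = (Subtype.val ⁻¹' U : Set Y) := by
      rw [← Set.preimage_union, hDU]
    rw [← hDS]
    refine IsFiniteTypeOver.union
      (O := Subtype.val ⁻¹' (closedFace 𝓕 (signVec 𝓕 p))ᶜ)
      (P := Subtype.val ⁻¹' openStar 𝓕 (signVec 𝓕 p))
      ((isClosed_closedFace _).isOpen_compl.preimage continuous_subtype_val)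
      ((isOpen_openStar _).preimage continuous_subtype_val) ?_ ?_ ?_ ?_ ?_
    · rw [hDS, ← Set.preimage_inter, ← Set.sdiff_eq, ← Set.sdiff_self_inter, hface,
        Set.sdiff_self_inter]
    · rw [hDS, ← Set.preimage_inter]
    · exact ih _ hlt D hDd (Set.sdiff_subset.trans hUY) rfl
    · exact .of_subset_of_contractible (Set.inter_subset_left.trans hUY) φ
    · rw [← Set.preimage_inter]
      exact ih _ ((Finset.card_le_card (signs_mono Set.inter_subset_left)).trans_lt hlt) (D ∩ S)
        (hDd.inter hSd) (Set.inter_subset_left.trans (Set.sdiff_subset.trans hUY)) rfl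

/-- Semilinear subsets have finite type. -/
theorem IsSemilinear.isFiniteTypeOver {U : Set V} (h : IsSemilinear U) {Y : Set V} (hUY : U ⊆ Y)
    (φ : C(Y, X)) : IsFiniteTypeOver φ x₀ (Subtype.val ⁻¹' U) :=
  h.choose_spec.isFiniteTypeOver φ U hUY

end SemilinearFinite

end EndTheory

end

noncomputable section

namespace EndTheory

/-! ### Neighborhoods of compact sets in polyhedra -/

section PolyhedralNeighborhoods

variable {V : Type} [NormedAddCommGroup V] [NormedSpace ℝ V]

theorem isSemilinear_Ici (a : ℝ) : IsSemilinear (Set.Ici a) := by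
  have := IsSemilinear.nonneg (AffineMap.id ℝ ℝ - AffineMap.const ℝ ℝ a)
  have e : {x | 0 ≤ (AffineMap.id ℝ ℝ - AffineMap.const ℝ ℝ a) x} = Set.Ici a := by
    ext x; simp
  rwa [e] at this

theorem isSemilinear_Iic (a : ℝ) : IsSemilinear (Set.Iic a) := by
  have := IsSemilinear.nonneg (AffineMap.const ℝ ℝ a - AffineMap.id ℝ ℝ)
  have e : {x | 0 ≤ (AffineMap.const ℝ ℝ a - AffineMap.id ℝ ℝ) x} = Set.Iic a := by
    ext x; simp
  rwa [e] at this

theorem isSemilinear_Icc (a b : ℝ) : IsSemilinear (Set.Icc a b) :=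
  (isSemilinear_Ici a).inter (isSemilinear_Iic b)

theorem isSemilinear_Iio (a : ℝ) : IsSemilinear (Set.Iio a) := by
  have := (isSemilinear_Ici a).compl
  rwa [Set.compl_Ici] at this

theorem isSemilinear_Ioo (a b : ℝ) : IsSemilinear (Set.Ioo a b) := by
  have := (isSemilinear_Iic a).compl.inter (isSemilinear_Iio b)
  rwa [Set.compl_Iic] at this

theorem IsSemilinear.prod {U : Set V} {J : Set ℝ} (hU : IsSemilinear U) (hJ : IsSemilinear J) :
    IsSemilinear (U ×ˢ J) :=
  (hU.preimage (LinearMap.fst ℝ V ℝ).toAffineMap).inter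
    (hJ.preimage (LinearMap.snd ℝ V ℝ).toAffineMap)

variable [FiniteDimensional ℝ V]

theorem IsCompactPolyhedron.prod {K : Set V} {J : Set ℝ} (hK : IsCompactPolyhedron K)
    (hJ : IsSemilinear J) (hJc : IsCompact J) : IsCompactPolyhedron (K ×ˢ J) :=
  (hK.isSemilinear.prod hJ).isCompactPolyhedron (hK.isCompact.prod hJc)

theorem exists_isOpen_isSemilinear {O : Set V} {z : V} (hO : O ∈ 𝓝 z) :
    ∃ Q, IsOpen Q ∧ IsSemilinear Q ∧ z ∈ Q ∧ Q ⊆ O := by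
  let e := (Module.finBasis ℝ V).equivFunL
  have h : e.symm ⁻¹' O ∈ 𝓝 (e z) := e.symm.continuous.continuousAt (by simpa using hO)
  obtain ⟨ε, hε, hball⟩ := Metric.mem_nhds_iff.1 h
  have hQ : e ⁻¹' Metric.ball (e z) ε =
      ⋂ i ∈ (Finset.univ : Finset (Fin (Module.finrank ℝ V))),
        ((LinearMap.proj i).comp e.toLinearEquiv.toLinearMap).toAffineMap ⁻¹'
          Set.Ioo (e z i - ε) (e z i + ε) := by
    ext x
    simp [ball_pi _ hε, Real.ball_eq_Ioo]
  refine ⟨e ⁻¹' Metric.ball (e z) ε, Metric.isOpen_ball.preimage e.continuous, ?_,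
    Metric.mem_ball_self hε, fun x hx => by simpa using hball hx⟩
  rw [hQ]
  exact IsSemilinear.biInter _ _ fun i _ => (isSemilinear_Ioo _ _).preimage _

/-- A compact subset of a polyhedron has an open semilinear neighborhood meeting the polyhedron
inside a compact polyhedron. -/
theorem IsPolyhedron.exists_semilinear_nhd {Y C : Set V} (hY : IsPolyhedron Y) (hC : IsCompact C)
    (hCY : C ⊆ Y) : ∃ G D : Set V, IsOpen G ∧ IsSemilinear G ∧ IsCompactPolyhedron D ∧ C ⊆ G ∧
      Y ∩ G ⊆ D ∧ D ⊆ Y := by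
  have h : ∀ z : V, ∃ Q K : Set V, z ∈ C → IsOpen Q ∧ IsSemilinear Q ∧ z ∈ Q ∧
      IsCompactPolyhedron K ∧ Q ∩ Y ⊆ K ∧ K ⊆ Y := by
    intro z
    by_cases hz : z ∈ C
    · obtain ⟨K, hK, hKY, hn⟩ := hY z (hCY hz)
      obtain ⟨O, hO, hzO, hOK⟩ := mem_nhdsWithin.1 hn
      obtain ⟨Q, hQ, hQs, hzQ, hQO⟩ := exists_isOpen_isSemilinear (hO.mem_nhds hzO)
      exact ⟨Q, K, fun _ => ⟨hQ, hQs, hzQ, hK, fun x hx => hOK ⟨hQO hx.1, hx.2⟩, hKY⟩⟩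
    · exact ⟨∅, ∅, fun h => absurd h hz⟩
  choose Q K h using h
  obtain ⟨t, ht, hCt⟩ := hC.elim_nhds_subcover Q fun z hz => (h z hz).1.mem_nhds (h z hz).2.2.1
  refine ⟨⋃ z ∈ t, Q z, ⋃ z ∈ t, K z, isOpen_biUnion fun z hz => (h z (ht z hz)).1,
    IsSemilinear.biUnion _ _ fun z hz => (h z (ht z hz)).2.1,
    IsCompactPolyhedron.biUnion _ _ fun z hz => (h z (ht z hz)).2.2.2.1, hCt, ?_,
    Set.iUnion₂_subset fun z hz => (h z (ht z hz)).2.2.2.2.2⟩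
  rintro x ⟨hxY, hx⟩
  obtain ⟨z, hz, hxz⟩ := Set.mem_iUnion₂.1 hx
  exact Set.mem_iUnion₂.2 ⟨z, hz, (h z (ht z hz)).2.2.2.2.1 ⟨hxz, hxY⟩⟩

theorem IsPolyhedron.sdiff {Y G : Set V} (hY : IsPolyhedron Y) (hG : IsOpen G)
    (hGs : IsSemilinear G) : IsPolyhedron (Y \ G) := by
  rintro x ⟨hx, hxG⟩
  obtain ⟨K, hK, hKY, hn⟩ := hY x hx
  refine ⟨K \ G, (hK.isSemilinear.diff hGs).isCompactPolyhedron (hK.isCompact.diff hG),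
    Set.sdiff_subset_sdiff_left hKY, ?_⟩
  exact Filter.inter_mem (nhdsWithin_mono x Set.sdiff_subset hn)
    (Filter.mem_of_superset self_mem_nhdsWithin fun y hy => hy.2)

theorem IsPolyhedron.prod_Ico {W : Set V} (hW : IsPolyhedron W) :
    IsPolyhedron (W ×ˢ Set.Ico (0 : ℝ) 1) := by
  rintro ⟨x, t⟩ ⟨hx, ht0, ht1⟩
  obtain ⟨K, hK, hKW, hn⟩ := hW x hx
  obtain ⟨b, htb, hb⟩ := exists_between ht1
  refine ⟨K ×ˢ Set.Icc 0 b, hK.prod (isSemilinear_Icc 0 b) isCompact_Icc,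
    Set.prod_mono hKW fun u hu => ⟨hu.1, hu.2.trans_lt hb⟩, nhdsWithin_prod hn ?_⟩
  filter_upwards [self_mem_nhdsWithin, mem_nhdsWithin_of_mem_nhds (Iio_mem_nhds htb)] with u hu hu'
  exact ⟨hu.1, le_of_lt hu'⟩

/-- Compact subsets of `W × [0, 1)` lie in boxes. -/
theorem IsPolyhedron.exists_box {W : Set V} (hW : IsPolyhedron W) {C : Set (V × ℝ)}
    (hC : IsCompact C) (hCW : C ⊆ W ×ˢ Set.Ico (0 : ℝ) 1) :
    ∃ (G D : Set V) (s : ℝ), IsOpen G ∧ IsSemilinear G ∧ IsCompactPolyhedron D ∧ W ∩ G ⊆ D ∧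
      D ⊆ W ∧ 0 ≤ s ∧ s < 1 ∧ C ⊆ G ×ˢ Set.Iio s := by
  obtain ⟨G, D, hG, hGs, hD, hCG, hGD, hDW⟩ := hW.exists_semilinear_nhd
    (hC.image continuous_fst) (by rintro _ ⟨x, hx, rfl⟩; exact (hCW hx).1)
  obtain ⟨s, hs0, hs1, hs⟩ : ∃ s : ℝ, 0 ≤ s ∧ s < 1 ∧ ∀ x ∈ C, x.2 < s := by
    rcases C.eq_empty_or_nonempty with rfl | hne
    · exact ⟨0, le_rfl, one_pos, fun x hx => hx.elim⟩
    · obtain ⟨y, hy, hmax⟩ := hC.exists_isMaxOn hne continuous_snd.continuousOn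
      obtain ⟨s, hys, hs⟩ := exists_between (hCW hy).2.2
      exact ⟨s, (hCW hy).2.1.trans hys.le, hs, fun x hx => (hmax hx).trans_lt hys⟩
  exact ⟨G, D, s, hG, hGs, hD, hGD, hDW, hs0, hs1, fun x hx => ⟨hCG ⟨x, hx, rfl⟩, hs x hx⟩⟩

end PolyhedralNeighborhoods

/-! ### Complements of boxes in `W × [0, 1)` -/

section Boxes

variable {V : Type} {W D : Set V} {J : Set ℝ} {m : ℝ}

theorem mk_mem_sdiff_prod (hm : m ∈ Set.Ico (0 : ℝ) 1 \ J) {w : V} (hw : w ∈ W) :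
    (w, m) ∈ (W ×ˢ Set.Ico (0 : ℝ) 1) \ D ×ˢ J :=
  ⟨⟨hw, hm.1⟩, fun h => hm.2 h.2⟩

theorem combination_mem_sdiff_prod (hJ : Convex ℝ (Set.Ico (0 : ℝ) 1 \ J))
    (hm : m ∈ Set.Ico (0 : ℝ) 1 \ J) {x : V × ℝ} (hx : x ∈ (W ×ˢ Set.Ico (0 : ℝ) 1) \ D ×ˢ J)
    {u : ℝ} (hu : u ∈ Set.Icc (0 : ℝ) 1) :
    (x.1, (1 - u) * x.2 + u * m) ∈ (W ×ˢ Set.Ico (0 : ℝ) 1) \ D ×ˢ J := by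
  have h1 : 0 ≤ 1 - u := by linarith [hu.2]
  refine ⟨⟨hx.1.1, convex_Ico 0 1 hx.1.2 hm.1 h1 hu.1 (by ring)⟩, fun h => ?_⟩
  have hxJ : x.2 ∉ J := fun hJ' => hx.2 ⟨h.1, hJ'⟩
  exact (hJ ⟨hx.1.2, hxJ⟩ hm h1 hu.1 (by ring)).2 h.2

variable [TopologicalSpace V]

/-- Pushing the complement of a box to a level of `W × [0, 1)`. -/
def sdiffProdHomotopyEquiv (D : Set V) (hJ : Convex ℝ (Set.Ico (0 : ℝ) 1 \ J))
    (hm : m ∈ Set.Ico (0 : ℝ) 1 \ J) :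
    ContinuousMap.HomotopyEquiv ↥((W ×ˢ Set.Ico (0 : ℝ) 1) \ D ×ˢ J) W where
  toFun := ⟨fun x => ⟨x.1.1, x.2.1.1⟩, by fun_prop⟩
  invFun := ⟨fun w => ⟨(w, m), mk_mem_sdiff_prod hm w.2⟩, by fun_prop⟩
  left_inv := by
    refine ContinuousMap.Homotopic.symm ⟨?_⟩
    exact
      { toFun := fun p => ⟨(p.2.1.1, (1 - (p.1 : ℝ)) * p.2.1.2 + p.1 * m),
          combination_mem_sdiff_prod hJ hm p.2.2 p.1.2⟩
        continuous_toFun := by fun_prop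
        map_zero_left := fun x => Subtype.ext (Prod.ext rfl (by simp))
        map_one_left := fun x => Subtype.ext (Prod.ext rfl (by simp)) }
  right_inv := by
    have h : ∀ f : C(W, W), (∀ w, f w = w) → f.Homotopic (ContinuousMap.id W) := fun f hf => by
      rw [show f = ContinuousMap.id W from ContinuousMap.ext hf]
    exact h _ fun w => rfl

theorem isPreconnected_sdiff_prod (D : Set V) (hW : IsConnected W)
    (hJ : Convex ℝ (Set.Ico (0 : ℝ) 1 \ J)) (hm : m ∈ Set.Ico (0 : ℝ) 1 \ J) :
    IsPreconnected ((W ×ˢ Set.Ico (0 : ℝ) 1) \ D ×ˢ J) := by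
  obtain ⟨w₀, hw₀⟩ := hW.nonempty
  refine isPreconnected_of_forall (w₀, m) fun x hx => ?_
  refine ⟨(fun w => (w, m)) '' W ∪ (fun u : ℝ => (x.1, (1 - u) * x.2 + u * m)) '' Set.Icc 0 1,
    ?_, .inl ⟨w₀, hw₀, rfl⟩, .inr ⟨0, ⟨le_rfl, zero_le_one⟩, by simp⟩, ?_⟩
  · rintro _ (⟨w, hw, rfl⟩ | ⟨u, hu, rfl⟩)
    · exact mk_mem_sdiff_prod hm hw
    · exact combination_mem_sdiff_prod hJ hm hx hu
  · refine IsPreconnected.union (x.1, m) ⟨x.1, hx.1.1, rfl⟩ ⟨1, ⟨zero_le_one, le_rfl⟩, by simp⟩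
      (hW.isPreconnected.image _ (by fun_prop)) (isPreconnected_Icc.image _ (by fun_prop))

theorem convex_Ico_sdiff_Iio {s : ℝ} (hs : 0 ≤ s) : Convex ℝ (Set.Ico (0 : ℝ) 1 \ Set.Iio s) := by
  have : Set.Ico (0 : ℝ) 1 \ Set.Iio s = Set.Ico s 1 := by
    ext x
    simp only [Set.mem_sdiff, Set.mem_Ico, Set.mem_Iio, not_lt]
    exact ⟨fun h => ⟨h.2, h.1.2⟩, fun h => ⟨⟨hs.trans h.1, h.2⟩, h.1⟩⟩
  rw [this]
  exact convex_Ico _ _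

theorem convex_Ico_sdiff_Icc {s : ℝ} (hs : 0 ≤ s) :
    Convex ℝ (Set.Ico (0 : ℝ) 1 \ Set.Icc 0 s) := by
  have : Set.Ico (0 : ℝ) 1 \ Set.Icc 0 s = Set.Ioo s 1 := by
    ext x
    simp only [Set.mem_sdiff, Set.mem_Ico, Set.mem_Icc, Set.mem_Ioo, not_and, not_le]
    exact ⟨fun h => ⟨h.2 h.1.1, h.1.2⟩, fun h => ⟨⟨hs.trans h.1.le, h.2⟩, fun _ => h.1⟩⟩
  rw [this]
  exact convex_Ioo _ _

theorem midpoint_mem_sdiff_Icc {s : ℝ} (hs : 0 ≤ s) (hs1 : s < 1) :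
    (s + 1) / 2 ∈ Set.Ico (0 : ℝ) 1 \ Set.Icc 0 s :=
  ⟨⟨by linarith, by linarith⟩, fun h => by linarith [h.2]⟩

end Boxes

end EndTheory

end

noncomputable section

namespace EndTheory

/-! ### Vanishing of Wall's finiteness obstruction -/

section Vanishing

theorem FGProjComplex.eulerClass_eq_zero {R : Type} [Ring R] (Q : FGProjComplex R)
    (h : ∀ i, Module.Free R (Q.complex.X i)) : Q.eulerClass = 0 := by
  refine Finset.sum_eq_zero fun i _ => ?_
  have := h i
  have := Q.finite i
  have := Q.projective i
  have e : Q.complex.X i ≃ₗ[R] (Fin (Fintype.card (Module.Free.ChooseBasisIndex R (Q.complex.X i)))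
      → R) :=
    ((Module.Free.chooseBasis R (Q.complex.X i)).reindex (Fintype.equivFin _)).equivFun
  have hz : KTilde.of (@FGProj.mk R _ (Q.complex.X i) _ _ (Q.finite i) (Q.projective i)) = 0 :=
    Quotient.sound ((FGProj.stablyEquiv_of_equiv (N := FGProj.free R _) e).trans
      (FGProj.free_equiv_zero _))
  rw [hz, smul_zero]

theorem isFinitenessObstructionAt_zero {X : Type} [TopologicalSpace X] {x₀ : X}
    (h : IsFiniteTypeOver (ContinuousMap.id X) x₀ Set.univ) : IsFinitenessObstructionAt X x₀ 0 := by
  obtain ⟨Q, q, hQ, hq⟩ : HasFiniteFreeType (coverChains X x₀) :=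
    HasFiniteFreeType.of_quasiIso h _ (quasiIso_overSetToCover X x₀)
  have := hQ.projective
  have := coverChains_projective X x₀
  obtain ⟨e, -⟩ := (ChainComplex.quasiIso_iff_of_projective q).1 hq
  obtain ⟨b, hb⟩ := hQ.bounded
  refine ⟨⟨Q, hQ.finite, fun i => ?_, b, hb⟩, ⟨e.symm⟩,
    (FGProjComplex.eulerClass_eq_zero _ hQ.free).symm⟩
  have := hQ.free i
  exact Module.Projective.of_free

end Vanishing

/-! ### The product with a half-open interval -/

section Product

variable {V : Type} [NormedAddCommGroup V] [NormedSpace ℝ V] [FiniteDimensional ℝ V] {W : Set V}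

theorem IsPolyhedron.exists_closed_box (hW : IsPolyhedron W) {C : Set (V × ℝ)}
    (hC : IsCompact C) (hCW : C ⊆ W ×ˢ Set.Ico (0 : ℝ) 1) :
    ∃ (D : Set V) (s : ℝ), IsCompactPolyhedron D ∧ D ⊆ W ∧ 0 ≤ s ∧ s < 1 ∧
      C ⊆ D ×ˢ Set.Icc 0 s := by
  obtain ⟨G, D, s, -, -, hD, hGD, hDW, hs0, hs1, hCG⟩ := hW.exists_box hC hCW
  exact ⟨D, s, hD, hDW, hs0, hs1, fun x hx =>
    ⟨hGD ⟨(hCW hx).1, (hCG hx).1⟩, (hCW hx).2.1, le_of_lt (hCG hx).2⟩⟩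

/-- Every compact subset of `W × [0, 1)` lies in a compact subset with connected complement. -/
theorem exists_isCompact_isConnected_sdiff (hW : IsPolyhedron W) (hc : IsConnected W)
    {C : Set (V × ℝ)} (hC : IsCompact C) (hCW : C ⊆ W ×ˢ Set.Ico (0 : ℝ) 1) :
    ∃ T, IsCompact T ∧ C ⊆ T ∧ T ⊆ W ×ˢ Set.Ico (0 : ℝ) 1 ∧
      IsConnected ((W ×ˢ Set.Ico (0 : ℝ) 1) \ T) := by
  obtain ⟨D, s, hD, hDW, hs0, hs1, hCT⟩ := hW.exists_closed_box hC hCW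
  obtain ⟨w, hw⟩ := hc.nonempty
  have hm := midpoint_mem_sdiff_Icc hs0 hs1
  exact ⟨D ×ˢ Set.Icc 0 s, hD.isCompact.prod isCompact_Icc, hCT,
    Set.prod_mono hDW fun u hu => ⟨hu.1, hu.2.trans_lt hs1⟩, ⟨_, mk_mem_sdiff_prod hm hw⟩,
    isPreconnected_sdiff_prod D hc (convex_Ico_sdiff_Icc hs0) hm⟩

/-- A space in which compact subsets are contained in compact subsets with connected complement is
one-ended. -/
theorem isOneEnded_of_isConnected_sdiff {E : Type} [TopologicalSpace E] {P : Set E}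
    (h : ∀ C, IsCompact C → C ⊆ P → ∃ T, IsCompact T ∧ C ⊆ T ∧ T ⊆ P ∧ IsConnected (P \ T)) :
    IsOneEnded P := by
  have h' : ∀ C : {C : Set E // IsCompact C ∧ C ⊆ P}, ∃ T, IsCompact T ∧ C.1 ⊆ T ∧ T ⊆ P ∧
      IsConnected (P \ T) := fun C => h C.1 C.2.1 C.2.2
  choose T hT hCT hTP hconn using h'
  choose z hz using fun C => (hconn C).nonempty
  have hsub : ∀ C, P \ T C ⊆ connectedComponentIn (P \ C.1) (z C) := fun C =>
    (hconn C).isPreconnected.subset_connectedComponentIn (hz C)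
      (Set.sdiff_subset_sdiff_right (hCT C))
  refine ⟨fun C => connectedComponentIn (P \ C.1) (z C),
    ⟨fun C => ⟨z C, Set.sdiff_subset_sdiff_right (hCT C) (hz C), rfl⟩, fun C D hCD => ?_⟩, ?_⟩
  · obtain ⟨S, -, hTS, -, hS⟩ := h (T C ∪ T D) ((hT C).union (hT D))
      (Set.union_subset (hTP C) (hTP D))
    obtain ⟨x, hxP, hxS⟩ := hS.nonempty
    have hxC := hsub C ⟨hxP, fun hx => hxS (hTS (.inl hx))⟩
    have hxD := hsub D ⟨hxP, fun hx => hxS (hTS (.inr hx))⟩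
    change connectedComponentIn (P \ D.1) (z D) ⊆ connectedComponentIn (P \ C.1) (z C)
    rw [connectedComponentIn_eq hxC, connectedComponentIn_eq hxD]
    exact connectedComponentIn_mono x (Set.sdiff_subset_sdiff_right hCD)
  · rintro ε ⟨hε, hmono⟩
    funext C
    obtain ⟨x, -, hx⟩ := hε C
    obtain ⟨y, hy, hy'⟩ := hε ⟨T C, hT C, hTP C⟩
    have hyC : y ∈ ε C := hmono C ⟨T C, hT C, hTP C⟩ (hCT C) (by
      rw [hy']
      exact mem_connectedComponentIn hy)
    rw [hx] at hyC ⊢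
    rw [connectedComponentIn_eq hyC, connectedComponentIn_eq (hsub C hy)]

theorem HasFiniteHomotopyType.isFinitelyDominated {X : Type} [TopologicalSpace X]
    (h : HasFiniteHomotopyType X) : IsFinitelyDominated X := by
  obtain ⟨k, K, hK, ⟨e⟩⟩ := h
  exact ⟨k, K, hK, e.toFun, e.invFun, e.left_inv⟩

theorem HasFiniteHomotopyType.of_homotopyEquiv {X Y : Type} [TopologicalSpace X]
    [TopologicalSpace Y] (h : HasFiniteHomotopyType Y) (e : ContinuousMap.HomotopyEquiv X Y) :
    HasFiniteHomotopyType X := by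
  obtain ⟨k, K, hK, ⟨e'⟩⟩ := h
  exact ⟨k, K, hK, ⟨e.trans e'⟩⟩

theorem HasFiniteHomotopyType.isFiniteTypeOver {X Y : Type} [TopologicalSpace X]
    [TopologicalSpace Y] (h : HasFiniteHomotopyType Y) (φ : C(Y, X)) (x₀ : X) :
    IsFiniteTypeOver φ x₀ Set.univ := by
  obtain ⟨k, K, hK, ⟨e⟩⟩ := h
  refine IsFiniteTypeOver.of_homotopyEquiv e.symm φ ?_
  have := hK.isSemilinear.isFiniteTypeOver (x₀ := x₀) subset_rfl (φ.comp e.symm.toFun)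
  rwa [Subtype.coe_preimage_self] at this

theorem isInwardTame_prod_Ico (hW : IsPolyhedron W) (hfin : HasFiniteHomotopyType W) :
    IsInwardTame (W ×ˢ Set.Ico (0 : ℝ) 1) := by
  refine ⟨hW.prod_Ico, fun C hC hCW => ?_⟩
  obtain ⟨G, D, s, hG, hGs, hD, hGD, hDW, hs0, hs1, hCG⟩ := hW.exists_box hC hCW
  have hopen : IsOpen (G ×ˢ Set.Iio s) := hG.prod isOpen_Iio
  refine ⟨(W ×ˢ Set.Ico (0 : ℝ) 1) \ G ×ˢ Set.Iio s,
    ⟨Set.sdiff_subset, hW.prod_Ico.sdiff hopen (hGs.prod (isSemilinear_Iio s)),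
      ⟨(G ×ˢ Set.Iio s)ᶜ, hopen.isClosed_compl, Set.sdiff_eq _ _⟩,
      ⟨D ×ˢ Set.Icc 0 s, hD.isCompact.prod isCompact_Icc,
        Set.prod_mono hDW fun u hu => ⟨hu.1, hu.2.trans_lt hs1⟩, ?_⟩⟩,
    Set.disjoint_left.2 fun x hx hxC => hx.2 (hCG hxC), ?_⟩
  · rintro x ⟨hx, hx'⟩
    have hxG : x ∈ G ×ˢ Set.Iio s := by
      by_contra h
      exact hx' ⟨hx, h⟩
    exact ⟨hGD ⟨hx.1, hxG.1⟩, hx.2.1, le_of_lt hxG.2⟩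
  · exact (hfin.of_homotopyEquiv (sdiffProdHomotopyEquiv G (convex_Ico_sdiff_Iio hs0)
      ⟨⟨hs0, hs1⟩, lt_irrefl s⟩)).isFinitelyDominated

/-- The chains of the universal cover of a polyhedral neighborhood of infinity in `W × [0, 1)` are
of finite free type. -/
theorem isFiniteTypeOver_nhdOfInfinity (hW : IsPolyhedron W) (hfin : HasFiniteHomotopyType W)
    {N : Set (V × ℝ)} (hN : IsPolyhedralNhdOfInfinity (W ×ˢ Set.Ico (0 : ℝ) 1) N) (x₀ : N) :
    IsFiniteTypeOver (ContinuousMap.id N) x₀ Set.univ := by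
  obtain ⟨C, hC, hCW, hNC⟩ := hN.cocompact
  obtain ⟨D, s, hD, hDW, hs0, hs1, hCT⟩ := hW.exists_closed_box hC hCW
  set T := D ×ˢ Set.Icc 0 s with hTdef
  have hT : IsCompactPolyhedron T := hD.prod (isSemilinear_Icc 0 s) isCompact_Icc
  have hTP : T ⊆ W ×ˢ Set.Ico (0 : ℝ) 1 :=
    Set.prod_mono hDW fun u hu => ⟨hu.1, hu.2.trans_lt hs1⟩
  obtain ⟨A, hA, hNA⟩ := hN.closed
  have hZ : IsCompact (N ∩ T) := by
    have : N ∩ T = T ∩ A := by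
      rw [hNA]
      ext x
      exact ⟨fun h => ⟨h.2, h.1.2⟩, fun h => ⟨⟨hTP h.1, h.2⟩, h.1⟩⟩
    rw [this]
    exact hT.isCompact.inter_right hA
  obtain ⟨G, L, hG, hGs, hL, hZG, hGL, hLN⟩ :=
    hN.polyhedron.exists_semilinear_nhd hZ Set.inter_subset_left
  have hsub : (W ×ˢ Set.Ico (0 : ℝ) 1) \ T ⊆ N := fun x hx => by
    by_contra h
    exact hx.2 (hCT (hNC ⟨hx.1, h⟩))
  have hNG : N ∩ G = L ∩ G := Set.Subset.antisymm (fun x hx => ⟨hGL hx, hx.2⟩)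
    (Set.inter_subset_inter_left _ hLN)
  have hNGs : IsSemilinear (N ∩ G) := hNG ▸ hL.isSemilinear.inter hGs
  have e₁ : (Subtype.val ⁻¹' ((W ×ˢ Set.Ico (0 : ℝ) 1) \ T) : Set N) = Subtype.val ⁻¹' Tᶜ := by
    ext x
    exact ⟨fun h => h.2, fun h => ⟨hN.subset x.2, h⟩⟩
  have e₂ : (Subtype.val ⁻¹' (N ∩ G) : Set N) = Subtype.val ⁻¹' G := Subtype.preimage_coe_self_inter N G
  have hUV : (Subtype.val ⁻¹' Tᶜ ∪ Subtype.val ⁻¹' G : Set N) = Set.univ := by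
    refine Set.eq_univ_of_forall fun x => ?_
    by_cases hx : x.1 ∈ T
    · exact .inr (hZG ⟨x.2, hx⟩)
    · exact .inl hx
  have hU : IsFiniteTypeOver (ContinuousMap.id N) x₀ (Subtype.val ⁻¹' Tᶜ) := by
    rw [← e₁]
    exact .of_subset hsub ((hfin.of_homotopyEquiv (sdiffProdHomotopyEquiv D
      (convex_Ico_sdiff_Icc hs0) (midpoint_mem_sdiff_Icc hs0 hs1))).isFiniteTypeOver _ _)
  have hV : IsFiniteTypeOver (ContinuousMap.id N) x₀ (Subtype.val ⁻¹' G) := by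
    rw [← e₂]
    exact hNGs.isFiniteTypeOver Set.inter_subset_left _
  have hI : IsFiniteTypeOver (ContinuousMap.id N) x₀ (Subtype.val ⁻¹' Tᶜ ∩ Subtype.val ⁻¹' G) := by
    rw [← e₂, ← Set.preimage_inter, Set.inter_comm]
    exact (hNGs.diff hT.isSemilinear).isFiniteTypeOver
      (Set.inter_subset_left.trans Set.inter_subset_left) _
  rw [← hUV]
  refine IsFiniteTypeOver.union (hT.isCompact.isClosed.isOpen_compl.preimage continuous_subtype_val)
    (hG.preimage continuous_subtype_val) ?_ ?_ hU hV hI <;> rw [hUV, Set.univ_inter]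

end Product

end EndTheory

end

theorem mainTheorem10 (n d : ℕ) (W : Set (EuclideanSpace ℝ (Fin d)))
    (hW : EndTheory.IsOpenPLManifold n W) (hconn : IsConnected W)
    (hfin : EndTheory.HasFiniteHomotopyType W) :
    EndTheory.IsOneEnded (W ×ˢ Set.Ico (0 : ℝ) 1) ∧
    EndTheory.IsInwardTame (W ×ˢ Set.Ico (0 : ℝ) 1) ∧
    ∀ 𝒩 : EndTheory.CofinalSequence (W ×ˢ Set.Ico (0 : ℝ) 1),
      EndTheory.IsEndObstruction 𝒩 0 := by
  have hP : EndTheory.IsPolyhedron W := hW.1.1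
  exact ⟨EndTheory.isOneEnded_of_isConnected_sdiff fun C hC hCW =>
      EndTheory.exists_isCompact_isConnected_sdiff hP hconn hC hCW,
    EndTheory.isInwardTame_prod_Ico hP hfin,
    fun 𝒩 i c => EndTheory.isFinitenessObstructionAt_zero
      (EndTheory.isFiniteTypeOver_nhdOfInfinity hP hfin (𝒩.isNhd i) _)⟩
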